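/- **Setting.** Let $u$ be an admissible function: (eventually) positive and nondecreasing, $u(r)=o(r)$ and $\limsup_{r\to\infty}u(2r)/u(r)<\infty$. Let $\mathcal O^+(u)$ be the set of functions $k:\mathbf Z_{\ge n_k}\to\mathbf Z_{\ge 0}$ (for some $n_k\in\mathbf Z$) with $k=O(u)$. *Ball structures.* A ball structure on a set $Z$ is a set $\beta$ of abstract balls with a realization $b\mapsto\widehat b\in\mathcal P(Z)\setminus\{\emptyset\}$, a level $\delta:\beta\to\mathbf Z$ and an action $(k,b)\mapsto k.b$ of $\mathbf Z_{\ge0}$ with $\delta(k.b)=\delta(b)-k$. It is an $O(u)$-quasisymmetric structure if, for all $b,b'\in\beta$ and $k\in\mathbf Z_{\ge 0}$: (1) $\widehat b\subseteq\widehat{k.b}$; $\widehat b\subseteq\widehat{b'}$ implies $\widehat{k.b}\subseteq\widehat{k.b'}$; $\delta(b)<\delta(b')$ implies $\widehat b\not\subseteq\widehat{b'}$; (2) there is $q\in\mathcal O^+(u)$, with $n_q\ge 0$, such that $n_q\le\delta(b)\le\delta(b')$ and $\widehat b\cap\widehat{b'}\ne\emptyset$ imply $\widehat{b'}\subseteq\widehat{q(\delta(b)).b}$;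 (3) for all $x\ne y$ in $Z$ and $n\in\mathbf Z$ there is $b$ with $\delta(b)\ge n$, $x\in\widehat b$, $y\notin\widehat b$. For $\Omega\subseteq Z$, the restriction $\beta_{|\Omega}$ is the ball structure on $\Omega$ consisting of the $b\in\beta$ with $\widehat{k.b}\cap\Omega\neq\emptyset$ for all $k\ge0$, realized as $\widehat b\cap\Omega$, with the same level and shift. *Conformal dimension.* For $k\in\mathcal O^+(u)$ and $\delta(b)\ge n_k$ put $k.b=k(\delta(b)).b$. A set $a\subseteq Z$ is $(k,n)$-round if $\widehat b\subseteq a\subseteq\widehat{k.b}$ for some $b$ with $\delta(b)\ge\max(n,n_k)$; a pair $(a,a')$ is a $k$-ring if $\widehat b\subseteq a\subseteq a'\subseteq\widehat{k.b}$ for some $b$ with $\delta(b)\ge n_k$. For a function $\psi:\mathcal P(Z)\to[0,\infty]$, $p>0$ and $A\subseteq Z$ let $$\Psi_{p;k}(A)=\lim_{n\to\infty}\ \inf\Big\{\sum_{a\in\mathscr F}\psi(a)^p:\ \mathscr F\text{ a countable covering of }A\text{ by }(k,n)\text{-round sets}\Big\}.$$ For a gauge $\phi:\mathcal P(Z)\to[0,\infty)$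 let $\widetilde\phi^{\ell}(a)=\sup\{\phi(a'):(a,a')\text{ an }\ell\text{-ring}\}$ (and $0$ if there is none), and write $\Phi$, $\widetilde\Phi^{\ell}$ for $\Psi$ with $\psi=\phi$, $\psi=\widetilde\phi^{\ell}$. For a family $\Gamma$ of subsets of $Z$ let $$\operatorname{mod}^{\ell,m}_{p;k}(\Gamma,\beta)=\inf\{\widetilde\Phi^{\ell}_{p;k}(Z):\ \Phi_{1;m}(\gamma)\ge1\text{ for all }\gamma\in\Gamma\}.$$ When $Z$ is a topological space, $\operatorname{Cdim}_{O(u)}(\beta)\in[0,\infty]$ is the supremum ($0$ if there is none) of the real $p>0$ such that for every $k\in\mathcal O^+(u)$ there are $\ell,m\in\mathcal O^+(u)$ with $\operatorname{mod}^{\ell,m}_{p;k}(\Gamma,\beta)=+\infty$, where $\Gamma$ is the family of all nonconstant curves in $Z$ (images, with more than one point, of intervals of $\mathbf R$ under continuous maps). **Proposition.** Let $S=N\rtimes\mathbf R$ be a purely real Heintze group of diagonalizable type with data $(N,\alpha)$: $N$ is a simply connected nilpotent Lie group, $\alpha$ is a derivation of its Lie algebra that is diagonalizable over $\mathbf R$,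 and $t\in\mathbf R$ acts on $N$ by the automorphism $e^{t\alpha}$ whose differential at $1_N$ is $\exp(t\alpha)$. Assume that the lowest eigenvalue of $\alpha$ is $1$. Let $B\subset N$ be compact and connected, with $1_N$ in its interior, and such that the ball structure $\beta^*=N\times\mathbf Z$ generated by $B$ on the punctured boundary $\partial_\infty^*S=N$, $$\widehat{(x,n)}=x\,e^{-n\alpha}(B),\qquad \delta(x,n)=n,\qquad k.(x,n)=(x,n-k),$$ is an $O(1)$-quasisymmetric structure. Then for every admissible $u$ and every nonempty open subset $\Omega$ of $N$, $$\operatorname{Cdim}_{O(u)}(\beta^*_{|\Omega})=\operatorname{tr}(\alpha).$$ -/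

import Mathlib

open scoped Manifold ContDiff ENNReal NNReal
open Filter Asymptotics

noncomputable section

/-! ### Admissible functions and the semigroup of gauges of asphericity -/

/-- Admissible functions on a half-line: positive, nondecreasing, strictly sublinear and with
`limsup u (2 r) / u r < ∞`. Only the behaviour for large `r` matters, so that `log` and the
constant `1` are both admissible. -/
structure IsAdmissible (u : ℝ → ℝ) : Prop where
  eventually_pos : ∀ᶠ r in atTop, 0 < u r
  eventually_mono : ∃ R : ℝ, MonotoneOn u (Set.Ici R)
  sublinear : u =o[atTop] (fun r : ℝ => r)
  doubling : (fun r : ℝ => u (2 * r)) =O[atTop] u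

/-- Functions valued in the nonnegative integers, defined on all the integers `≥ start`, that are
`O(u)` at `+∞`. The values of `toFun` below `start` are never used. -/
structure OPlus (u : ℝ → ℝ) where
  start : ℤ
  toFun : ℤ → ℕ
  isBigO : (fun n : ℤ => (toFun n : ℝ)) =O[atTop] (fun n : ℤ => u (n : ℝ))

/-! ### Quasisymmetric structures -/

universe v

/-- A set of abstract balls over `Z` with a realization map to the nonempty subsets of `Z`, a
level map `δ` to the integers, and an action of the nonnegative integers for which `δ` is
equivariant. -/
structure BallStructure (Z : Type v) where
  Ball : Type v
  real : Ball → Set Z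
  real_nonempty : ∀ b, (real b).Nonempty
  level : Ball → ℤ
  shift : ℕ → Ball → Ball
  shift_zero : ∀ b, shift 0 b = b
  shift_shift : ∀ k' k b, shift k' (shift k b) = shift (k' + k) b
  level_shift : ∀ k b, level (shift k b) = level b - k

namespace BallStructure

variable {Z : Type v}

/-- The remaining axioms of an `O(u)`-quasisymmetric structure. -/
structure IsQuasisymmetric (u : ℝ → ℝ) (β : BallStructure Z) : Prop where
  subset_shift : ∀ (k : ℕ) (b : β.Ball), β.real b ⊆ β.real (β.shift k b)
  shift_mono : ∀ (k : ℕ) (b b' : β.Ball), β.real b ⊆ β.real b' →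
    β.real (β.shift k b) ⊆ β.real (β.shift k b')
  not_subset : ∀ b b' : β.Ball, β.level b < β.level b' → ¬ β.real b ⊆ β.real b'
  engulf : ∃ q : OPlus u, 0 ≤ q.start ∧ ∀ b b' : β.Ball,
    q.start ≤ β.level b → β.level b ≤ β.level b' → (β.real b ∩ β.real b').Nonempty →
      β.real b' ⊆ β.real (β.shift (q.toFun (β.level b)) b)
  separated : ∀ x y : Z, y ≠ x → ∀ n : ℤ, ∃ b : β.Ball,
    n ≤ β.level b ∧ x ∈ β.real b ∧ y ∉ β.real b

/-- The structure induced on a subset `Ω`: the abstract balls all of whose shifts meet `Ω`, with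
the realizations intersected with `Ω`. -/
def restrict (β : BallStructure Z) (Ω : Set Z) : BallStructure Ω where
  Ball := {b : β.Ball // ∀ k : ℕ, (β.real (β.shift k b) ∩ Ω).Nonempty}
  real b := {z : Ω | (z : Z) ∈ β.real b.1}
  real_nonempty b := by
    obtain ⟨z, hz, hΩ⟩ := b.2 0
    rw [β.shift_zero] at hz
    exact ⟨⟨z, hΩ⟩, hz⟩
  level b := β.level b.1
  shift k b := ⟨β.shift k b.1, fun j => by rw [β.shift_shift]; exact b.2 (j + k)⟩
  shift_zero b := Subtype.ext (β.shift_zero b.1)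
  shift_shift k' k b := Subtype.ext (β.shift_shift k' k b.1)
  level_shift k b := β.level_shift k b.1

variable (β : BallStructure Z) {u : ℝ → ℝ}

/-- The ball `k.b`, where `k` is evaluated at the level of `b`. -/
def dilate (k : OPlus u) (b : β.Ball) : β.Ball := β.shift (k.toFun (β.level b)) b

/-- `a` is a `(k,n)`-round set: `b ⊆ a ⊆ k.b` for some ball `b` of level at least `n`
(and in the domain of `k`). -/
def IsRound (k : OPlus u) (n : ℤ) (a : Set Z) : Prop :=
  ∃ b : β.Ball, n ≤ β.level b ∧ k.start ≤ β.level b ∧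
    β.real b ⊆ a ∧ a ⊆ β.real (β.dilate k b)

/-- `(a, a')` is a `k`-ring: `b ⊆ a ⊆ a' ⊆ k.b` for some ball `b` whose level is in the
domain of `k`. -/
def IsRing (k : OPlus u) (a a' : Set Z) : Prop :=
  ∃ b : β.Ball, k.start ≤ β.level b ∧
    β.real b ⊆ a ∧ a ⊆ a' ∧ a' ⊆ β.real (β.dilate k b)

/-- The shifted gauge: the supremum of `φ a'` over the `ℓ`-rings `(a, a')` (`0` if there is
none). -/
def shiftedGauge (ℓ : OPlus u) (φ : Set Z → ℝ≥0∞) (a : Set Z) : ℝ≥0∞ :=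
  ⨆ (a' : Set Z) (_ : β.IsRing ℓ a a'), φ a'

/-- The infimum of `∑ ψ(a)^p` over the countable coverings of `A` by `(k,n)`-round sets. -/
def preCaratheodory (ψ : Set Z → ℝ≥0∞) (p : ℝ) (k : OPlus u) (n : ℤ) (A : Set Z) : ℝ≥0∞ :=
  ⨅ (F : Set (Set Z)) (_ : F.Countable) (_ : ∀ a ∈ F, β.IsRound k n a) (_ : A ⊆ ⋃₀ F),
    ∑' a : F, ψ a ^ p

/-- The Carathéodory measure, the limit of `preCaratheodory` as `n → ∞`; the latter is
nondecreasing in `n`, so that the limit is the supremum. -/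
def caratheodory (ψ : Set Z → ℝ≥0∞) (p : ℝ) (k : OPlus u) (A : Set Z) : ℝ≥0∞ :=
  ⨆ n : ℤ, β.preCaratheodory ψ p k n A

/-- A gauge `φ`, a finite nonnegative function of subsets, is `m`-admissible for `Γ` if every
member of `Γ` has `φ`-length at least `1`. -/
def AdmissibleGauge (m : OPlus u) (Γ : Set (Set Z)) (φ : Set Z → ℝ≥0) : Prop :=
  ∀ γ ∈ Γ, 1 ≤ β.caratheodory (fun a => (φ a : ℝ≥0∞)) 1 m γ

/-- The combinatorial modulus of `Γ` with parameters `p`, `k`, `ℓ`, `m`. -/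
def modulus (p : ℝ) (k ℓ m : OPlus u) (Γ : Set (Set Z)) : ℝ≥0∞ :=
  ⨅ (φ : Set Z → ℝ≥0) (_ : β.AdmissibleGauge m Γ φ),
    β.caratheodory (β.shiftedGauge ℓ (fun a => (φ a : ℝ≥0∞))) p k Set.univ

variable (u) in
/-- The `O(u)`-conformal dimension of `β` with respect to a family `Γ` of subsets, in `[0, ∞]`:
the supremum of the `p > 0` such that for every `k` there are `ℓ` and `m` for which the modulus is
infinite (`0` if there is no such `p`). -/
def conformalDimension (Γ : Set (Set Z)) : ℝ≥0∞ :=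
  ⨆ (p : ℝ) (_ : 0 < p ∧ ∀ k : OPlus u, ∃ ℓ m : OPlus u, β.modulus p k ℓ m Γ = ⊤),
    ENNReal.ofReal p

end BallStructure

/-- The nonconstant curves in a topological space, as subsets: the images with at least two points
of continuous maps from an interval of the real line. -/
def nonconstantCurves (X : Type*) [TopologicalSpace X] : Set (Set X) :=
  {γ | γ.Nontrivial ∧ ∃ (J : Set ℝ) (c : ℝ → X), J.OrdConnected ∧ ContinuousOn c J ∧ γ = c '' J}

/-! ### Heintze groups -/

/-- Makes the Lie algebra of a smooth real Lie group available. -/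
instance instLEInftyMinSmoothness : ENat.LEInfty (minSmoothness ℝ 3) :=
  ⟨by rw [minSmoothness_of_isRCLikeNormedField]; exact ENat.LEInfty.out⟩

/-- Finite-dimensional real normed spaces are complete. -/
instance instCompleteSpaceOfFiniteDimensional (E : Type*) [NormedAddCommGroup E]
    [NormedSpace ℝ E] [FiniteDimensional ℝ E] : CompleteSpace E :=
  FiniteDimensional.complete ℝ E

/-- The exponential of an endomorphism of a finite-dimensional real vector space. -/
def expEnd {E : Type*} [NormedAddCommGroup E] [NormedSpace ℝ E] [FiniteDimensional ℝ E]
    (L : E →ₗ[ℝ] E) : E →L[ℝ] E :=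
  NormedSpace.exp (LinearMap.toContinuousLinearMap L)

/-- The data `(N, α)` of a Lie group `S = N ⋊ ℝ`, where `N` is a Lie group: a derivation `α` of
the Lie algebra of `N`, and the smooth action of `ℝ` on `N` by the automorphisms `e^{tα}`, that
is, by the automorphisms of `N` whose differential at the identity is the linear map
`exp (t α)`. -/
structure HeintzeData (E : Type*) [NormedAddCommGroup E] [NormedSpace ℝ E]
    [FiniteDimensional ℝ E] (N : Type v) [TopologicalSpace N] [ChartedSpace E N] [Group N]
    [LieGroup 𝓘(ℝ, E) ∞ N] where
  α : LieDerivation ℝ (GroupLieAlgebra 𝓘(ℝ, E) N) (GroupLieAlgebra 𝓘(ℝ, E) N)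
  action : Multiplicative ℝ →* MulAut N
  smooth_action : ContMDiff (𝓘(ℝ, ℝ).prod 𝓘(ℝ, E)) 𝓘(ℝ, E) ∞
    (fun z : ℝ × N => action (Multiplicative.ofAdd z.1) z.2)
  mfderiv_action : ∀ (t : ℝ) (w : GroupLieAlgebra 𝓘(ℝ, E) N),
    mfderiv 𝓘(ℝ, E) 𝓘(ℝ, E) (fun x : N => action (Multiplicative.ofAdd t) x) 1 w =
      expEnd (E := E) (t • α.toLinearMap) w

namespace HeintzeData

variable {E : Type*} [NormedAddCommGroup E] [NormedSpace ℝ E] [FiniteDimensional ℝ E]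
  {N : Type v} [TopologicalSpace N] [ChartedSpace E N] [Group N] [LieGroup 𝓘(ℝ, E) ∞ N]
  (S : HeintzeData E N)

/-- The semidirect product `N ⋊ ℝ`. -/
abbrev group : Type v := N ⋊[S.action] Multiplicative ℝ

/-- The derivation `α` as a linear endomorphism of the Lie algebra of `N`. -/
def endα : Module.End ℝ (GroupLieAlgebra 𝓘(ℝ, E) N) := S.α.toLinearMap

/-- The automorphism `e^{tα}` of `N`. -/
def dilation (t : ℝ) : MulAut N := S.action (Multiplicative.ofAdd t)

/-- `N ⋊ ℝ` is a purely real Heintze group of diagonalizable type, normalized so that the lowest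
eigenvalue is `1`: the group `N` is simply connected and nilpotent, `α` is diagonalizable over the
real numbers, and its smallest eigenvalue is `1`. -/
structure IsNormalizedDiagonalizable : Prop where
  simplyConnected : SimplyConnectedSpace N
  nilpotent : Group.IsNilpotent N
  diagonalizable : ⨆ μ : ℝ, S.endα.eigenspace μ = ⊤
  lowest : IsLeast {μ : ℝ | S.endα.HasEigenvalue μ} 1

/-- The ball structure on `N` (the boundary of `N ⋊ ℝ` punctured at its focal point) generated by
`B`: the balls are the pairs `(x, n)` with realization `x · e^{-nα}(B)`, level `n`, and shift
`k.(x, n) = (x, n - k)`. -/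
def generated (B : Set N) (hB : B.Nonempty) : BallStructure N where
  Ball := N × ℤ
  real b := (fun y : N => b.1 * S.dilation (-(b.2 : ℝ)) y) '' B
  real_nonempty _ := hB.image _
  level b := b.2
  shift k b := (b.1, b.2 - k)
  shift_zero b := by simp
  shift_shift k' k b := by
    refine Prod.ext rfl ?_
    push_cast
    ring
  level_shift _ _ := rfl

end HeintzeData

end

/-!
Write `h = tr α`, the sum of the eigenvalues `μ i ≥ 1` of `α`. In the coordinates of an eigenbasis,
the contraction `D = e^{-α}` is tangent at the identity to the diagonal map with entries
`exp (-μ i)`. A chart at the identity with this property, in which moreover small translations are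
close to the identity, is called a dilation chart (`IsDilationChart`). It makes it possible to
avoid the exponential map and the structure of nilpotent groups altogether: up to errors
`exp (ε n)`, balls `x (D ^ n B)` of level `n` centered near a given point have volume `exp (-h n)`
in the chart, hence a bounded region contains at most `exp (h n)` disjoint ones
(`exists_tsum_le_of_disjoint`) and is covered by that many (`exists_cover`). An element of
`OPlus u` is sublinear, so that dilating balls of level `n` only costs such an error.

*Upper bound.* Let `p > h`. Since all the eigenvalues are at least `1`, there is a bump function `f`
around the identity whose oscillation on balls of level `n` is at most of order `exp (-θ n)`, for
`θ < 1` close to `1` (`exists_bump`). Its left translates separate points, and the gauge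
`a ↦ osc (a) ^ θ`, where `osc (a)` is the largest oscillation of these translates on `a`, gives
length at least `1` to the curves: the image of a curve contains an interval, whose length is at
most the sum of the oscillations (`one_le_caratheodory_oscillation`). This gauge is therefore
admissible. On the other hand the cost of a ball of level `n` is about `exp (-p n)`, so the
coverings by `exp (h n)` balls show that the Carathéodory measure of exponent `p` is finite. Here
one uses `k = 0`; the axiom comparing the levels of nested balls controls the rings around the
covering balls, once the connectedness of `B` has been used to show that a small ball whose trace
on `Ω` is contained in a covering ball is itself contained in it (`modulus_zero_ne_top`).

*Lower bound.* Let `1 < p < h`. An eigenvector for the eigenvalue `1` generates an arc whose pieces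
of length `exp (-n)` are translates of parts of its image by `D ^ n` (`exists_arc`). The left
translates of this arc form a family of curves parametrized by an open set of starting points, and
the curves meeting a ball of level `n` start in a set of volume at most of order `exp (-(h - 1) n)`
(`exists_volume_tube_le`). Given an admissible gauge and a covering by round sets, a covering lemma
selects disjoint balls whose enlargements by a constant shift cover the curves; the round sets and
these enlargements form rings if `ℓ = m = k + Q` for a large constant `Q`. Integrating the lengths
of the curves over the starting points, one obtains `c ≤ ∑ φ (a') exp (-(h - 1) n)`, where
`∑ exp (-h n)` is bounded because the selected balls are disjoint; comparing `φ (a')` with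
`exp (-σ n)` for some `σ` between `1` and `(h - 1) / (p - 1)` shows that `∑ φ (a') ^ p` tends to
infinity as the balls get smaller (`caratheodory_univ_eq_top_of_selection`). If `h = 1`, the
exponent `p = 1` is used instead: there are arbitrarily many disjoint compact curves, each of length
at least `1` (`caratheodory_one_univ_eq_top`).
-/

noncomputable section

/-! ### Local coordinates adapted to the dilations -/

/-- The diagonal endomorphism of `ι → ℝ` with entries `exp (-μ i)`. -/
def diagExp {ι : Type*} [Fintype ι] (μ : ι → ℝ) : (ι → ℝ) →L[ℝ] (ι → ℝ) :=
  ContinuousLinearMap.pi fun i => Real.exp (-μ i) • ContinuousLinearMap.proj i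

/-- A chart `ψ` of a group around the identity, with values in `ι → ℝ`, in which the automorphism
`D` is tangent at the origin to the diagonal map `diagExp μ`, and in which the triple product
`(x, w, y) ↦ x w y` is strictly differentiable at the origin, with partial derivative the identity
with respect to the middle factor. -/
structure IsDilationChart {N : Type*} [TopologicalSpace N] [Group N] (D : MulAut N)
    {ι : Type*} [Fintype ι] (μ : ι → ℝ) (ψ : OpenPartialHomeomorph N (ι → ℝ)) : Prop where
  one_mem : (1 : N) ∈ ψ.source
  map_one : ψ 1 = 0
  strict_conj : HasStrictFDerivAt (fun z => ψ (D (ψ.symm z))) (diagExp μ) 0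
  strict_mul : ∃ M' : (ι → ℝ) × (ι → ℝ) × (ι → ℝ) →L[ℝ] (ι → ℝ),
    HasStrictFDerivAt (fun z : (ι → ℝ) × (ι → ℝ) × (ι → ℝ) =>
      ψ (ψ.symm z.1 * ψ.symm z.2.1 * ψ.symm z.2.2)) M' 0 ∧ ∀ w, M' (0, w, 0) = w

section LinearAlgebra

variable {E : Type*} [NormedAddCommGroup E] [NormedSpace ℝ E] [FiniteDimensional ℝ E]

theorem expEnd_apply_of_apply_eq_smul {L : E →ₗ[ℝ] E} {v : E} {c : ℝ} (h : L v = c • v) :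
    expEnd L v = Real.exp c • v := by
  have hpow : ∀ n : ℕ, (LinearMap.toContinuousLinearMap L ^ n) v = c ^ n • v := by
    intro n
    induction n with
    | zero => simp
    | succ n ih =>
      rw [pow_succ', mul_apply_eq_comp, ih, map_smul]
      simp [h, smul_smul, pow_succ]
  have h1 := NormedSpace.exp_series_hasSum_exp' (𝕂 := ℝ) (LinearMap.toContinuousLinearMap L)
  have h2 := h1.mapL (ContinuousLinearMap.apply ℝ E v)
  have h3 := (NormedSpace.exp_series_hasSum_exp' (𝕂 := ℝ) c).smul_const v
  rw [← Real.exp_eq_exp_ℝ] at h3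
  refine h2.unique ?_
  convert h3 using 2 with n
  simp [hpow, smul_smul]

theorem exists_eigenbasis (L : Module.End ℝ E) (h : ⨆ μ : ℝ, L.eigenspace μ = ⊤) :
    ∃ (ι : Type) (_ : Fintype ι) (μ : ι → ℝ) (b : Module.Basis ι ℝ E),
      ∀ i, L (b i) = μ i • b i := by
  classical
  have hint := DirectSum.isInternal_submodule_of_iSupIndep_of_iSup_eq_top
    L.eigenspaces_iSupIndep h
  let B := hint.collectedBasis (fun μ => Module.finBasis ℝ (L.eigenspace μ))
  have hfin : Finite (Σ μ : ℝ, Fin (Module.finrank ℝ (L.eigenspace μ))) :=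
    Module.Finite.finite_basis B
  let _ : Fintype (Σ μ : ℝ, Fin (Module.finrank ℝ (L.eigenspace μ))) := Fintype.ofFinite _
  refine ⟨_, inferInstance, fun i => i.1, B, fun i => ?_⟩
  have := hint.collectedBasis_mem (fun μ => Module.finBasis ℝ (L.eigenspace μ)) i
  exact Module.End.mem_eigenspace_iff.1 this

omit [FiniteDimensional ℝ E] in
theorem trace_eq_sum_of_eigenbasis {ι : Type*} [Fintype ι] (L : Module.End ℝ E) {μ : ι → ℝ}
    (b : Module.Basis ι ℝ E) (hb : ∀ i, L (b i) = μ i • b i) :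
    LinearMap.trace ℝ E L = ∑ i, μ i := by
  classical
  rw [LinearMap.trace_eq_matrix_trace ℝ b, Matrix.trace]
  refine Finset.sum_congr rfl fun i _ => ?_
  simp [LinearMap.toMatrix_apply, hb]

end LinearAlgebra

section Charts

variable {E : Type*} [NormedAddCommGroup E] [NormedSpace ℝ E] [FiniteDimensional ℝ E]
  {N : Type*} [TopologicalSpace N] [ChartedSpace E N] [Group N] [LieGroup 𝓘(ℝ, E) ∞ N]

/-- The preferred chart at the identity, read in the coordinates of a basis and translated so that
the identity has coordinates `0`. -/
def coordChart (N : Type*) [TopologicalSpace N] [ChartedSpace E N] [Group N]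
    {ι : Type*} [Fintype ι] (b : Module.Basis ι ℝ E) : OpenPartialHomeomorph N (ι → ℝ) :=
  (chartAt E (1 : N)).transHomeomorph
    ((Homeomorph.addRight (-(chartAt E (1 : N) 1))).trans
      b.equivFunL.toHomeomorph)

variable {ι : Type*} [Fintype ι] (b : Module.Basis ι ℝ E)

omit [FiniteDimensional ℝ E] [LieGroup 𝓘(ℝ, E) ∞ N] in
theorem coordChart_apply (x : N) :
    coordChart N b x = b.equivFunL (chartAt E (1 : N) x - chartAt E (1 : N) 1) := by
  simp [coordChart, sub_eq_add_neg]

omit [FiniteDimensional ℝ E] [LieGroup 𝓘(ℝ, E) ∞ N] in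
theorem coordChart_symm_apply (z : ι → ℝ) :
    (coordChart N b).symm z =
      (chartAt E (1 : N)).symm (b.equivFunL.symm z + chartAt E (1 : N) 1) := by
  change (chartAt E (1 : N)).symm (b.equivFunL.symm z + -(-(chartAt E (1 : N) 1))) = _
  rw [neg_neg]

omit [FiniteDimensional ℝ E] [LieGroup 𝓘(ℝ, E) ∞ N] in
theorem contMDiffAt_coordChart :
    ContMDiffAt 𝓘(ℝ, E) 𝓘(ℝ, ι → ℝ) ∞ (coordChart N b) (1 : N) := by
  have h1 : ContMDiffAt 𝓘(ℝ, E) 𝓘(ℝ, E) ∞ (extChartAt 𝓘(ℝ, E) (1 : N)) (1 : N) :=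
    contMDiffAt_extChartAt
  have h2 : ContMDiff 𝓘(ℝ, E) 𝓘(ℝ, ι → ℝ) ∞
      (fun e : E => b.equivFunL (e - chartAt E (1 : N) 1)) := by
    rw [contMDiff_iff_contDiff]
    fun_prop
  have h3 := h2.contMDiffAt.comp (1 : N) h1
  refine h3.congr_of_eventuallyEq (Eventually.of_forall fun x => ?_)
  simp [coordChart_apply]

omit [FiniteDimensional ℝ E] in
theorem contMDiffAt_coordChart_symm :
    ContMDiffAt 𝓘(ℝ, ι → ℝ) 𝓘(ℝ, E) ∞ (coordChart N b).symm (0 : ι → ℝ) := by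
  have h1 : ContMDiffAt 𝓘(ℝ, E) 𝓘(ℝ, E) ∞ (extChartAt 𝓘(ℝ, E) (1 : N)).symm
      (extChartAt 𝓘(ℝ, E) (1 : N) 1) :=
    (contMDiffOn_extChartAt_symm (1 : N)).contMDiffAt
      (extChartAt_target_mem_nhds (I := 𝓘(ℝ, E)) (1 : N))
  have h2 : ContMDiff 𝓘(ℝ, ι → ℝ) 𝓘(ℝ, E) ∞
      (fun z : ι → ℝ => b.equivFunL.symm z + chartAt E (1 : N) 1) := by
    rw [contMDiff_iff_contDiff]
    fun_prop
  have h3 := ContMDiffAt.comp_of_eq (x := (0 : ι → ℝ)) h1 h2.contMDiffAt (by simp)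
  refine h3.congr_of_eventuallyEq (Eventually.of_forall fun z => ?_)
  simp [coordChart_symm_apply]

omit [FiniteDimensional ℝ E] in
/-- A chart given by a basis of eigenvectors of the differential of `D` at the identity is adapted
to `D`. -/
theorem isDilationChart_coordChart (D : MulAut N) (hD : ContMDiff 𝓘(ℝ, E) 𝓘(ℝ, E) ∞ D)
    {μ : ι → ℝ}
    (hDb : ∀ i, (mfderiv 𝓘(ℝ, E) 𝓘(ℝ, E) D (1 : N) : E → E) (b i) = Real.exp (-μ i) • b i) :
    IsDilationChart D μ (coordChart N b) where
  one_mem := by simp [coordChart]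
  map_one := by simp [coordChart_apply]
  strict_conj := by
    have hs := contMDiffAt_coordChart_symm (N := N) b
    have h0 : (coordChart N b).symm 0 = 1 := by simp [coordChart_symm_apply]
    have h1 : ContMDiffAt 𝓘(ℝ, ι → ℝ) 𝓘(ℝ, ι → ℝ) ∞
        (fun z => coordChart N b (D ((coordChart N b).symm z))) 0 := by
      refine ContMDiffAt.comp_of_eq (x := (0 : ι → ℝ)) (contMDiffAt_coordChart b)
        (hD.contMDiffAt.comp _ hs) (by simp [h0])
    have h2 := (contMDiffAt_iff_contDiffAt.1 h1).hasStrictFDerivAt (by simp)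
    let A : E →L[ℝ] E := mfderiv 𝓘(ℝ, E) 𝓘(ℝ, E) D (1 : N)
    have hA : HasFDerivAt (fun e => chartAt E (1 : N) (D ((chartAt E (1 : N)).symm e))) A
        (chartAt E (1 : N) 1) := by
      have h := ((hD (1 : N)).mdifferentiableAt (by simp)).hasMFDerivAt.2
      refine hasFDerivWithinAt_univ.1 ?_
      simp [writtenInExtChartAt, Function.comp_def] at h
      exact h
    have h3 : HasFDerivAt (fun z : ι → ℝ => b.equivFunL.symm z + chartAt E (1 : N) 1)
        (b.equivFunL.symm : (ι → ℝ) →L[ℝ] E) 0 :=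
      b.equivFunL.symm.hasFDerivAt.add_const _
    have h4 : HasFDerivAt (fun e : E => b.equivFunL (e - chartAt E (1 : N) 1))
        (b.equivFunL : E →L[ℝ] (ι → ℝ)) (chartAt E (1 : N) 1) := by
      exact b.equivFunL.hasFDerivAt.comp _ ((hasFDerivAt_id _).sub_const _)
    have h5 : HasFDerivAt (fun z => coordChart N b (D ((coordChart N b).symm z)))
        ((b.equivFunL : E →L[ℝ] (ι → ℝ)) ∘L A ∘L (b.equivFunL.symm : (ι → ℝ) →L[ℝ] E)) 0 := by
      have e3 : b.equivFunL.symm (0 : ι → ℝ) + chartAt E (1 : N) 1 = chartAt E (1 : N) 1 := by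
        simp
      rw [← e3] at hA
      have h6 := HasFDerivAt.comp (0 : ι → ℝ) hA h3
      have e4 : chartAt E (1 : N) 1 = chartAt E (1 : N) (D ((chartAt E (1 : N)).symm
          (b.equivFunL.symm (0 : ι → ℝ) + chartAt E (1 : N) 1))) := by simp
      rw [e4] at h4
      have h7 := HasFDerivAt.comp (0 : ι → ℝ) h4 h6
      refine h7.congr_of_eventuallyEq (Eventually.of_forall fun z => ?_)
      simp [coordChart_apply, coordChart_symm_apply]
    have h6 : (b.equivFunL : E →L[ℝ] (ι → ℝ)) ∘L A ∘L (b.equivFunL.symm : (ι → ℝ) →L[ℝ] E) =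
        diagExp μ := by
      classical
      have hAb : ∀ i, A (b i) = Real.exp (-μ i) • b i := hDb
      refine ContinuousLinearMap.coe_injective (LinearMap.pi_ext' fun i => LinearMap.ext_ring ?_)
      have : b.equivFunL.symm (Pi.single i 1) = b i := by
        refine b.equivFun.symm_apply_eq.2 (funext fun j => ?_)
        simp [Pi.single_apply, eq_comm]
      simp only [LinearMap.comp_apply, ContinuousLinearMap.coe_coe,
        ContinuousLinearMap.comp_apply, LinearMap.coe_single, ContinuousLinearEquiv.coe_coe, this,
        hAb, map_smul]
      funext j
      by_cases hij : j = i
      · subst hij; simp [diagExp]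
      · simp [diagExp, hij]
    rw [h5.fderiv, h6] at h2
    exact h2
  strict_mul := by
    have h0 : (coordChart N b).symm 0 = 1 := by simp [coordChart_symm_apply]
    have hs := contMDiffAt_coordChart_symm (N := N) b
    let V := ι → ℝ
    have e1 : ContMDiffAt 𝓘(ℝ, V × V × V) 𝓘(ℝ, E) ∞
        (fun z : V × V × V => (coordChart N b).symm z.1) 0 :=
      ContMDiffAt.comp_of_eq (x := (0 : V × V × V)) hs
        (contMDiffAt_iff_contDiffAt.2 (by fun_prop)) rfl
    have e2 : ContMDiffAt 𝓘(ℝ, V × V × V) 𝓘(ℝ, E) ∞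
        (fun z : V × V × V => (coordChart N b).symm z.2.1) 0 :=
      ContMDiffAt.comp_of_eq (x := (0 : V × V × V)) hs
        (contMDiffAt_iff_contDiffAt.2 (by fun_prop)) rfl
    have e3 : ContMDiffAt 𝓘(ℝ, V × V × V) 𝓘(ℝ, E) ∞
        (fun z : V × V × V => (coordChart N b).symm z.2.2) 0 :=
      ContMDiffAt.comp_of_eq (x := (0 : V × V × V)) hs
        (contMDiffAt_iff_contDiffAt.2 (by fun_prop)) rfl
    have h1 : ContMDiffAt 𝓘(ℝ, V × V × V) 𝓘(ℝ, V) ∞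
        (fun z : V × V × V => coordChart N b ((coordChart N b).symm z.1 *
          (coordChart N b).symm z.2.1 * (coordChart N b).symm z.2.2)) 0 := by
      refine ContMDiffAt.comp_of_eq (x := (0 : V × V × V)) (contMDiffAt_coordChart b)
        ((e1.mul e2).mul e3) (by simp [h0])
    have h2 := (contMDiffAt_iff_contDiffAt.1 h1).hasStrictFDerivAt (by simp)
    refine ⟨_, h2, fun w => ?_⟩
    -- the partial map in the middle variable is the identity near the origin
    have h3 : HasFDerivAt (fun w : V => ((0 : V), w, (0 : V)))
        (ContinuousLinearMap.inr ℝ V (V × V) ∘L ContinuousLinearMap.inl ℝ V V) 0 :=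
      (ContinuousLinearMap.inr ℝ V (V × V) ∘L ContinuousLinearMap.inl ℝ V V).hasFDerivAt
    have h4 := HasFDerivAt.comp (0 : V) (g := fun z : V × V × V => coordChart N b
      ((coordChart N b).symm z.1 * (coordChart N b).symm z.2.1 * (coordChart N b).symm z.2.2))
      (f := fun w : V => ((0 : V), w, (0 : V))) h2.hasFDerivAt h3
    have h5 : HasFDerivAt (fun w : V => w) (ContinuousLinearMap.id ℝ V) 0 := hasFDerivAt_id _
    have h6 := h5.congr_of_eventuallyEq (f₁ := (fun z : V × V × V => coordChart N b
      ((coordChart N b).symm z.1 * (coordChart N b).symm z.2.1 * (coordChart N b).symm z.2.2)) ∘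
      (fun w : V => ((0 : V), w, (0 : V)))) (by
        have : (coordChart N b).target ∈ nhds (0 : V) := by
          refine (coordChart N b).open_target.mem_nhds ?_
          have := (coordChart N b).map_source (x := 1) (by simp [coordChart])
          simpa [coordChart_apply] using this
        filter_upwards [this] with z hz
        simp [h0, (coordChart N b).right_inv hz])
    have h7 := h4.unique h6
    have h8 := congrArg (fun T : V →L[ℝ] V => T w) h7
    simpa using h8

end Charts

/-! ### Arcs of one-parameter subgroups -/

section OneParameter

variable {E : Type*} [NormedAddCommGroup E] [NormedSpace ℝ E] [FiniteDimensional ℝ E]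
  {N : Type*} [TopologicalSpace N] [ChartedSpace E N] [Group N] [LieGroup 𝓘(ℝ, E) ∞ N]

omit [FiniteDimensional ℝ E] in
/-- A smooth map intertwining left translations with a map `G` fixing the identity carries
left-invariant vector fields to left-invariant vector fields. -/
theorem mfderiv_mulInvariantVectorField {F G : N → N} (hF : ContMDiff 𝓘(ℝ, E) 𝓘(ℝ, E) ∞ F)
    (hG : MDifferentiableAt 𝓘(ℝ, E) 𝓘(ℝ, E) G 1) (hG1 : G 1 = 1)
    (h : ∀ y z, F (y * z) = F y * G z) (v : GroupLieAlgebra 𝓘(ℝ, E) N) (y : N) :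
    mfderiv 𝓘(ℝ, E) 𝓘(ℝ, E) F y (mulInvariantVectorField v y) =
      (mfderiv 𝓘(ℝ, E) 𝓘(ℝ, E) (fun z => F y * z) (1 : N) : E →L[ℝ] E)
        ((mfderiv 𝓘(ℝ, E) 𝓘(ℝ, E) G (1 : N) : E →L[ℝ] E) v) := by
  have hl : ∀ x z : N, MDifferentiableAt 𝓘(ℝ, E) 𝓘(ℝ, E) (fun z => x * z) z := fun x z =>
    (contMDiff_mul_left (I := 𝓘(ℝ, E)) (n := ∞) (a := x)).mdifferentiableAt (by simp)
  have hFm : ∀ z, MDifferentiableAt 𝓘(ℝ, E) 𝓘(ℝ, E) F z := fun z =>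
    hF.mdifferentiableAt (by simp)
  have h1 : HasMFDerivAt 𝓘(ℝ, E) 𝓘(ℝ, E) (fun z => F (y * z)) (1 : N)
      ((mfderiv 𝓘(ℝ, E) 𝓘(ℝ, E) F y : E →L[ℝ] E) ∘L
        (mfderiv 𝓘(ℝ, E) 𝓘(ℝ, E) (fun z => y * z) (1 : N) : E →L[ℝ] E)) := by
    refine HasMFDerivAt.comp (1 : N) (g := F) (f := fun z => y * z) ?_ (hl y 1).hasMFDerivAt
    rw [mul_one]
    exact (hFm y).hasMFDerivAt
  have h2 : HasMFDerivAt 𝓘(ℝ, E) 𝓘(ℝ, E) (fun z => F (y * z)) (1 : N)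
      ((mfderiv 𝓘(ℝ, E) 𝓘(ℝ, E) (fun z => F y * z) (1 : N) : E →L[ℝ] E) ∘L
        (mfderiv 𝓘(ℝ, E) 𝓘(ℝ, E) G (1 : N) : E →L[ℝ] E)) := by
    have : (fun z => F (y * z)) = (fun z => F y * z) ∘ G := by ext z; simp [h]
    rw [this]
    refine HasMFDerivAt.comp (1 : N) (g := fun z => F y * z) (f := G) ?_ hG.hasMFDerivAt
    rw [hG1]
    exact (hl _ 1).hasMFDerivAt
  exact congrArg (fun T : E →L[ℝ] E => T v) (hasMFDerivAt_unique h1 h2)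

omit [FiniteDimensional ℝ E] in
theorem comp_smulRight_eq (T : E →L[ℝ] E) (X X' : E) (h : T X = X') :
    T ∘L (1 : ℝ →L[ℝ] ℝ).smulRight X = (1 : ℝ →L[ℝ] ℝ).smulRight X' := by
  ext
  simp [h]

omit [FiniteDimensional ℝ E] in
theorem IsMIntegralCurveOn.const_mul {v : GroupLieAlgebra 𝓘(ℝ, E) N} {γ : ℝ → N} {s : Set ℝ}
    (hγ : IsMIntegralCurveOn γ (mulInvariantVectorField v) s) (x : N) :
    IsMIntegralCurveOn (fun t => x * γ t) (mulInvariantVectorField v) s := by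
  intro t ht
  have hl : ContMDiff 𝓘(ℝ, E) 𝓘(ℝ, E) ∞ (fun z : N => x * z) := contMDiff_mul_left
  have h1 := (hl.mdifferentiableAt (by simp)).hasMFDerivAt.comp_hasMFDerivWithinAt t (hγ t ht)
  refine h1.congr_mfderiv ?_
  have h2 := mfderiv_mulInvariantVectorField (G := id) hl mdifferentiableAt_id rfl
    (fun y z => (mul_assoc x y z).symm) v (γ t)
  rw [mfderiv_id] at h2
  exact comp_smulRight_eq (E := E) _ _ _ h2

end OneParameter

namespace HeintzeData

variable {E : Type*} [NormedAddCommGroup E] [NormedSpace ℝ E] [FiniteDimensional ℝ E]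
  {N : Type*} [TopologicalSpace N] [ChartedSpace E N] [Group N] [LieGroup 𝓘(ℝ, E) ∞ N]
  (S : HeintzeData E N)

theorem contMDiff_dilation (t : ℝ) : ContMDiff 𝓘(ℝ, E) 𝓘(ℝ, E) ∞ (S.dilation t) :=
  S.smooth_action.comp (contMDiff_const.prodMk contMDiff_id)

theorem mfderiv_dilation_eigenvector (t c : ℝ) {v : GroupLieAlgebra 𝓘(ℝ, E) N}
    (hv : S.endα v = c • v) :
    (mfderiv 𝓘(ℝ, E) 𝓘(ℝ, E) (S.dilation t) (1 : N) : E → E) v = Real.exp (t * c) • v := by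
  refine (S.mfderiv_action t v).trans ?_
  refine expEnd_apply_of_apply_eq_smul (E := E) ?_
  have : (t • S.α.toLinearMap) v = t • S.endα v := rfl
  refine this.trans ?_
  rw [hv, smul_smul]
  rfl

theorem dilation_neg_natCast (n : ℕ) : S.dilation (-(n : ℝ)) = S.dilation (-1) ^ n := by
  simp only [dilation]
  rw [← map_pow, ← ofAdd_nsmul]
  congr 2
  simp

/-- Left-invariant vector fields of eigenvectors are rescaled by the dilations. -/
theorem isMIntegralCurveOn_dilation {v : GroupLieAlgebra 𝓘(ℝ, E) N} (hv : S.endα v = v)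
    {γ : ℝ → N} {s : Set ℝ} (t : ℝ)
    (hγ : IsMIntegralCurveOn γ (mulInvariantVectorField v) s) :
    IsMIntegralCurveOn (fun r => S.dilation t (γ r))
      (mulInvariantVectorField (Real.exp t • v)) s := by
  intro r hr
  have hl := S.contMDiff_dilation t
  have h1 := (hl.mdifferentiableAt (by simp)).hasMFDerivAt.comp_hasMFDerivWithinAt r (hγ r hr)
  refine h1.congr_mfderiv ?_
  have h2 := mfderiv_mulInvariantVectorField (G := S.dilation t) hl
    (hl.mdifferentiableAt (by simp)) (map_one _) (fun y z => map_mul _ y z) v (γ r)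
  have h3 := S.mfderiv_dilation_eigenvector t 1 (v := v) (by rw [hv, one_smul])
  rw [mul_one] at h3
  have h4 : (mfderiv 𝓘(ℝ, E) 𝓘(ℝ, E) (S.dilation t) (1 : N) : E →L[ℝ] E) v =
    Real.exp t • v := h3
  rw [h4] at h2
  exact comp_smulRight_eq (E := E) _ _ _ h2

/-- An eigenvector of `α` for the eigenvalue `1` generates a nonconstant arc `g` of a one-parameter
subgroup, on which the dilations act by rescaling the parameter. -/
theorem exists_arc [T2Space N] {v : GroupLieAlgebra 𝓘(ℝ, E) N} (hv : S.endα v = v) (hv0 : v ≠ 0) :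
    ∃ τ : ℝ, 0 < τ ∧ ∃ g : ℝ → N, ContinuousOn g (Set.Icc 0 τ) ∧
      (∃ t ∈ Set.Icc 0 τ, g t ≠ g 0) ∧
      ∀ n : ℕ, ∀ t₀ t, 0 ≤ t₀ → t₀ ≤ t → t ≤ τ → t - t₀ ≤ τ * Real.exp (-n) →
        ∃ s ∈ Set.Icc 0 τ, (g t₀)⁻¹ * g t = (S.dilation (-1) ^ n) (g s) := by
  have hX : ContMDiff 𝓘(ℝ, E) (𝓘(ℝ, E).prod 𝓘(ℝ, E)) 1
      (fun g : N => (⟨g, mulInvariantVectorField v g⟩ : TangentBundle 𝓘(ℝ, E) N)) :=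
    (contMDiff_mulInvariantVectorField v).of_le
      (by rw [minSmoothness_of_isRCLikeNormedField]; norm_num)
  obtain ⟨g, hg0, hg⟩ := exists_isMIntegralCurveAt_of_contMDiffAt_boundaryless (0 : ℝ)
    (hX.contMDiffAt (x := (1 : N)))
  obtain ⟨ε, hε, hgε⟩ := isMIntegralCurveAt_iff'.1 hg
  have hI : ∀ s ⊆ Set.Ioo (-ε) ε, IsMIntegralCurveOn g (mulInvariantVectorField v) s :=
    fun s hs => hgε.mono (by rw [Real.ball_eq_Ioo]; simpa using hs)
  have hτ : 0 < ε / 4 := by positivity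
  set τ := ε / 4 with hτdef
  have h0 : (0 : ℝ) ∈ Set.Ioo (-(2 * τ)) (2 * τ) := ⟨by linarith, by linarith⟩
  -- `g` is a local one-parameter subgroup
  have hadd : ∀ t₀ ∈ Set.Icc 0 τ, ∀ s ∈ Set.Ioo (-(2 * τ)) (2 * τ), g (s + t₀) = g t₀ * g s := by
    intro t₀ ht₀
    have h1 : IsMIntegralCurveOn (g ∘ (· + t₀)) (mulInvariantVectorField v)
        (Set.Ioo (-(2 * τ)) (2 * τ)) := by
      refine ((hI _ subset_rfl).comp_add t₀).mono fun s hs => ?_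
      have h1 := hs.1
      have h2 := hs.2
      have h3 := ht₀.1
      have h4 := ht₀.2
      exact ⟨by linarith, by linarith⟩
    have h2 := (hI (Set.Ioo (-(2 * τ)) (2 * τ))
      (Set.Ioo_subset_Ioo (by linarith) (by linarith))).const_mul (g t₀)
    exact isMIntegralCurveOn_Ioo_eqOn_of_contMDiff_boundaryless h0 hX h1 h2 (by simp [hg0])
  have hdil : ∀ n : ℕ, ∀ s ∈ Set.Ioo (-(2 * τ)) (2 * τ),
      g (s * Real.exp (-n)) = (S.dilation (-1) ^ n) (g s) := by
    intro n
    rw [← S.dilation_neg_natCast]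
    have hX' : ContMDiff 𝓘(ℝ, E) (𝓘(ℝ, E).prod 𝓘(ℝ, E)) 1 (fun g : N =>
        (⟨g, mulInvariantVectorField (Real.exp (-n) • v) g⟩ : TangentBundle 𝓘(ℝ, E) N)) :=
      (contMDiff_mulInvariantVectorField _).of_le
        (by rw [minSmoothness_of_isRCLikeNormedField]; norm_num)
    have h1 : IsMIntegralCurveOn (g ∘ (· * Real.exp (-n)))
        (mulInvariantVectorField (Real.exp (-n) • v)) (Set.Ioo (-(2 * τ)) (2 * τ)) := by
      rw [mulInvariantVectorField_smul]
      refine ((hI _ subset_rfl).comp_mul (Real.exp (-n))).mono fun s hs => ?_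
      have h1 : |s| < 2 * τ := abs_lt.2 hs
      have h2 : Real.exp (-(n : ℝ)) ≤ 1 := Real.exp_le_one_iff.2 (by simp)
      have h3 : |s * Real.exp (-(n : ℝ))| < ε := by
        rw [abs_mul, abs_of_pos (Real.exp_pos _)]
        have := mul_le_of_le_one_right (abs_nonneg s) h2
        linarith
      exact abs_lt.1 h3
    have h2 := S.isMIntegralCurveOn_dilation hv (-n) (hI (Set.Ioo (-(2 * τ)) (2 * τ))
      (Set.Ioo_subset_Ioo (by linarith) (by linarith)))
    exact isMIntegralCurveOn_Ioo_eqOn_of_contMDiff_boundaryless h0 hX' h1 h2 (by simp [hg0])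
  refine ⟨τ, hτ, g, ?_, ?_, ?_⟩
  · intro t ht
    have := (hI _ (Set.Ioo_subset_Ioo (a₁ := -(2 * τ)) (b₁ := 2 * τ) (by linarith)
      (by linarith))).continuousWithinAt (t₀ := t) ⟨by linarith [ht.1], by linarith [ht.2]⟩
    exact this.mono fun s hs => ⟨by linarith [hs.1], by linarith [hs.2]⟩
  · by_contra! hconst
    -- a constant arc would have zero velocity
    have hmem : Set.Ioo 0 τ ∈ nhds (τ / 2) := Ioo_mem_nhds (by linarith) (by linarith)
    have h1 : HasMFDerivAt 𝓘(ℝ, ℝ) 𝓘(ℝ, E) g (τ / 2)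
        ((1 : ℝ →L[ℝ] ℝ).smulRight (mulInvariantVectorField v (g (τ / 2)))) :=
      ((hI _ (Set.Ioo_subset_Ioo (by linarith) (by linarith))).isMIntegralCurveAt
        hmem).hasMFDerivAt
    have h2 : HasMFDerivAt 𝓘(ℝ, ℝ) 𝓘(ℝ, E) g (τ / 2) (0 : ℝ →L[ℝ] E) := by
      refine (hasMFDerivAt_const (1 : N) (τ / 2)).congr_of_eventuallyEq ?_
      filter_upwards [hmem] with t ht
      rw [hconst t ⟨ht.1.le, ht.2.le⟩, hg0]
    have h3 := hasMFDerivAt_unique h1 h2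
    have h4 : g (τ / 2) = 1 := by rw [hconst _ ⟨by linarith, by linarith⟩, hg0]
    rw [h4] at h3
    have h5 := congrArg (fun T : ℝ →L[ℝ] E => T 1) h3
    have h6 : (mulInvariantVectorField v (1 : N) : E) = 0 := by
      refine Eq.trans ?_ h5
      exact (one_smul ℝ (mulInvariantVectorField v (1 : N) : E)).symm
    have h7 : (mulInvariantVectorField v (1 : N) : E) = v := by
      have : (fun z : N => 1 * z) = id := by ext z; simp
      simp only [mulInvariantVectorField]
      rw [this, mfderiv_id]
      rfl
    exact hv0 (h7.symm.trans h6)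
  · intro n t₀ t ht₀ htt ht hn
    have hs : (t - t₀) * Real.exp n ∈ Set.Icc 0 τ := by
      refine ⟨mul_nonneg (by linarith) (Real.exp_pos _).le, ?_⟩
      calc (t - t₀) * Real.exp n ≤ τ * Real.exp (-n) * Real.exp n := by gcongr
        _ = τ := by rw [mul_assoc, ← Real.exp_add]; simp
    refine ⟨_, hs, ?_⟩
    rw [← hdil n _ ⟨by linarith [hs.1], by linarith [hs.2]⟩, mul_assoc, ← Real.exp_add]
    have h1 := hadd t₀ ⟨ht₀, by linarith⟩ (t - t₀) ⟨by linarith, by linarith⟩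
    simp only [sub_add_cancel] at h1
    simp [h1]

end HeintzeData

/-! ### Contraction in an adapted chart -/

section DiagExp

variable {ι : Type*} [Fintype ι] {μ : ι → ℝ}

theorem norm_diagExp_apply_le (hμ : ∀ i, 1 ≤ μ i) (z : ι → ℝ) :
    ‖diagExp μ z‖ ≤ Real.exp (-1) * ‖z‖ := by
  refine (pi_norm_le_iff_of_nonneg (by positivity)).2 fun i => ?_
  have h1 : ‖Real.exp (-μ i) * z i‖ ≤ Real.exp (-1) * ‖z‖ := by
    rw [norm_mul, Real.norm_of_nonneg (Real.exp_pos _).le]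
    gcongr
    · exact hμ i
    · exact norm_le_pi_norm z i
  simpa [diagExp] using h1

theorem det_diagExp (μ : ι → ℝ) : (diagExp μ).det = Real.exp (-∑ i, μ i) := by
  classical
  have h : ((diagExp μ : (ι → ℝ) →L[ℝ] (ι → ℝ)) : (ι → ℝ) →ₗ[ℝ] (ι → ℝ)) =
      Matrix.toLin' (Matrix.diagonal fun i => Real.exp (-μ i)) := by
    refine LinearMap.pi_ext' fun i => LinearMap.ext_ring ?_
    funext j
    simp [diagExp, Matrix.mulVec_diagonal]
  rw [ContinuousLinearMap.det, h, LinearMap.det_toLin', Matrix.det_diagonal, ← Real.exp_sum]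
  simp

end DiagExp

theorem MulAut.continuous_pow {N : Type*} [TopologicalSpace N] [Group N] {D : MulAut N}
    (hD : Continuous D) (n : ℕ) : Continuous (D ^ n : MulAut N) := by
  induction n with
  | zero => exact continuous_id
  | succ n ih => rw [pow_succ']; exact hD.comp ih

theorem MulAut.isOpenMap_pow {N : Type*} [TopologicalSpace N] [Group N] {D : MulAut N}
    (hD : IsOpenMap D) (n : ℕ) : IsOpenMap (D ^ n : MulAut N) := by
  induction n with
  | zero => exact IsOpenMap.id
  | succ n ih => rw [pow_succ']; exact hD.comp ih

/-- The set of points whose coordinates in the chart `ψ` have norm less than `r`. -/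
def chartBall {N : Type*} [TopologicalSpace N] {ι : Type*} [Fintype ι]
    (ψ : OpenPartialHomeomorph N (ι → ℝ)) (r : ℝ) : Set N :=
  ψ.source ∩ ψ ⁻¹' Metric.ball 0 r

theorem isOpen_chartBall {N : Type*} [TopologicalSpace N] {ι : Type*} [Fintype ι]
    (ψ : OpenPartialHomeomorph N (ι → ℝ)) (r : ℝ) : IsOpen (chartBall ψ r) :=
  ψ.isOpen_inter_preimage Metric.isOpen_ball

theorem chartBall_mono {N : Type*} [TopologicalSpace N] {ι : Type*} [Fintype ι]
    (ψ : OpenPartialHomeomorph N (ι → ℝ)) {r r' : ℝ} (h : r ≤ r') :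
    chartBall ψ r ⊆ chartBall ψ r' := fun _ hx => ⟨hx.1, Metric.ball_subset_ball h hx.2⟩

theorem norm_lt_of_mem_chartBall {N : Type*} [TopologicalSpace N] {ι : Type*} [Fintype ι]
    {ψ : OpenPartialHomeomorph N (ι → ℝ)} {r : ℝ} {x : N} (hx : x ∈ chartBall ψ r) :
    ‖ψ x‖ < r := by
  simpa using hx.2

namespace IsDilationChart

variable {N : Type*} [TopologicalSpace N] [Group N] [IsTopologicalGroup N] {D : MulAut N}
  {ι : Type*} [Fintype ι] {μ : ι → ℝ} {ψ : OpenPartialHomeomorph N (ι → ℝ)}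

omit [IsTopologicalGroup N] in
theorem symm_zero (hψ : IsDilationChart D μ ψ) : ψ.symm 0 = 1 := by
  rw [← hψ.map_one, ψ.left_inv hψ.one_mem]

omit [IsTopologicalGroup N] in
theorem zero_mem_target (hψ : IsDilationChart D μ ψ) : (0 : ι → ℝ) ∈ ψ.target := by
  rw [← hψ.map_one]
  exact ψ.map_source hψ.one_mem

omit [IsTopologicalGroup N] in
theorem one_mem_chartBall (hψ : IsDilationChart D μ ψ) {r : ℝ} (hr : 0 < r) :
    (1 : N) ∈ chartBall ψ r :=
  ⟨hψ.one_mem, by simpa [hψ.map_one] using hr⟩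

omit [IsTopologicalGroup N] in
theorem chartBall_mem_nhds (hψ : IsDilationChart D μ ψ) {r : ℝ} (hr : 0 < r) :
    chartBall ψ r ∈ nhds (1 : N) :=
  (isOpen_chartBall ψ r).mem_nhds (hψ.one_mem_chartBall hr)

omit [IsTopologicalGroup N] in
theorem exists_ball_subset_preimage (hψ : IsDilationChart D μ ψ) {W : Set N}
    (hW : W ∈ nhds (1 : N)) : ∃ r > 0, Metric.closedBall 0 r ⊆ ψ.target ∧
      ∀ z ∈ Metric.closedBall (0 : ι → ℝ) r, ψ.symm z ∈ W := by
  have h1 : ψ.symm ⁻¹' W ∈ nhds (0 : ι → ℝ) := by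
    refine (ψ.continuousAt_symm hψ.zero_mem_target).preimage_mem_nhds ?_
    rwa [hψ.symm_zero]
  have h2 := Filter.inter_mem (ψ.open_target.mem_nhds hψ.zero_mem_target) h1
  obtain ⟨r, hr, h⟩ := Metric.nhds_basis_closedBall.mem_iff.1 h2
  exact ⟨r, hr, fun z hz => (h hz).1, fun z hz => (h hz).2⟩

omit [IsTopologicalGroup N] in
theorem exists_chartBall_subset (hψ : IsDilationChart D μ ψ) {W : Set N}
    (hW : W ∈ nhds (1 : N)) : ∃ r > 0, Metric.closedBall 0 r ⊆ ψ.target ∧ chartBall ψ r ⊆ W := by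
  obtain ⟨r, hr, h1, h2⟩ := hψ.exists_ball_subset_preimage hW
  refine ⟨r, hr, h1, fun x hx => ?_⟩
  rw [← ψ.left_inv hx.1]
  exact h2 _ (Metric.ball_subset_closedBall hx.2)

/-- Two-sided translations by small elements are close to the identity in the chart. -/
theorem exists_mul_approx (hψ : IsDilationChart D μ ψ) {ε : ℝ} (hε : 0 < ε) :
    ∃ r > 0, Metric.closedBall 0 r ⊆ ψ.target ∧
      ∀ x ∈ chartBall ψ r, ∀ y ∈ chartBall ψ r, (∀ w ∈ chartBall ψ r, x * w * y ∈ ψ.source) ∧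
        ∀ w ∈ chartBall ψ r, ∀ w' ∈ chartBall ψ r,
        ‖ψ (x * w * y) - ψ (x * w' * y) - (ψ w - ψ w')‖ ≤ ε * ‖ψ w - ψ w'‖ := by
  obtain ⟨M', hM, hM'⟩ := hψ.strict_mul
  obtain ⟨s, hs, happ⟩ := hM.approximates_deriv_on_nhds (c := ⟨ε, hε.le⟩) (Or.inr hε)
  have hc : Tendsto (fun z : N × N × N => z.1 * z.2.1 * z.2.2) (nhds (1, 1, 1)) (nhds 1) := by
    have : Continuous (fun z : N × N × N => z.1 * z.2.1 * z.2.2) := by fun_prop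
    simpa using this.tendsto (1, 1, 1)
  have h1 := hc (ψ.open_source.mem_nhds hψ.one_mem)
  rw [mem_map, nhds_prod_eq, nhds_prod_eq] at h1
  obtain ⟨W1, hW1, W23, hW23, hW⟩ := Filter.mem_prod_iff.1 h1
  obtain ⟨W2, hW2, W3, hW3, hW'⟩ := Filter.mem_prod_iff.1 hW23
  obtain ⟨r1, hr1, h3, h4⟩ := hψ.exists_chartBall_subset (inter_mem hW1 (inter_mem hW2 hW3))
  obtain ⟨r2, hr2, h5⟩ := Metric.nhds_basis_ball.mem_iff.1 hs
  refine ⟨min r1 r2, lt_min hr1 hr2,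
    (Metric.closedBall_subset_closedBall (min_le_left _ _)).trans h3, fun x hx y hy => ⟨?_, ?_⟩⟩
  · intro w hw
    have hm : (x, w, y) ∈ W1 ×ˢ W23 := ⟨(h4 (chartBall_mono _ (min_le_left _ _) hx)).1,
      hW' (Set.mk_mem_prod (h4 (chartBall_mono _ (min_le_left _ _) hw)).2.1
        (h4 (chartBall_mono _ (min_le_left _ _) hy)).2.2)⟩
    exact hW hm
  · intro w hw w' hw'
    have hmem : ∀ w ∈ chartBall ψ (min r1 r2), (ψ x, ψ w, ψ y) ∈ s := by
      intro w hw
      have : ∀ x ∈ chartBall ψ (min r1 r2), ‖ψ x‖ < r2 := fun x hx =>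
        (norm_lt_of_mem_chartBall hx).trans_le (min_le_right _ _)
      refine h5 ?_
      rw [mem_ball_zero_iff, Prod.norm_def, Prod.norm_def]
      exact max_lt (this x hx) (max_lt (this w hw) (this y hy))
    have h := happ _ (hmem w hw) _ (hmem w' hw')
    have e1 : ((ψ x, ψ w, ψ y) : (ι → ℝ) × (ι → ℝ) × (ι → ℝ)) - (ψ x, ψ w', ψ y) =
        (0, ψ w - ψ w', 0) := by simp
    rw [e1, hM'] at h
    simp only [ψ.left_inv hx.1, ψ.left_inv hy.1, ψ.left_inv hw.1, ψ.left_inv hw'.1] at h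
    refine h.trans_eq ?_
    simp only [Prod.norm_def, norm_zero, norm_nonneg, sup_of_le_left, sup_of_le_right]
    rfl

omit [IsTopologicalGroup N] in
/-- The automorphism `D` is close to its differential in the chart. -/
theorem exists_conj_approx (hψ : IsDilationChart D μ ψ) (hD : Continuous D) {ε : ℝ} (hε : 0 < ε) :
    ∃ r > 0, Metric.closedBall 0 r ⊆ ψ.target ∧ (∀ w ∈ chartBall ψ r, D w ∈ ψ.source) ∧
        ∀ w ∈ chartBall ψ r, ∀ w' ∈ chartBall ψ r,
        ‖ψ (D w) - ψ (D w') - diagExp μ (ψ w - ψ w')‖ ≤ ε * ‖ψ w - ψ w'‖ := by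
  obtain ⟨s, hs, happ⟩ := hψ.strict_conj.approximates_deriv_on_nhds (c := ⟨ε, hε.le⟩) (Or.inr hε)
  have h1 : D ⁻¹' ψ.source ∈ nhds (1 : N) := hD.continuousAt.preimage_mem_nhds
    (by rw [_root_.map_one]; exact ψ.open_source.mem_nhds hψ.one_mem)
  obtain ⟨r1, hr1, h3, h4⟩ := hψ.exists_chartBall_subset h1
  obtain ⟨r2, hr2, h5⟩ := Metric.nhds_basis_ball.mem_iff.1 hs
  refine ⟨min r1 r2, lt_min hr1 hr2,
    (Metric.closedBall_subset_closedBall (min_le_left _ _)).trans h3,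
    fun w hw => h4 (chartBall_mono _ (min_le_left _ _) hw), fun w hw w' hw' => ?_⟩
  have hmem : ∀ w ∈ chartBall ψ (min r1 r2), ψ w ∈ s := fun w hw =>
    h5 (Metric.ball_subset_ball (min_le_right _ _) hw.2)
  have h := happ _ (hmem w hw) _ (hmem w' hw')
  simp only [ψ.left_inv hw.1, ψ.left_inv hw'.1] at h
  exact h

omit [IsTopologicalGroup N] in
/-- Near the identity `D` contracts the chart at any rate `exp (-s)` with `s < 1`. -/
theorem exists_contracting (hψ : IsDilationChart D μ ψ) (hD : Continuous D) (hμ : ∀ i, 1 ≤ μ i)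
    {s : ℝ} (hs : s < 1) : ∃ r > 0, Metric.closedBall 0 r ⊆ ψ.target ∧
      ∀ w ∈ chartBall ψ r, D w ∈ ψ.source ∧ ‖ψ (D w)‖ ≤ Real.exp (-s) * ‖ψ w‖ := by
  have hε : 0 < Real.exp (-s) - Real.exp (-1) := by
    have := Real.exp_lt_exp.2 (neg_lt_neg hs)
    linarith
  obtain ⟨r, hr, h1, h2, h3⟩ := hψ.exists_conj_approx hD hε
  refine ⟨r, hr, h1, fun w hw => ⟨h2 w hw, ?_⟩⟩
  have h := h3 w hw 1 (hψ.one_mem_chartBall hr)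
  rw [_root_.map_one, hψ.map_one, sub_zero, sub_zero] at h
  have h4 := norm_diagExp_apply_le hμ (ψ w)
  have h5 := norm_sub_norm_le (ψ (D w)) (diagExp μ (ψ w))
  linarith

omit [IsTopologicalGroup N] in
theorem mem_chartBall_of_contracting {s r : ℝ} (hs : 0 ≤ s)
    (h : ∀ w ∈ chartBall ψ r, D w ∈ ψ.source ∧ ‖ψ (D w)‖ ≤ Real.exp (-s) * ‖ψ w‖)
    {r' : ℝ} (hr' : r' ≤ r) {w : N} (hw : w ∈ chartBall ψ r') (n : ℕ) :
    (D ^ n) w ∈ chartBall ψ r' ∧ ‖ψ ((D ^ n) w)‖ ≤ Real.exp (-(s * n)) * ‖ψ w‖ := by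
  induction n with
  | zero => simpa using hw
  | succ n ih =>
    have h1 := h _ (chartBall_mono ψ hr' ih.1)
    have e : (D ^ (n + 1)) w = D ((D ^ n) w) := by rw [pow_succ', MulAut.mul_apply]
    have h2 : Real.exp (-s) ≤ 1 := Real.exp_le_one_iff.2 (by linarith)
    have h3 := norm_lt_of_mem_chartBall ih.1
    rw [e]
    refine ⟨⟨h1.1, ?_⟩, ?_⟩
    · have := mul_le_of_le_one_left (norm_nonneg (ψ ((D ^ n) w))) h2
      simpa using (h1.2.trans this).trans_lt h3
    · calc _ ≤ _ := h1.2
        _ ≤ Real.exp (-s) * (Real.exp (-(s * n)) * ‖ψ w‖) := by gcongr; exact ih.2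
        _ = _ := by rw [← mul_assoc, ← Real.exp_add]; push_cast; ring_nf

theorem tendsto_pow_apply [ConnectedSpace N] (hψ : IsDilationChart D μ ψ) (hD : Continuous D)
    (hμ : ∀ i, 1 ≤ μ i) (x : N) : Tendsto (fun n : ℕ => (D ^ n) x) atTop (nhds 1) := by
  obtain ⟨r, hr, h1, h2⟩ := hψ.exists_contracting hD hμ (s := 1 / 2) (by norm_num)
  -- the basin of attraction of the identity is an open subgroup
  let H : Subgroup N :=
    { carrier := {x | Tendsto (fun n : ℕ => (D ^ n) x) atTop (nhds 1)}
      one_mem' := by simp [tendsto_const_nhds]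
      mul_mem' := fun {a b} ha hb => by
        have := Tendsto.mul (M := N) ha hb
        simpa using this
      inv_mem' := fun {a} ha => by
        have := Tendsto.inv (G := N) ha
        simpa using this }
  have hH : chartBall ψ r ⊆ H := by
    intro w hw
    change Tendsto (fun n : ℕ => (D ^ n) w) atTop (nhds 1)
    have h3 := mem_chartBall_of_contracting (by norm_num) h2 le_rfl hw
    have h4 : Tendsto (fun n : ℕ => ψ ((D ^ n) w)) atTop (nhds 0) := by
      refine squeeze_zero_norm (fun n => (h3 n).2) ?_
      have : Tendsto (fun n : ℕ => Real.exp (-(1 / 2 * (n : ℝ)))) atTop (nhds 0) := by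
        refine Real.tendsto_exp_neg_atTop_nhds_zero.comp ?_
        exact tendsto_natCast_atTop_atTop.const_mul_atTop (by norm_num)
      simpa using this.mul_const ‖ψ w‖
    have h5 := (ψ.continuousAt_symm hψ.zero_mem_target).tendsto.comp h4
    rw [hψ.symm_zero] at h5
    refine h5.congr fun n => ?_
    exact ψ.left_inv (h3 n).1.1
  have hHopen : IsOpen (H : Set N) :=
    H.isOpen_of_mem_nhds (mem_of_superset (hψ.chartBall_mem_nhds hr) hH)
  have hHtop : (H : Set N) = Set.univ :=
    IsClopen.eq_univ ⟨H.isClosed_of_isOpen hHopen, hHopen⟩ ⟨1, H.one_mem⟩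
  have : x ∈ (H : Set N) := by rw [hHtop]; trivial
  exact this

/-- Iterates of `D` contract compact sets to the identity, at any rate `exp (-s)`, `s < 1`. -/
theorem exists_forall_norm_pow_le [ConnectedSpace N] (hψ : IsDilationChart D μ ψ)
    (hD : Continuous D) (hμ : ∀ i, 1 ≤ μ i) {K : Set N} (hK : IsCompact K) {s : ℝ} (hs : s < 1)
    (hs0 : 0 ≤ s) :
    ∃ C > 0, ∃ n₀ : ℕ, ∀ n ≥ n₀, ∀ w ∈ K, (D ^ n) w ∈ ψ.source ∧
      ‖ψ ((D ^ n) w)‖ ≤ C * Real.exp (-(s * n)) := by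
  obtain ⟨r, hr, h1, h2⟩ := hψ.exists_contracting hD hμ hs
  obtain ⟨t, ht⟩ := hK.elim_finite_subcover (fun n : ℕ => (D ^ n : MulAut N) ⁻¹' chartBall ψ r)
    (fun n => (isOpen_chartBall ψ r).preimage (MulAut.continuous_pow hD n)) (fun x _ => by
      obtain ⟨n, hn⟩ := ((hψ.tendsto_pow_apply hD hμ x).eventually
        (hψ.chartBall_mem_nhds hr)).exists
      exact Set.mem_iUnion.2 ⟨n, hn⟩)
  obtain ⟨n₀, hn₀⟩ := t.exists_nat_subset_range
  have hadd : ∀ (m n : ℕ) (w : N), (D ^ (m + n)) w = (D ^ m) ((D ^ n) w) := by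
    intro m n w
    rw [pow_add, MulAut.mul_apply]
  have hK0 : ∀ w ∈ K, (D ^ n₀) w ∈ chartBall ψ r := by
    intro w hw
    obtain ⟨n, hn, hwn⟩ := Set.mem_iUnion₂.1 (ht hw)
    have hlt : n < n₀ := Finset.mem_range.1 (hn₀ hn)
    obtain ⟨m, rfl⟩ := Nat.exists_eq_add_of_lt hlt
    have := (mem_chartBall_of_contracting hs0 h2 le_rfl hwn (m + 1)).1
    rwa [← hadd, show m + 1 + n = n + m + 1 by ring] at this
  refine ⟨Real.exp (s * n₀) * r, by positivity, n₀, fun n hn w hw => ?_⟩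
  obtain ⟨m, rfl⟩ := Nat.exists_eq_add_of_le hn
  have h3 := mem_chartBall_of_contracting hs0 h2 le_rfl (hK0 w hw) m
  rw [← hadd, add_comm] at h3
  refine ⟨h3.1.1, h3.2.trans ?_⟩
  have h4 := (norm_lt_of_mem_chartBall (hK0 w hw)).le
  calc _ ≤ Real.exp (-(s * m)) * r := by gcongr
    _ = Real.exp (s * n₀) * Real.exp (-(s * (n₀ + m : ℕ))) * r := by
      rw [← Real.exp_add]; push_cast; ring_nf
    _ = _ := by ring

theorem exists_forall_pow_mem [ConnectedSpace N] (hψ : IsDilationChart D μ ψ)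
    (hD : Continuous D) (hμ : ∀ i, 1 ≤ μ i) {K : Set N} (hK : IsCompact K) {r : ℝ} (hr : 0 < r) :
    ∃ n₀ : ℕ, ∀ n ≥ n₀, ∀ w ∈ K, (D ^ n) w ∈ chartBall ψ r := by
  obtain ⟨C, hC, n₀, h⟩ := hψ.exists_forall_norm_pow_le hD hμ hK (s := 1 / 2) (by norm_num)
    (by norm_num)
  have h4 : Tendsto (fun n : ℕ => C * Real.exp (-(1 / 2 * (n : ℝ)))) atTop (nhds 0) := by
    have : Tendsto (fun n : ℕ => Real.exp (-(1 / 2 * (n : ℝ)))) atTop (nhds 0) := by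
      refine Real.tendsto_exp_neg_atTop_nhds_zero.comp ?_
      exact tendsto_natCast_atTop_atTop.const_mul_atTop (by norm_num)
    simpa using this.const_mul C
  obtain ⟨n₁, hn₁⟩ := eventually_atTop.1 (h4.eventually (gt_mem_nhds hr))
  refine ⟨max n₀ n₁, fun n hn w hw => ?_⟩
  have h5 := h n (le_of_max_le_left hn) w hw
  refine ⟨h5.1, ?_⟩
  simpa using h5.2.trans_lt (hn₁ n (le_of_max_le_right hn))

end IsDilationChart

/-! ### Volumes in an adapted chart -/

namespace IsDilationChart

open MeasureTheory

variable {N : Type*} [TopologicalSpace N] [Group N] [IsTopologicalGroup N] {D : MulAut N}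
  {ι : Type*} [Fintype ι] {μ : ι → ℝ} {ψ : OpenPartialHomeomorph N (ι → ℝ)}

/-- Near the identity, two-sided translations by small elements change volumes by a factor of at
most two. -/
theorem exists_volume_translate (hψ : IsDilationChart D μ ψ) :
    ∃ r > 0, Metric.closedBall 0 r ⊆ ψ.target ∧
      ∀ x ∈ chartBall ψ r, ∀ y ∈ chartBall ψ r, (∀ w ∈ chartBall ψ r, x * w * y ∈ ψ.source) ∧
        ∀ A ⊆ chartBall ψ r,
          volume (ψ '' ((fun w => x * w * y) '' A)) ≤ 2 * volume (ψ '' A) ∧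
          volume (ψ '' A) ≤ 2 * volume (ψ '' ((fun w => x * w * y) '' A)) := by
  have h1 := addHaar_image_le_mul_of_det_lt (volume : Measure (ι → ℝ))
    (ContinuousLinearMap.id ℝ (ι → ℝ)) (m := 2) (by simp [ContinuousLinearMap.det])
  have h2 := mul_le_addHaar_image_of_lt_det (volume : Measure (ι → ℝ))
    (ContinuousLinearMap.id ℝ (ι → ℝ)) (m := 2⁻¹) (by
      simp [ContinuousLinearMap.det, ENNReal.coe_inv])
  obtain ⟨δ, ⟨h1, h2⟩, hδ⟩ := ((h1.and h2).and self_mem_nhdsWithin).exists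
  obtain ⟨r, hr, h3, h4⟩ := hψ.exists_mul_approx (ε := δ) (NNReal.coe_pos.2 hδ)
  refine ⟨r, hr, h3, fun x hx y hy => ⟨(h4 x hx y hy).1, fun A hA => ?_⟩⟩
  have happ : ApproximatesLinearOn (fun z => ψ (x * ψ.symm z * y))
      (ContinuousLinearMap.id ℝ (ι → ℝ)) (ψ '' A) δ := by
    rintro _ ⟨w, hw, rfl⟩ _ ⟨w', hw', rfl⟩
    simp only [ψ.left_inv (hA hw).1, ψ.left_inv (hA hw').1]
    exact (h4 x hx y hy).2 w (hA hw) w' (hA hw')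
  have himg : (fun z => ψ (x * ψ.symm z * y)) '' (ψ '' A) =
      ψ '' ((fun w => x * w * y) '' A) := by
    rw [Set.image_image, Set.image_image]
    refine Set.image_congr fun w hw => ?_
    rw [ψ.left_inv (hA hw).1]
  have h5 := h1 _ _ happ
  have h6 := h2 _ _ happ
  rw [himg] at h5 h6
  refine ⟨by simpa using h5, ?_⟩
  rw [ENNReal.coe_inv (by norm_num)] at h6
  calc volume (ψ '' A) = 2 * (2⁻¹ * volume (ψ '' A)) := by
        rw [← mul_assoc, ENNReal.mul_inv_cancel (by norm_num) (by norm_num), one_mul]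
    _ ≤ _ := by gcongr; simpa using h6

omit [IsTopologicalGroup N] in
/-- Near the identity, `D` multiplies volumes by about `exp (-∑ i, μ i)`. -/
theorem exists_volume_conj (hψ : IsDilationChart D μ ψ) (hD : Continuous D) {ε : ℝ}
    (hε : 0 < ε) :
    ∃ r > 0, Metric.closedBall 0 r ⊆ ψ.target ∧ ∀ A ⊆ chartBall ψ r,
      volume (ψ '' (D '' A)) ≤ ENNReal.ofReal (Real.exp (-(∑ i, μ i - ε))) * volume (ψ '' A) ∧
      ENNReal.ofReal (Real.exp (-(∑ i, μ i + ε))) * volume (ψ '' A) ≤ volume (ψ '' (D '' A)) := by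
  have hdet : |(diagExp μ).det| = Real.exp (-∑ i, μ i) := by
    rw [det_diagExp, abs_of_pos (Real.exp_pos _)]
  have h1 := addHaar_image_le_mul_of_det_lt (volume : Measure (ι → ℝ)) (diagExp μ)
    (m := (Real.exp (-(∑ i, μ i - ε))).toNNReal) (by
      rw [hdet, ENNReal.ofReal, ENNReal.coe_lt_coe]
      exact (Real.toNNReal_lt_toNNReal_iff (Real.exp_pos _)).2 (Real.exp_lt_exp.2 (by linarith)))
  have h2 := mul_le_addHaar_image_of_lt_det (volume : Measure (ι → ℝ)) (diagExp μ)
    (m := (Real.exp (-(∑ i, μ i + ε))).toNNReal) (by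
      rw [hdet, ENNReal.ofReal, ENNReal.coe_lt_coe]
      exact (Real.toNNReal_lt_toNNReal_iff (Real.exp_pos _)).2 (Real.exp_lt_exp.2 (by linarith)))
  obtain ⟨δ, ⟨h1, h2⟩, hδ⟩ := ((h1.and h2).and self_mem_nhdsWithin).exists
  obtain ⟨r, hr, h3, -, h4⟩ := hψ.exists_conj_approx hD (ε := δ) (NNReal.coe_pos.2 hδ)
  refine ⟨r, hr, h3, fun A hA => ?_⟩
  have happ : ApproximatesLinearOn (fun z => ψ (D (ψ.symm z))) (diagExp μ) (ψ '' A) δ := by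
    rintro _ ⟨w, hw, rfl⟩ _ ⟨w', hw', rfl⟩
    simp only [ψ.left_inv (hA hw).1, ψ.left_inv (hA hw').1]
    exact h4 w (hA hw) w' (hA hw')
  have himg : (fun z => ψ (D (ψ.symm z))) '' (ψ '' A) = ψ '' (D '' A) := by
    rw [Set.image_image, Set.image_image]
    refine Set.image_congr fun w hw => ?_
    rw [ψ.left_inv (hA hw).1]
  have h5 := h1 _ _ happ
  have h6 := h2 _ _ happ
  rw [himg] at h5 h6
  exact ⟨h5, h6⟩

omit [IsTopologicalGroup N] in
/-- Iterates of `D` multiply volumes by about `exp (-n ∑ i, μ i)`. -/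
theorem exists_volume_pow (hψ : IsDilationChart D μ ψ) (hD : Continuous D) (hμ : ∀ i, 1 ≤ μ i)
    {ε : ℝ} (hε : 0 < ε) :
    ∃ r > 0, Metric.closedBall 0 r ⊆ ψ.target ∧ ∀ r' ≤ r, ∀ A ⊆ chartBall ψ r', ∀ n : ℕ,
      (D ^ n : MulAut N) '' A ⊆ chartBall ψ r' ∧
      volume (ψ '' ((D ^ n : MulAut N) '' A)) ≤
        ENNReal.ofReal (Real.exp (-((∑ i, μ i - ε) * n))) * volume (ψ '' A) ∧
      ENNReal.ofReal (Real.exp (-((∑ i, μ i + ε) * n))) * volume (ψ '' A) ≤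
        volume (ψ '' ((D ^ n : MulAut N) '' A)) := by
  obtain ⟨r₁, hr₁, h1, h2⟩ := hψ.exists_volume_conj hD hε
  obtain ⟨r₂, hr₂, h3, h4⟩ := hψ.exists_contracting hD hμ (s := 1 / 2) (by norm_num)
  refine ⟨min r₁ r₂, lt_min hr₁ hr₂,
    (Metric.closedBall_subset_closedBall (min_le_left _ _)).trans h1, fun r' hr' A hA n => ?_⟩
  have hmem : ∀ n : ℕ, (D ^ n : MulAut N) '' A ⊆ chartBall ψ r' := by
    rintro n _ ⟨w, hw, rfl⟩
    exact (mem_chartBall_of_contracting (by norm_num) h4 (hr'.trans (min_le_right _ _))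
      (hA hw) n).1
  refine ⟨hmem n, ?_⟩
  induction n with
  | zero => simp
  | succ n ih =>
    have himg : (D ^ (n + 1) : MulAut N) '' A = D '' ((D ^ n : MulAut N) '' A) := by
      rw [Set.image_image, pow_succ']
      rfl
    have h5 := h2 ((D ^ n : MulAut N) '' A)
      ((hmem n).trans (chartBall_mono ψ (hr'.trans (min_le_left _ _))))
    rw [himg]
    have hexp : ∀ a : ℝ, ENNReal.ofReal (Real.exp (-(a * (n + 1 : ℕ)))) =
        ENNReal.ofReal (Real.exp (-a)) * ENNReal.ofReal (Real.exp (-(a * n))) := by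
      intro a
      rw [← ENNReal.ofReal_mul (Real.exp_pos _).le, ← Real.exp_add]
      push_cast
      ring_nf
    rw [hexp, hexp, mul_assoc, mul_assoc]
    exact ⟨h5.1.trans (by gcongr; exact ih.1), le_trans (by gcongr; exact ih.2) h5.2⟩

omit [Group N] [IsTopologicalGroup N] in
theorem volume_image_chartBall_lt_top (r : ℝ) : volume (ψ '' chartBall ψ r) < ⊤ := by
  refine (measure_mono ?_).trans_lt
    (Metric.isBounded_ball (x := (0 : ι → ℝ)) (r := r)).measure_lt_top
  rintro _ ⟨x, hx, rfl⟩
  exact hx.2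

omit [Group N] [IsTopologicalGroup N] in
theorem image_chartBall {r : ℝ} (hr : Metric.closedBall 0 r ⊆ ψ.target) :
    ψ '' chartBall ψ r = Metric.ball 0 r := by
  rw [chartBall, ψ.image_source_inter_eq']
  ext z
  constructor
  · rintro ⟨h1, h2⟩
    rwa [Set.mem_preimage, Set.mem_preimage, ψ.right_inv h1] at h2
  · intro hz
    have h1 := hr (Metric.ball_subset_closedBall hz)
    refine ⟨h1, ?_⟩
    rwa [Set.mem_preimage, Set.mem_preimage, ψ.right_inv h1]

/-- Upper bound for the volumes of the sets `x (D ^ n K) y`, for `K` compact and small `x`, `y`. -/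
theorem exists_volume_le [ConnectedSpace N] (hψ : IsDilationChart D μ ψ) (hD : Continuous D)
    (hμ : ∀ i, 1 ≤ μ i) {ε : ℝ} (hε : 0 < ε) :
    ∃ r > 0, ∀ K : Set N, IsCompact K → ∃ C > 0, ∃ n₀ : ℕ, ∀ n ≥ n₀,
      ∀ x ∈ chartBall ψ r, ∀ y ∈ chartBall ψ r,
        volume (ψ '' ((fun k => x * (D ^ n) k * y) '' K)) ≤
          ENNReal.ofReal (C * Real.exp (-((∑ i, μ i - ε) * n))) := by
  obtain ⟨r₁, hr₁, h1, h2⟩ := hψ.exists_volume_translate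
  obtain ⟨r₂, hr₂, h3, h4⟩ := hψ.exists_volume_pow hD hμ hε
  have hr : 0 < min r₁ r₂ := lt_min hr₁ hr₂
  refine ⟨min r₁ r₂, hr, fun K hK => ?_⟩
  obtain ⟨n₀, hn₀⟩ := hψ.exists_forall_pow_mem hD hμ hK hr
  set M := (volume (ψ '' chartBall ψ (min r₁ r₂))).toReal with hM
  have hMtop := volume_image_chartBall_lt_top (ψ := ψ) (min r₁ r₂)
  refine ⟨2 * (Real.exp ((∑ i, μ i - ε) * n₀) * (M + 1)), by positivity, n₀,
    fun n hn x hx y hy => ?_⟩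
  obtain ⟨m, rfl⟩ := Nat.exists_eq_add_of_le hn
  have hK0 : (D ^ n₀ : MulAut N) '' K ⊆ chartBall ψ (min r₁ r₂) := by
    rintro _ ⟨w, hw, rfl⟩
    exact hn₀ n₀ le_rfl w hw
  have h5 := h4 _ (min_le_right _ _) _ hK0 m
  have himg : (fun k => x * (D ^ (n₀ + m)) k * y) '' K =
      (fun w => x * w * y) '' ((D ^ m : MulAut N) '' ((D ^ n₀ : MulAut N) '' K)) := by
    rw [Set.image_image, Set.image_image, add_comm, pow_add]
    rfl
  have h6 := (h2 x (chartBall_mono ψ (min_le_left _ _) hx) y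
    (chartBall_mono ψ (min_le_left _ _) hy)).2 _ (h5.1.trans (chartBall_mono ψ (min_le_left _ _)))
  rw [himg]
  calc _ ≤ _ := h6.1
    _ ≤ 2 * (ENNReal.ofReal (Real.exp (-((∑ i, μ i - ε) * m))) * ENNReal.ofReal (M + 1)) := by
        gcongr
        refine h5.2.1.trans ?_
        gcongr
        refine (measure_mono (Set.image_mono hK0)).trans ?_
        rw [← ENNReal.ofReal_toReal hMtop.ne]
        exact ENNReal.ofReal_le_ofReal (by rw [← hM]; linarith)
    _ = _ := by
        rw [show (2 : ℝ≥0∞) = ENNReal.ofReal 2 by simp, ← ENNReal.ofReal_mul (by positivity),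
          ← ENNReal.ofReal_mul (by positivity)]
        congr 1
        have : Real.exp (-((∑ i, μ i - ε) * m)) =
            Real.exp ((∑ i, μ i - ε) * n₀) * Real.exp (-((∑ i, μ i - ε) * (n₀ + m : ℕ))) := by
          rw [← Real.exp_add]
          push_cast
          ring_nf
        rw [this]
        ring

/-- Lower bound for the volumes of the sets `x (D ^ n A)`, for `A` a chart ball and small `x`. -/
theorem exists_le_volume (hψ : IsDilationChart D μ ψ) (hD : Continuous D)
    (hμ : ∀ i, 1 ≤ μ i) {ε : ℝ} (hε : 0 < ε) :
    ∃ r > 0, ∀ r' > 0, r' ≤ r → ∃ c > 0, ∀ n : ℕ,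
      (D ^ n : MulAut N) '' chartBall ψ r' ⊆ chartBall ψ r' ∧ ∀ x ∈ chartBall ψ r,
        (∀ w ∈ chartBall ψ r', x * w ∈ ψ.source) ∧
        ENNReal.ofReal (c * Real.exp (-((∑ i, μ i + ε) * n))) ≤
          volume (ψ '' ((fun k => x * (D ^ n) k) '' chartBall ψ r')) := by
  obtain ⟨r₁, hr₁, h1, h2⟩ := hψ.exists_volume_translate
  obtain ⟨r₂, hr₂, h3, h4⟩ := hψ.exists_volume_pow hD hμ hε
  have hr : 0 < min r₁ r₂ := lt_min hr₁ hr₂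
  refine ⟨min r₁ r₂, hr, fun r' hr' hr'r => ?_⟩
  have hball := image_chartBall (ψ := ψ) (r := r')
    ((Metric.closedBall_subset_closedBall (hr'r.trans (min_le_left _ _))).trans h1)
  set M := (volume (ψ '' chartBall ψ r')).toReal with hM
  have hMtop := volume_image_chartBall_lt_top (ψ := ψ) r'
  have hMpos : 0 < M := by
    refine ENNReal.toReal_pos ?_ hMtop.ne
    rw [hball]
    exact (Metric.measure_ball_pos volume _ hr').ne'
  refine ⟨M / 2, by positivity, fun n => ?_⟩
  have h5 := h4 r' (hr'r.trans (min_le_right _ _)) _ subset_rfl n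
  refine ⟨h5.1, fun x hx => ?_⟩
  have h7 := h2 x (chartBall_mono ψ (min_le_left _ _) hx) 1 (hψ.one_mem_chartBall hr₁)
  have h6 := h7.2 _ (h5.1.trans (chartBall_mono ψ (hr'r.trans (min_le_left _ _))))
  refine ⟨fun w hw => by
    simpa using h7.1 w (chartBall_mono ψ (hr'r.trans (min_le_left _ _)) hw), ?_⟩
  simp only [mul_one] at h6
  have h8 := h5.2.2.trans h6.2
  rw [← ENNReal.ofReal_toReal hMtop.ne, ← hM, ← ENNReal.ofReal_mul (Real.exp_pos _).le] at h8
  calc _ = 2⁻¹ * ENNReal.ofReal (Real.exp (-((∑ i, μ i + ε) * n)) * M) := by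
        rw [show (2⁻¹ : ℝ≥0∞) = ENNReal.ofReal 2⁻¹ by
          rw [ENNReal.ofReal_inv_of_pos (by norm_num)]; simp, ← ENNReal.ofReal_mul (by positivity)]
        congr 1
        ring
    _ ≤ 2⁻¹ * (2 * volume (ψ '' ((fun k => x * (D ^ n) k) '' chartBall ψ r'))) := by
        gcongr
        simpa only [Set.image_image] using h8
    _ = _ := by
        rw [← mul_assoc, ENNReal.inv_mul_cancel (by norm_num) (by norm_num), one_mul]

end IsDilationChart

/-! ### Bump functions -/

namespace IsDilationChart

variable {N : Type*} [TopologicalSpace N] [Group N] [IsTopologicalGroup N] {D : MulAut N}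
  {ι : Type*} [Fintype ι] {μ : ι → ℝ} {ψ : OpenPartialHomeomorph N (ι → ℝ)}

/-- There is a bounded continuous function, taking its value at the identity only there, whose
oscillation along `x (D ^ n K)` is at most of order `exp (-s n)`, uniformly in `x`. -/
theorem exists_bump [T2Space N] [ConnectedSpace N] (hψ : IsDilationChart D μ ψ)
    (hD : Continuous D) (hμ : ∀ i, 1 ≤ μ i) {s : ℝ} (hs : s < 1) (hs0 : 0 ≤ s) :
    ∃ f : N → ℝ, Continuous f ∧ (∀ x, x ≠ 1 → f x ≠ f 1) ∧
      (∃ R, ∀ x y, |f x - f y| ≤ R) ∧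
      ∀ K : Set N, IsCompact K → ∃ C > 0, ∀ n : ℕ, ∀ x, ∀ w ∈ K,
        |f (x * (D ^ n) w) - f x| ≤ C * Real.exp (-(s * n)) := by
  classical
  obtain ⟨r, hr, hrt, hmul⟩ := hψ.exists_mul_approx one_pos
  set R := r / 2 with hR
  have hRpos : 0 < R := by positivity
  let f : N → ℝ := fun z => if z ∈ ψ.source then max 0 (R - ‖ψ z‖) else 0
  have hf1 : f 1 = R := by simp [f, hψ.one_mem, hψ.map_one, hRpos.le]
  have hf0 : ∀ z, 0 ≤ f z := by
    intro z
    by_cases hz : z ∈ ψ.source <;> simp [f, hz]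
  have hfR : ∀ z, f z ≤ R := by
    intro z
    by_cases hz : z ∈ ψ.source <;> simp [f, hz, hRpos.le]
  have hfsupp : ∀ z, z ∉ chartBall ψ r → f z = 0 := by
    intro z hz
    by_cases hzs : z ∈ ψ.source
    · have : r ≤ ‖ψ z‖ := by
        by_contra! h
        exact hz ⟨hzs, by simpa using h⟩
      simp only [f, hzs, if_true]
      exact max_eq_left (by linarith)
    · simp [f, hzs]
  have hfdiff : ∀ z ∈ ψ.source, ∀ z' ∈ ψ.source, |f z - f z'| ≤ ‖ψ z - ψ z'‖ := by
    intro z hz z' hz'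
    simp only [f, hz, hz', if_true]
    rw [max_comm 0, max_comm 0]
    refine (abs_max_sub_max_le_abs (R - ‖ψ z‖) (R - ‖ψ z'‖) 0).trans ?_
    rw [sub_sub_sub_cancel_left, abs_sub_comm]
    exact abs_norm_sub_norm_le _ _
  have hR0 : ∀ x y, |f x - f y| ≤ R := fun x y =>
    abs_sub_le_iff.2 ⟨by linarith [hf0 y, hfR x], by linarith [hf0 x, hfR y]⟩
  refine ⟨f, ?_, ?_, ⟨R, hR0⟩, ?_⟩
  · -- outside of a compact subset of the chart domain, `f` vanishes
    have hK : IsClosed (ψ.symm '' Metric.closedBall 0 R) := by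
      refine IsCompact.isClosed ((isCompact_closedBall _ _).image_of_continuousOn ?_)
      refine ψ.continuousOn_symm.mono (subset_trans ?_ hrt)
      exact Metric.closedBall_subset_closedBall (by linarith)
    refine continuous_iff_continuousAt.2 fun z => ?_
    by_cases hz : z ∈ ψ.source
    · have h1 : ContinuousAt (fun z => max 0 (R - ‖ψ z‖)) z := by
        have := ψ.continuousAt hz
        fun_prop
      refine h1.congr ?_
      filter_upwards [ψ.open_source.mem_nhds hz] with z' hz'
      simp [f, hz']
    · have h1 : z ∉ ψ.symm '' Metric.closedBall 0 R := by
        rintro ⟨v, hv, rfl⟩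
        exact hz (ψ.map_target (hrt (Metric.closedBall_subset_closedBall (by linarith) hv)))
      refine (continuousAt_const (y := (0 : ℝ))).congr ?_
      filter_upwards [hK.isOpen_compl.mem_nhds h1] with z' hz'
      by_cases hz's : z' ∈ ψ.source
      · have : R ≤ ‖ψ z'‖ := by
          by_contra! h
          exact hz' ⟨ψ z', by simpa using h.le, ψ.left_inv hz's⟩
        simp only [f, hz's, if_true]
        exact (max_eq_left (by linarith)).symm
      · simp [f, hz's]
  · intro x hx h
    rw [hf1] at h
    by_cases hxs : x ∈ ψ.source
    · simp only [f, hxs, if_true] at h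
      have h2 : ‖ψ x‖ = 0 := by
        rcases max_choice (0 : ℝ) (R - ‖ψ x‖) with h3 | h3 <;> rw [h3] at h <;> linarith
      refine hx ?_
      rw [← ψ.left_inv hxs, norm_eq_zero.1 h2, hψ.symm_zero]
    · simp only [f, hxs, if_false] at h
      linarith
  · intro K hK
    obtain ⟨C, hC, n₀, hCn⟩ := hψ.exists_forall_norm_pow_le hD hμ (hK.union hK.inv) hs hs0
    obtain ⟨n₁, hn₁⟩ := hψ.exists_forall_pow_mem hD hμ (hK.union hK.inv) hr
    -- right translation by a small element moves points of the chart by a comparable amount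
    have key : ∀ x ∈ chartBall ψ r, ∀ v ∈ chartBall ψ r, |f (x * v) - f x| ≤ 2 * ‖ψ v‖ := by
      intro x hx v hv
      have h1 := hmul x hx 1 (hψ.one_mem_chartBall hr)
      have h2 := h1.2 v hv 1 (hψ.one_mem_chartBall hr)
      simp only [mul_one, hψ.map_one, sub_zero, one_mul] at h2
      have h3 := h1.1 v hv
      rw [mul_one] at h3
      have h4 := hfdiff _ h3 _ hx.1
      have h5 := norm_sub_norm_le (ψ (x * v) - ψ x) (ψ v)
      linarith
    refine ⟨2 * C + R * Real.exp (s * max n₀ n₁), by positivity, fun n x w hw => ?_⟩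
    rcases le_or_gt (max n₀ n₁) n with hn | hn
    · have hb : |f (x * (D ^ n) w) - f x| ≤ 2 * (C * Real.exp (-(s * n))) := by
        have hw1 := hCn n (le_of_max_le_left hn) w (Or.inl hw)
        have hw2 := hCn n (le_of_max_le_left hn) w⁻¹ (Or.inr (Set.inv_mem_inv.2 hw))
        have hv1 := hn₁ n (le_of_max_le_right hn) w (Or.inl hw)
        have hv2 := hn₁ n (le_of_max_le_right hn) w⁻¹ (Or.inr (Set.inv_mem_inv.2 hw))
        by_cases hx : x ∈ chartBall ψ r
        · linarith [key x hx _ hv1, hw1.2]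
        by_cases hxv : x * (D ^ n) w ∈ chartBall ψ r
        · have h1 := key _ hxv _ hv2
          rw [map_inv, mul_inv_cancel_right, abs_sub_comm] at h1
          rw [map_inv] at hw2
          linarith [hw2.2]
        · rw [hfsupp _ hx, hfsupp _ hxv]
          simp only [sub_zero, abs_zero]
          positivity
      have : 0 ≤ R * Real.exp (s * max n₀ n₁) * Real.exp (-(s * n)) := by positivity
      linarith
    · have h1 : 1 ≤ Real.exp (s * max n₀ n₁) * Real.exp (-(s * n)) := by
        rw [← Real.exp_add, Real.one_le_exp_iff]
        have : (n : ℝ) ≤ (max n₀ n₁ : ℕ) := by exact_mod_cast hn.le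
        nlinarith
      have h2 := hR0 (x * (D ^ n) w) x
      have h3 : R * 1 ≤ R * (Real.exp (s * max n₀ n₁) * Real.exp (-(s * n))) := by gcongr
      have h4 : 0 ≤ 2 * C * Real.exp (-(s * n)) := by positivity
      linarith

end IsDilationChart

/-! ### The semigroup `OPlus u` -/

namespace OPlus

variable {u : ℝ → ℝ}

theorem eventually_le (hu : IsAdmissible u) (k : OPlus u) {ε : ℝ} (hε : 0 < ε) :
    ∀ᶠ n : ℤ in atTop, (k.toFun n : ℝ) ≤ ε * n := by
  have h1 : (fun n : ℤ => u (n : ℝ)) =o[atTop] (fun n : ℤ => (n : ℝ)) :=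
    hu.sublinear.comp_tendsto tendsto_intCast_atTop_atTop
  have h2 := (k.isBigO.trans_isLittleO h1).bound hε
  filter_upwards [h2, eventually_ge_atTop 0] with n hn hn0
  have : (0 : ℝ) ≤ n := by exact_mod_cast hn0
  rwa [Real.norm_of_nonneg (Nat.cast_nonneg _), Real.norm_of_nonneg this] at hn

theorem const_isBigO (hu : IsAdmissible u) (Q : ℝ) :
    (fun _ : ℤ => Q) =O[atTop] (fun n : ℤ => u (n : ℝ)) := by
  obtain ⟨R, hR⟩ := hu.eventually_mono
  obtain ⟨R', hR'⟩ := eventually_atTop.1 hu.eventually_pos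
  have hpos := hR' (max R R') (le_max_right _ _)
  refine IsBigO.of_bound (|Q| / u (max R R')) ?_
  filter_upwards [tendsto_intCast_atTop_atTop.eventually_ge_atTop (max R R')] with n hn
  have h1 := hR (Set.mem_Ici.2 (le_max_left R R'))
    (Set.mem_Ici.2 ((le_max_left R R').trans hn)) hn
  rw [Real.norm_of_nonneg (hpos.le.trans h1), Real.norm_eq_abs, div_mul_eq_mul_div,
    le_div_iff₀ hpos]
  gcongr

/-- The function `k + Q`. -/
def addConst (hu : IsAdmissible u) (k : OPlus u) (Q : ℕ) : OPlus u where
  start := k.start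
  toFun n := k.toFun n + Q
  isBigO := by
    push_cast
    exact k.isBigO.add (const_isBigO hu Q)

/-- The zero function, defined on the nonnegative integers. -/
protected def zero (u : ℝ → ℝ) : OPlus u where
  start := 0
  toFun _ := 0
  isBigO := by simpa using isBigO_zero _ _

/-- Shifts by a sublinear function lower the levels by a factor close to one. -/
theorem exists_forall_le_sub (hu : IsAdmissible u) (k : OPlus u) {ε : ℝ} (hε : 0 < ε) :
    ∃ n₀ : ℤ, 0 ≤ n₀ ∧ ∀ n ≥ n₀, (1 - ε) * n ≤ ((n - k.toFun n : ℤ) : ℝ) := by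
  obtain ⟨n₀, hn₀⟩ := eventually_atTop.1 (k.eventually_le hu hε)
  refine ⟨max n₀ 0, le_max_right _ _, fun n hn => ?_⟩
  have := hn₀ n (le_of_max_le_left hn)
  push_cast
  linarith

/-- An element of `OPlus 1` is eventually bounded. -/
theorem exists_bound_of_one (q : OPlus (fun _ => 1)) :
    ∃ (Q : ℕ) (n₀ : ℤ), ∀ n ≥ n₀, q.toFun n ≤ Q := by
  obtain ⟨C, hC⟩ := q.isBigO.bound
  obtain ⟨n₀, hn₀⟩ := eventually_atTop.1 hC
  refine ⟨⌈C⌉₊, n₀, fun n hn => ?_⟩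
  have h := hn₀ n hn
  simp only [norm_one, mul_one, Real.norm_natCast] at h
  exact_mod_cast h.trans (Nat.le_ceil C)

end OPlus

/-! ### Carathéodory measures of ball structures -/

theorem ENNReal.tsum_image_le {α β : Type*} (f : α → β) (s : Set α) (g : β → ℝ≥0∞) :
    ∑' b : f '' s, g b ≤ ∑' a : s, g (f a) :=
  ENNReal.tsum_le_tsum_comp_of_surjective (f := s.imageFactorization f)
    Set.imageFactorization_surjective (fun b => g b)

namespace BallStructure

variable {X : Type*} (β : BallStructure X) {u : ℝ → ℝ}

theorem IsRound.mono {β : BallStructure X} {k : OPlus u} {n n' : ℤ} (h : n ≤ n') {a : Set X}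
    (ha : β.IsRound k n' a) : β.IsRound k n a := by
  obtain ⟨b, h1, h2⟩ := ha
  exact ⟨b, h.trans h1, h2⟩

theorem preCaratheodory_mono (ψ : Set X → ℝ≥0∞) (p : ℝ) (k : OPlus u) (A : Set X) :
    Monotone fun n => β.preCaratheodory ψ p k n A := by
  intro n n' h
  refine le_iInf₂ fun F hF => le_iInf₂ fun hround hA => ?_
  exact iInf₂_le_of_le F hF (iInf₂_le_of_le (fun a ha => (hround a ha).mono h) hA le_rfl)

theorem preCaratheodory_le {β : BallStructure X} {ψ : Set X → ℝ≥0∞} {p : ℝ} {k : OPlus u} {n : ℤ}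
    {A : Set X} {F : Set (Set X)} (hF : F.Countable) (h : ∀ a ∈ F, β.IsRound k n a)
    (hA : A ⊆ ⋃₀ F) : β.preCaratheodory ψ p k n A ≤ ∑' a : F, ψ a ^ p :=
  iInf₂_le_of_le F hF (iInf₂_le_of_le h hA le_rfl)

theorem le_preCaratheodory {β : BallStructure X} {ψ : Set X → ℝ≥0∞} {p : ℝ} {k : OPlus u} {n : ℤ}
    {A : Set X} {t : ℝ≥0∞} (h : ∀ F : Set (Set X), F.Countable → (∀ a ∈ F, β.IsRound k n a) →
      A ⊆ ⋃₀ F → t ≤ ∑' a : F, ψ a ^ p) : t ≤ β.preCaratheodory ψ p k n A :=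
  le_iInf₂ fun F hF => le_iInf₂ fun hround hA => h F hF hround hA

theorem le_shiftedGauge {ℓ : OPlus u} (φ : Set X → ℝ≥0∞) {a a' : Set X} (h : β.IsRing ℓ a a') :
    φ a' ≤ β.shiftedGauge ℓ φ a :=
  le_iSup₂_of_le (f := fun a' (_ : β.IsRing ℓ a a') => φ a') a' h le_rfl

section Oscillation

variable {I : Type*} (f : I → X → ℝ)

/-- The largest oscillation on `a` of the functions of a family. -/
def oscillation (a : Set X) : ℝ≥0∞ := ⨆ i, Metric.ediam (f i '' a)

/-- A power less than one of the oscillation of a separating family of continuous functions is an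
admissible gauge: the image of a curve contains an interval, which is covered by the images of the
round sets, whose lengths tend to zero. -/
theorem one_le_caratheodory_oscillation [TopologicalSpace X] (hf : ∀ i, Continuous (f i))
    (hsep : ∀ y z, y ≠ z → ∃ i, f i y ≠ f i z) (m : OPlus u)
    (hsmall : ∀ δ > (0 : ℝ≥0∞), ∃ n, ∀ a, β.IsRound m n a → oscillation f a ≤ δ)
    {θ : ℝ} (hθ0 : 0 < θ) (hθ1 : θ < 1) {γ : Set X} (hγ : γ ∈ nonconstantCurves X) :
    1 ≤ β.caratheodory (fun a => oscillation f a ^ θ) 1 m γ := by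
  obtain ⟨⟨y, hy, z, hz, hyz⟩, J, c, hJ, hc, rfl⟩ := hγ
  obtain ⟨i, hi⟩ := hsep y z hyz
  set L := ENNReal.ofReal |f i y - f i z| with hL
  have hL0 : 0 < L := ENNReal.ofReal_pos.2 (abs_pos.2 (sub_ne_zero.2 hi))
  have hLtop : L ≠ ⊤ := ENNReal.ofReal_ne_top
  have hθ : 0 < 1 - θ := by linarith
  obtain ⟨n, hn⟩ := hsmall (L ^ (1 / (1 - θ))) (ENNReal.rpow_pos hL0 hLtop)
  refine le_iSup_of_le n (le_preCaratheodory fun F hF hround hcov => ?_)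
  have hconn : (f i '' (c '' J)).OrdConnected :=
    ((hJ.isPreconnected.image c hc).image _ (hf i).continuousOn).ordConnected
  have h1 : L ≤ MeasureTheory.volume (f i '' (c '' J)) := by
    rw [hL, abs_sub_comm, ← Real.volume_interval]
    exact MeasureTheory.measure_mono
      (hconn.uIcc_subset (Set.mem_image_of_mem _ hy) (Set.mem_image_of_mem _ hz))
  have h2 : MeasureTheory.volume (f i '' (c '' J)) ≤ ∑' a : F, oscillation f a := by
    have : f i '' (c '' J) ⊆ ⋃ a : F, f i '' a := by
      rintro _ ⟨w, hw, rfl⟩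
      obtain ⟨a, ha, hwa⟩ := hcov hw
      exact Set.mem_iUnion.2 ⟨⟨a, ha⟩, Set.mem_image_of_mem _ hwa⟩
    have : Countable F := hF
    refine (MeasureTheory.measure_mono ‹_›).trans
      ((MeasureTheory.measure_iUnion_le _).trans (ENNReal.tsum_le_tsum fun a => ?_))
    exact (Real.volume_le_diam _).trans (le_iSup (fun i => Metric.ediam (f i '' (a : Set X))) i)
  have h3 : ∑' a : F, oscillation f a ≤
      L * ∑' a : F, (oscillation f (a : Set X) ^ θ) ^ (1 : ℝ) := by
    rw [← ENNReal.tsum_mul_left]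
    refine ENNReal.tsum_le_tsum fun a => ?_
    rw [ENNReal.rpow_one]
    have h4 := hn a (hround a a.2)
    calc oscillation f a = oscillation f (a : Set X) ^ (1 - θ) * oscillation f (a : Set X) ^ θ := by
          rw [← ENNReal.rpow_add_of_nonneg _ _ hθ.le hθ0.le]
          simp
      _ ≤ (L ^ (1 / (1 - θ))) ^ (1 - θ) * oscillation f (a : Set X) ^ θ := by gcongr
      _ = _ := by rw [← ENNReal.rpow_mul, one_div_mul_cancel hθ.ne', ENNReal.rpow_one]
  have h5 := h1.trans (h2.trans h3)
  have h6 : L * 1 ≤ L * ∑' a : F, (oscillation f (a : Set X) ^ θ) ^ (1 : ℝ) := by simpa using h5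
  exact (ENNReal.mul_le_mul_iff_right hL0.ne' hLtop).1 h6

end Oscillation

/-- A space which is a countable union of pieces of arbitrarily small premeasure at all scales has
Carathéodory measure at most one. -/
theorem caratheodory_univ_le_one {ψ : Set X → ℝ≥0∞} {p : ℝ} {k : OPlus u} {T : Set (Set X)}
    (hT : T.Countable) (hcov : ⋃₀ T = Set.univ)
    (h : ∀ A ∈ T, ∀ n : ℤ, ∀ η > (0 : ℝ≥0∞), ∃ F : Set (Set X), F.Countable ∧
      (∀ a ∈ F, β.IsRound k n a) ∧ A ⊆ ⋃₀ F ∧ ∑' a : F, ψ a ^ p ≤ η) :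
    β.caratheodory ψ p k Set.univ ≤ 1 := by
  refine iSup_le fun n => ?_
  have : Countable T := hT
  obtain ⟨η, hη, hsum⟩ := ENNReal.exists_pos_sum_of_countable (ε := 1) one_ne_zero T
  choose F hF1 hF2 hF3 hF4 using fun A : T => h A A.2 n (η A) (ENNReal.coe_pos.2 (hη A))
  refine (preCaratheodory_le (F := ⋃ A, F A) (Set.countable_iUnion hF1) ?_ ?_).trans ?_
  · intro a ha
    obtain ⟨A, hA⟩ := Set.mem_iUnion.1 ha
    exact hF2 A a hA
  · intro x hx
    rw [← hcov] at hx
    obtain ⟨A, hA, hxA⟩ := hx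
    obtain ⟨a, ha, hxa⟩ := hF3 ⟨A, hA⟩ hxA
    exact ⟨a, Set.mem_iUnion.2 ⟨⟨A, hA⟩, ha⟩, hxa⟩
  · refine (ENNReal.tsum_iUnion_le_tsum (fun a => ψ a ^ p) F).trans ?_
    exact (ENNReal.tsum_le_tsum hF4).trans hsum.le

/-- A gauge giving length at least one to arbitrarily many separated sets has infinite total
length. -/
theorem caratheodory_univ_eq_top_of_separated {φ : Set X → ℝ≥0∞} {k : OPlus u}
    (h : ∀ M : ℕ, ∃ A : Fin M → Set X, (∀ j, 1 ≤ β.caratheodory φ 1 k (A j)) ∧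
      ∃ n₀ : ℤ, ∀ a, β.IsRound k n₀ a → ∀ i j, (a ∩ A i).Nonempty → (a ∩ A j).Nonempty → i = j) :
    β.caratheodory φ 1 k Set.univ = ⊤ := by
  classical
  refine ENNReal.eq_top_of_forall_nnreal_le fun R => ?_
  obtain ⟨M, hM⟩ := exists_nat_ge R
  obtain ⟨A, hA, n₀, hsep⟩ := h M
  calc (R : ℝ≥0∞) ≤ (M : ℝ≥0∞) := by exact_mod_cast hM
    _ = ∑ _j : Fin M, 1 := by simp
    _ ≤ ∑ j : Fin M, β.caratheodory φ 1 k (A j) := Finset.sum_le_sum fun j _ => hA j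
    _ = ⨆ n : ℤ, ∑ j : Fin M, β.preCaratheodory φ 1 k n (A j) :=
        ENNReal.finsetSum_iSup_of_monotone fun j => β.preCaratheodory_mono _ _ _ _
    _ ≤ _ := ?_
  refine iSup_le fun n => le_iSup_of_le (max n n₀) (le_preCaratheodory fun F hF hround hcov => ?_)
  have h1 : ∀ j, β.preCaratheodory φ 1 k n (A j) ≤
      ∑' a : F, if ((a : Set X) ∩ A j).Nonempty then φ a else 0 := by
    intro j
    refine (preCaratheodory_le (F := {a ∈ F | (a ∩ A j).Nonempty}) (hF.mono (Set.sep_subset _ _))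
      (fun a ha => (hround a ha.1).mono (le_max_left _ _)) ?_).trans ?_
    · intro x hx
      obtain ⟨a, ha, hxa⟩ := hcov (Set.mem_univ x)
      exact ⟨a, ⟨ha, x, hxa, hx⟩, hxa⟩
    · rw [tsum_subtype {a ∈ F | (a ∩ A j).Nonempty} (fun a => φ a ^ (1 : ℝ)),
        tsum_subtype F (fun a => if (a ∩ A j).Nonempty then φ a else 0)]
      refine ENNReal.tsum_le_tsum fun a => ?_
      by_cases ha : a ∈ F <;> by_cases hj : (a ∩ A j).Nonempty <;> simp [Set.indicator, ha, hj]
  calc _ ≤ ∑ j, ∑' a : F, (if ((a : Set X) ∩ A j).Nonempty then φ a else 0) :=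
        Finset.sum_le_sum fun j _ => h1 j
    _ = ∑' a : F, ∑ j, (if ((a : Set X) ∩ A j).Nonempty then φ a else 0) :=
        (Summable.tsum_finsetSum fun _ _ => ENNReal.summable).symm
    _ ≤ _ := ENNReal.tsum_le_tsum fun a => ?_
  rw [ENNReal.rpow_one]
  by_cases hex : ∃ j, ((a : Set X) ∩ A j).Nonempty
  · obtain ⟨j, hj⟩ := hex
    rw [Finset.sum_eq_single j]
    · simp [hj]
    · intro i _ hij
      rw [if_neg]
      exact fun hi => hij (hsep a ((hround a a.2).mono (le_max_right _ _)) i j hi hj)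
    · simp
  · rw [Finset.sum_eq_zero]
    · exact zero_le
    · intro j _
      exact if_neg fun hj => hex ⟨j, hj⟩

/-- An elementary substitute for Hölder's inequality: the term `x ^ p` dominates if
`x ≥ exp (-σ t)`, and the term `exp (-q t)` dominates otherwise. -/
theorem mul_exp_le_of_split {x t n p σ κ q η : ℝ} (hx : 0 ≤ x) (hp : 1 ≤ p) (hn : 0 ≤ n)
    (hnt : n ≤ t) (hη : 0 ≤ η) (h1 : η ≤ κ - σ * (p - 1)) (h2 : η ≤ κ + σ - q) :
    x * Real.exp (-(κ * t)) ≤ Real.exp (-(η * n)) * (x ^ p + Real.exp (-(q * t))) := by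
  have ht : 0 ≤ t := hn.trans hnt
  have hηt : Real.exp (-(η * t)) ≤ Real.exp (-(η * n)) :=
    Real.exp_le_exp.2 (by nlinarith)
  rcases le_or_gt (Real.exp (-(σ * t))) x with hxt | hxt
  · have hx0 : 0 < x := (Real.exp_pos _).trans_le hxt
    have h3 : x ^ (1 - p) ≤ Real.exp (σ * (p - 1) * t) := by
      calc x ^ (1 - p) ≤ Real.exp (-(σ * t)) ^ (1 - p) :=
            Real.rpow_le_rpow_of_nonpos (Real.exp_pos _) hxt (by linarith)
        _ = _ := by rw [← Real.exp_mul]; ring_nf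
    calc x * Real.exp (-(κ * t)) = x ^ p * x ^ (1 - p) * Real.exp (-(κ * t)) := by
          rw [← Real.rpow_add hx0]; simp
      _ ≤ x ^ p * Real.exp (σ * (p - 1) * t) * Real.exp (-(κ * t)) := by gcongr
      _ = x ^ p * Real.exp (-((κ - σ * (p - 1)) * t)) := by
          rw [mul_assoc, ← Real.exp_add]; ring_nf
      _ ≤ x ^ p * Real.exp (-(η * t)) := by
          gcongr
      _ ≤ x ^ p * Real.exp (-(η * n)) := by gcongr
      _ ≤ Real.exp (-(η * n)) * (x ^ p + Real.exp (-(q * t))) := by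
          rw [mul_comm, mul_add]
          have : 0 ≤ Real.exp (-(η * n)) * Real.exp (-(q * t)) := by positivity
          linarith
  · calc x * Real.exp (-(κ * t)) ≤ Real.exp (-(σ * t)) * Real.exp (-(κ * t)) := by gcongr
      _ = Real.exp (-((κ + σ - q) * t)) * Real.exp (-(q * t)) := by
          rw [← Real.exp_add, ← Real.exp_add]; ring_nf
      _ ≤ Real.exp (-(η * t)) * Real.exp (-(q * t)) := by
          gcongr
      _ ≤ Real.exp (-(η * n)) * Real.exp (-(q * t)) := by gcongr
      _ ≤ _ := by
          gcongr
          have : 0 ≤ x ^ p := Real.rpow_nonneg hx p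
          linarith

open MeasureTheory in
/-- The length-volume argument. Suppose that a measured family of curves `γ z` has `φ`-length at
least one, and that every covering by round sets can be thinned out and enlarged to a covering of
these curves by sets `a'` such that the measure of the curves meeting `a'` is at most of order
`exp (-κ t)`, where the levels `t` satisfy `∑ exp (-q t) ≤ C₁`. Integrating the lengths over the
family shows that the Carathéodory measure of exponent `p` is infinite. -/
theorem caratheodory_univ_eq_top_of_selection {k ℓ : OPlus u} {φ : Set X → ℝ≥0}
    {φ' : Set X → ℝ≥0∞} {p σ κ q : ℝ} (hp : 1 ≤ p) (h1 : σ * (p - 1) < κ) (h2 : q < κ + σ)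
    {Z : Type*} [MeasurableSpace Z] (ν : Measure Z) {G : Set Z} (hG : 0 < ν G) (γ : Z → Set X)
    (hγ : ∀ z ∈ G, 1 ≤ β.caratheodory (fun a => (φ a : ℝ≥0∞)) 1 ℓ (γ z)) {C₁ C₂ : ℝ≥0∞}
    (hC₁ : C₁ ≠ ⊤) (hC₂ : C₂ ≠ ⊤)
    (hsel : ∃ n₁ : ℤ, ∀ n ≥ n₁, ∀ F : Set (Set X), F.Countable → (∀ a ∈ F, β.IsRound k n a) →
      Set.univ ⊆ ⋃₀ F → ∃ I ⊆ F, ∃ (e : Set X → Set X) (t : Set X → ℝ),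
        (∀ a ∈ I, β.IsRound ℓ n (e a)) ∧ (∀ a ∈ I, (φ (e a) : ℝ≥0∞) ≤ φ' a) ∧
        (∀ z ∈ G, γ z ⊆ ⋃ a ∈ I, e a) ∧ (∀ a ∈ I, (n : ℝ) ≤ t a) ∧
        (∀ a ∈ I, ν {z ∈ G | (γ z ∩ e a).Nonempty} ≤
          C₂ * ENNReal.ofReal (Real.exp (-(κ * t a)))) ∧
        ∑' a : I, ENNReal.ofReal (Real.exp (-(q * t a))) ≤ C₁) :
    β.caratheodory φ' p k Set.univ = ⊤ := by
  classical
  obtain ⟨n₁, hsel⟩ := hsel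
  set η := min (κ - σ * (p - 1)) (κ + σ - q) with hηdef
  have hη : 0 < η := lt_min (by linarith) (by linarith)
  -- the curves whose length is already seen at scale `n`
  let E : ℤ → Set Z := fun n =>
    {z ∈ G | 2⁻¹ ≤ β.preCaratheodory (fun a => (φ a : ℝ≥0∞)) 1 ℓ n (γ z)}
  have hEmono : Monotone E := fun n n' h z hz =>
    ⟨hz.1, hz.2.trans (β.preCaratheodory_mono _ _ _ _ h)⟩
  have hEU : G ⊆ ⋃ n, E n := by
    intro z hz
    have h3 : (2⁻¹ : ℝ≥0∞) < β.caratheodory (fun a => (φ a : ℝ≥0∞)) 1 ℓ (γ z) :=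
      lt_of_lt_of_le (by simp) (hγ z hz)
    obtain ⟨n, hn⟩ := lt_iSup_iff.1 h3
    exact Set.mem_iUnion.2 ⟨n, hz, hn.le⟩
  obtain ⟨n₂, hn₂⟩ : ∃ n, 0 < ν (E n) := by
    have h3 : 0 < ⨆ n, ν (E n) := by
      rw [← hEmono.measure_iUnion]
      exact hG.trans_le (measure_mono hEU)
    exact lt_iSup_iff.1 h3
  refine ENNReal.eq_top_of_forall_nnreal_le fun R => ?_
  -- the scale is chosen so fine that total mass `R` cannot account for the curves in `E n₂`
  have hlim : Tendsto (fun n : ℤ => C₂ * (ENNReal.ofReal (Real.exp (-(η * n))) * (R + C₁)))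
      atTop (nhds 0) := by
    have h3 : Tendsto (fun n : ℤ => Real.exp (-(η * n))) atTop (nhds 0) :=
      Real.tendsto_exp_neg_atTop_nhds_zero.comp
        (tendsto_intCast_atTop_atTop.const_mul_atTop hη)
    have h4 := ENNReal.tendsto_ofReal h3
    rw [ENNReal.ofReal_zero] at h4
    have h5 := ENNReal.Tendsto.mul_const (b := (R + C₁ : ℝ≥0∞)) h4
      (Or.inr (by simp [hC₁]))
    have h6 := ENNReal.Tendsto.const_mul (a := C₂) h5 (Or.inr hC₂)
    simpa using h6
  have hpos : 0 < 2⁻¹ * ν (E n₂) := ENNReal.mul_pos (by simp) hn₂.ne'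
  obtain ⟨n, hn, hn1, hn2, hn0⟩ := ((hlim.eventually (gt_mem_nhds hpos)).and
    ((eventually_ge_atTop n₁).and ((eventually_ge_atTop n₂).and
      (eventually_ge_atTop 0)))).exists
  refine le_iSup_of_le n (le_preCaratheodory fun F hF hround hcov => ?_)
  obtain ⟨I, hIF, e, t, hr, hφ, hγI, ht, hν, hsum⟩ := hsel n hn1 F hF hround hcov
  have hIc : I.Countable := hF.mono hIF
  have : Countable I := hIc
  let T : I → Set Z := fun a => toMeasurable ν {z ∈ G | (γ z ∩ e a).Nonempty}
  let g : Z → ℝ≥0∞ := fun z => ∑' a : I, (T a).indicator (fun _ => (φ (e a) : ℝ≥0∞)) z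
  have hg : ∀ z ∈ E n, 2⁻¹ ≤ g z := by
    intro z hz
    refine hz.2.trans ?_
    refine (preCaratheodory_le (F := e '' {a ∈ I | (γ z ∩ e a).Nonempty})
      ((hIc.mono (Set.sep_subset _ _)).image _) ?_ ?_).trans ?_
    · rintro _ ⟨a, ha, rfl⟩
      exact hr a ha.1
    · intro x hx
      obtain ⟨a, ha, hxa⟩ := Set.mem_iUnion₂.1 (hγI z hz.1 hx)
      exact ⟨e a, ⟨a, ⟨ha, x, hx, hxa⟩, rfl⟩, hxa⟩
    · refine (ENNReal.tsum_image_le e _ (fun a => (φ a : ℝ≥0∞) ^ (1 : ℝ))).trans ?_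
      rw [tsum_subtype {a ∈ I | (γ z ∩ e a).Nonempty} (fun a => (φ (e a) : ℝ≥0∞) ^ (1 : ℝ))]
      have h3 : g z = ∑' a, I.indicator
          (fun a => (toMeasurable ν {z ∈ G | (γ z ∩ e a).Nonempty}).indicator
            (fun _ => (φ (e a) : ℝ≥0∞)) z) a :=
        tsum_subtype I (fun a => (toMeasurable ν {z ∈ G | (γ z ∩ e a).Nonempty}).indicator
          (fun _ => (φ (e a) : ℝ≥0∞)) z)
      rw [h3]
      refine ENNReal.tsum_le_tsum fun a => ?_
      by_cases ha : a ∈ I ∧ (γ z ∩ e a).Nonempty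
      · have h4 : z ∈ toMeasurable ν {z ∈ G | (γ z ∩ e a).Nonempty} :=
          subset_toMeasurable _ _ ⟨hz.1, ha.2⟩
        simp [Set.indicator, ha, h4]
      · have : a ∉ {a ∈ I | (γ z ∩ e a).Nonempty} := ha
        rw [Set.indicator_of_notMem this]
        exact zero_le
  have hgm : Measurable g := Measurable.tsum fun a =>
    measurable_const.indicator (measurableSet_toMeasurable _ _)
  have hint : ∫⁻ z, g z ∂ν ≤
      C₂ * (ENNReal.ofReal (Real.exp (-(η * n))) * (∑' a : F, φ' a ^ p + C₁)) := by
    rw [lintegral_tsum fun a =>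
      (measurable_const.indicator (measurableSet_toMeasurable _ _)).aemeasurable]
    calc _ ≤ ∑' a : I, C₂ * (ENNReal.ofReal (Real.exp (-(η * n))) *
          (φ' a ^ p + ENNReal.ofReal (Real.exp (-(q * t a))))) := by
          refine ENNReal.tsum_le_tsum fun a => ?_
          rw [lintegral_indicator_const (measurableSet_toMeasurable _ _), measure_toMeasurable]
          have h3 := mul_exp_le_of_split (x := φ (e a)) (t := t a) (n := n) (p := p) (σ := σ)
            (κ := κ) (q := q) (η := η) (NNReal.coe_nonneg _) hp (by exact_mod_cast hn0)
            (ht a a.2) hη.le (min_le_left _ _) (min_le_right _ _)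
          have h4 := ENNReal.ofReal_le_ofReal h3
          rw [ENNReal.ofReal_mul (NNReal.coe_nonneg _), ENNReal.ofReal_mul (Real.exp_pos _).le,
            ENNReal.ofReal_add (by positivity) (Real.exp_pos _).le,
            ← ENNReal.ofReal_rpow_of_nonneg (NNReal.coe_nonneg _) (by linarith),
            ENNReal.ofReal_coe_nnreal] at h4
          calc _ ≤ (φ (e a) : ℝ≥0∞) * (C₂ * ENNReal.ofReal (Real.exp (-(κ * t a)))) := by
                gcongr; exact hν a a.2
            _ = C₂ * ((φ (e a) : ℝ≥0∞) * ENNReal.ofReal (Real.exp (-(κ * t a)))) := by ring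
            _ ≤ C₂ * (ENNReal.ofReal (Real.exp (-(η * n))) *
                ((φ (e a) : ℝ≥0∞) ^ p + ENNReal.ofReal (Real.exp (-(q * t a))))) := by gcongr
            _ ≤ _ := by gcongr; exact hφ a a.2
      _ = C₂ * (ENNReal.ofReal (Real.exp (-(η * n))) * (∑' a : I, φ' a ^ p +
          ∑' a : I, ENNReal.ofReal (Real.exp (-(q * t a))))) := by
          rw [ENNReal.tsum_mul_left, ENNReal.tsum_mul_left, ENNReal.tsum_add]
      _ ≤ _ := by
          gcongr
          exact ENNReal.tsum_mono_subtype (fun a => φ' a ^ p) hIF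
  have hlow : 2⁻¹ * ν (E n₂) ≤ ∫⁻ z, g z ∂ν := by
    refine le_trans ?_ (mul_meas_ge_le_lintegral hgm 2⁻¹)
    gcongr
    exact fun z hz => hg z (hEmono hn2 hz)
  by_contra! hlt
  have h3 := hlow.trans hint
  have h4 : C₂ * (ENNReal.ofReal (Real.exp (-(η * n))) * (∑' a : F, φ' a ^ p + C₁)) ≤
      C₂ * (ENNReal.ofReal (Real.exp (-(η * n))) * (R + C₁)) := by
    gcongr
  exact absurd (h3.trans h4) (not_le.2 hn)

end BallStructure

/-! ### Packing and covering estimates -/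

namespace IsDilationChart

open MeasureTheory

variable {N : Type*} [TopologicalSpace N] [Group N] [IsTopologicalGroup N] {D : MulAut N}
  {ι : Type*} [Fintype ι] {μ : ι → ℝ} {ψ : OpenPartialHomeomorph N (ι → ℝ)}

theorem exists_chartBall_mul_subset (hψ : IsDilationChart D μ ψ) {W : Set N}
    (hW : W ∈ nhds (1 : N)) : ∃ r > 0, ∀ x ∈ chartBall ψ r, ∀ y ∈ chartBall ψ r,
      x * y ∈ W ∧ x * y⁻¹ ∈ W := by
  have h1 : Tendsto (fun z : N × N => z.1 * z.2) (nhds (1, 1)) (nhds 1) := by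
    have : Continuous (fun z : N × N => z.1 * z.2) := by fun_prop
    simpa using this.tendsto (1, 1)
  have h2 : Tendsto (fun z : N × N => z.1 * z.2⁻¹) (nhds (1, 1)) (nhds 1) := by
    have : Continuous (fun z : N × N => z.1 * z.2⁻¹) := by fun_prop
    simpa using this.tendsto (1, 1)
  have h3 : (fun z : N × N => z.1 * z.2) ⁻¹' W ∩ (fun z : N × N => z.1 * z.2⁻¹) ⁻¹' W ∈
      nhds ((1 : N), (1 : N)) := inter_mem (h1 hW) (h2 hW)
  rw [nhds_prod_eq] at h3
  obtain ⟨W₁, hW₁, W₂, hW₂, h⟩ := Filter.mem_prod_iff.1 h3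
  obtain ⟨r, hr, -, h4⟩ := hψ.exists_chartBall_subset (inter_mem hW₁ hW₂)
  exact ⟨r, hr, fun x hx y hy => h (Set.mk_mem_prod (h4 hx).1 (h4 hy).2)⟩

/-- Packing estimate: disjoint sets `x (D ^ n U)` centered near a given point satisfy
`∑ exp (-(∑ i, μ i + ε) n) ≤ M`, since their volumes add up to at most that of a bounded set. The
neighbourhood `U` can be chosen so small that `U U⁻¹` is contained in `B`. -/
theorem exists_tsum_le_of_disjoint (hψ : IsDilationChart D μ ψ) (hD : Continuous D)
    (hDo : IsOpenMap D) (hμ : ∀ i, 1 ≤ μ i) {ε : ℝ} (hε : 0 < ε) {B : Set N}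
    (hB : B ∈ nhds (1 : N)) :
    ∃ r > 0, ∃ U : Set N, IsOpen U ∧ (1 : N) ∈ U ∧
      (∀ x ∈ U, ∀ y ∈ U, x * y⁻¹ ∈ B) ∧ ∃ M : ℝ≥0∞, M ≠ ⊤ ∧
      ∀ (J : Type*) [Countable J] (o : N) (x : J → N) (n : J → ℕ),
        (∀ j, o⁻¹ * x j ∈ chartBall ψ r) →
        Pairwise (fun i j => Disjoint ((fun y => x i * (D ^ n i) y) '' U)
          ((fun y => x j * (D ^ n j) y) '' U)) →
        ∑' j, ENNReal.ofReal (Real.exp (-((∑ i, μ i + ε) * n j))) ≤ M := by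
  obtain ⟨r, hr, hvol⟩ := hψ.exists_le_volume hD hμ hε
  obtain ⟨r₁, hr₁, h1⟩ := hψ.exists_chartBall_mul_subset
    (inter_mem hB (hψ.chartBall_mem_nhds hr))
  set r' := min r r₁ with hr'
  have hr'pos : 0 < r' := lt_min hr hr₁
  obtain ⟨c, hc, h2⟩ := hvol r' hr'pos (min_le_left _ _)
  set M₀ := volume (ψ '' chartBall ψ r) with hM₀
  have hM₀top : M₀ ≠ ⊤ := (volume_image_chartBall_lt_top (ψ := ψ) r).ne
  refine ⟨r', hr'pos, chartBall ψ r', isOpen_chartBall ψ r', hψ.one_mem_chartBall hr'pos,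
    fun x hx y hy => (h1 x (chartBall_mono ψ (min_le_right _ _) hx) y
      (chartBall_mono ψ (min_le_right _ _) hy)).2.1, (ENNReal.ofReal c)⁻¹ * M₀,
      ENNReal.mul_ne_top (ENNReal.inv_ne_top.2 (ENNReal.ofReal_pos.2 hc).ne') hM₀top, ?_⟩
  intro J _ o x n hx hdisj
  let A : J → Set N := fun j => (fun k => o⁻¹ * x j * (D ^ n j) k) '' chartBall ψ r'
  have hAr : ∀ j, A j ⊆ chartBall ψ r := by
    rintro j _ ⟨k, hk, rfl⟩
    exact (h1 _ (chartBall_mono ψ (min_le_right _ _) (hx j)) _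
      (chartBall_mono ψ (min_le_right _ _) ((h2 (n j)).1 ⟨k, hk, rfl⟩))).1.2
  have hAo : ∀ j, IsOpen (A j) := fun j =>
    ((isOpenMap_mul_left (o⁻¹ * x j)).comp (MulAut.isOpenMap_pow hDo (n j))) _
      (isOpen_chartBall ψ r')
  have hAd : Pairwise (fun i j => Disjoint (ψ '' A i) (ψ '' A j)) := by
    intro i j hij
    refine Set.disjoint_left.2 ?_
    rintro _ ⟨_, ⟨k, hk, rfl⟩, rfl⟩ ⟨_, ⟨k', hk', rfl⟩, heq⟩
    have h3 := ψ.injOn (hAr j ⟨k', hk', rfl⟩).1 (hAr i ⟨k, hk, rfl⟩).1 heq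
    have h4 : x j * (D ^ n j) k' = x i * (D ^ n i) k := by
      simpa [mul_assoc] using h3
    exact Set.disjoint_left.1 (hdisj hij) ⟨k, hk, rfl⟩ ⟨k', hk', h4⟩
  have hAm : ∀ j, MeasurableSet (ψ '' A j) := fun j =>
    (ψ.isOpen_image_of_subset_source (hAo j) ((hAr j).trans Set.inter_subset_left)).measurableSet
  have h3 : ∑' j, volume (ψ '' A j) ≤ M₀ := by
    rw [← measure_iUnion hAd hAm]
    exact measure_mono (Set.iUnion_subset fun j => Set.image_mono (hAr j))
  have h4 : ENNReal.ofReal c * ∑' j, ENNReal.ofReal (Real.exp (-((∑ i, μ i + ε) * n j))) ≤ M₀ := by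
    rw [← ENNReal.tsum_mul_left]
    refine le_trans (ENNReal.tsum_le_tsum fun j => ?_) h3
    rw [← ENNReal.ofReal_mul hc.le]
    exact ((h2 (n j)).2 _ (chartBall_mono ψ (min_le_left _ _) (hx j))).2
  have hc0 := (ENNReal.ofReal_pos.2 hc).ne'
  calc _ = (ENNReal.ofReal c)⁻¹ * (ENNReal.ofReal c *
        ∑' j, ENNReal.ofReal (Real.exp (-((∑ i, μ i + ε) * n j)))) := by
        rw [← mul_assoc, ENNReal.inv_mul_cancel hc0 ENNReal.ofReal_ne_top, one_mul]
    _ ≤ _ := by gcongr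

/-- Smallness of the sets `x (D ^ n B)`: those meeting a small neighbourhood of a point of an open
set `Ω` are contained in `Ω`, and centered near this point. -/
theorem exists_forall_subset [ConnectedSpace N] (hψ : IsDilationChart D μ ψ) (hD : Continuous D)
    (hμ : ∀ i, 1 ≤ μ i) {B : Set N} (hB : IsCompact B) {Ω : Set N}
    (hΩ : IsOpen Ω) {o : N} (ho : o ∈ Ω) {r : ℝ} (hr : 0 < r) :
    ∃ r' > 0, ∃ n₀ : ℕ, ∀ n ≥ n₀, ∀ x z, z ∈ (fun y => x * (D ^ n) y) '' B →
      o⁻¹ * z ∈ chartBall ψ r' →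
      (fun y => x * (D ^ n) y) '' B ⊆ Ω ∧ ∀ y ∈ (fun y => x * (D ^ n) y) '' B,
        o⁻¹ * y ∈ chartBall ψ r := by
  have hW : (fun z => o * z) ⁻¹' Ω ∩ chartBall ψ r ∈ nhds (1 : N) := by
    refine inter_mem ((continuous_const_mul o).continuousAt.preimage_mem_nhds ?_)
      (hψ.chartBall_mem_nhds hr)
    rw [mul_one]
    exact hΩ.mem_nhds ho
  obtain ⟨r₁, hr₁, h1⟩ := hψ.exists_chartBall_mul_subset hW
  obtain ⟨n₀, hn₀⟩ := hψ.exists_forall_pow_mem hD hμ (hB.inv.mul hB) hr₁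
  refine ⟨r₁, hr₁, n₀, fun n hn x z hz hzr => ?_⟩
  have key : ∀ y ∈ (fun y => x * (D ^ n) y) '' B,
      o⁻¹ * y ∈ (fun z => o * z) ⁻¹' Ω ∩ chartBall ψ r := by
    rintro _ ⟨k, hk, rfl⟩
    obtain ⟨k', hk', rfl⟩ := hz
    have h3 := (h1 _ hzr _ (hn₀ n hn (k'⁻¹ * k)
      (Set.mul_mem_mul (Set.inv_mem_inv.2 hk') hk))).1
    simpa [mul_assoc] using h3
  refine ⟨fun y hy => ?_, fun y hy => (key y hy).2⟩
  simpa using (key y hy).1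

/-- Covering estimate: a neighbourhood of a point of the open set `Ω` is covered by sets
`x (D ^ n B)` contained in `Ω`, with centers `x` in `Ω` whose number is at most of order
`exp ((∑ i, μ i + ε) n)`. -/
theorem exists_cover [ConnectedSpace N] [SecondCountableTopology N] (hψ : IsDilationChart D μ ψ)
    (hD : Continuous D) (hDo : IsOpenMap D) (hμ : ∀ i, 1 ≤ μ i) {ε : ℝ} (hε : 0 < ε) {B : Set N}
    (hB : IsCompact B) (hB1 : B ∈ nhds (1 : N)) {Ω : Set N} (hΩ : IsOpen Ω) {o : N} (ho : o ∈ Ω) :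
    ∃ W ∈ nhds o, ∃ M : ℝ≥0∞, M ≠ ⊤ ∧ ∃ n₀ : ℕ, ∀ n ≥ n₀, ∃ T : Set N, T.Countable ∧ T ⊆ Ω ∧
      (∀ x ∈ T, (fun y => x * (D ^ n) y) '' B ⊆ Ω) ∧
      W ⊆ ⋃ x ∈ T, (fun y => x * (D ^ n) y) '' B ∧
      ∑' _x : T, ENNReal.ofReal (Real.exp (-((∑ i, μ i + ε) * n))) ≤ M := by
  obtain ⟨r, hr, U, hU, hU1, hUB, M, hM, hpack⟩ := hψ.exists_tsum_le_of_disjoint hD hDo hμ hε hB1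
  obtain ⟨r', hr', n₀, hsub⟩ := hψ.exists_forall_subset hD hμ hB hΩ ho hr
  have hself : ∀ (n : ℕ) (x : N), x ∈ (fun y => x * (D ^ n) y) '' B := fun n x =>
    ⟨1, mem_of_mem_nhds hB1, by simp⟩
  let W : Set N := (fun z => o⁻¹ * z) ⁻¹' chartBall ψ r'
  have hW : W ∈ nhds o := by
    refine (continuous_const_mul o⁻¹).continuousAt.preimage_mem_nhds ?_
    rw [inv_mul_cancel]
    exact hψ.chartBall_mem_nhds hr'
  refine ⟨W, hW, M, hM, n₀, fun n hn => ?_⟩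
  obtain ⟨T, hTW, hdisj, hT⟩ := Vitali.exists_disjoint_subfamily_covering_enlargement
    (fun x => (fun y => x * (D ^ n) y) '' U) W (fun _ => 1) 2 (by norm_num) (by simp) 1
    (by simp) (fun x _ => ⟨x * (D ^ n) 1, 1, hU1, rfl⟩)
  have hTc : T.Countable := hdisj.countable_of_isOpen
    (fun x _ => ((isOpenMap_mul_left x).comp (MulAut.isOpenMap_pow hDo n)) _ hU)
    (fun x _ => ⟨x * (D ^ n) 1, 1, hU1, rfl⟩)
  have hTs : ∀ x ∈ T, (fun y => x * (D ^ n) y) '' B ⊆ Ω ∧ ∀ y ∈ (fun y => x * (D ^ n) y) '' B,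
      o⁻¹ * y ∈ chartBall ψ r := fun x hx => hsub n hn x x (hself n x) (hTW hx)
  refine ⟨T, hTc, fun x hx => (hTs x hx).1 (hself n x), fun x hx => (hTs x hx).1, ?_, ?_⟩
  · intro y hy
    obtain ⟨x, hx, ⟨_, ⟨k, hk, rfl⟩, ⟨k', hk', heq⟩⟩, -⟩ := hT y hy
    refine Set.mem_iUnion₂.2 ⟨x, hx, k' * k⁻¹, hUB _ hk' _ hk, ?_⟩
    simp only [map_mul, map_inv] at heq ⊢
    rw [← mul_assoc, heq, mul_inv_cancel_right]
  · have : Countable T := hTc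
    exact hpack T o (fun x => x) (fun _ => n) (fun x => (hTs x x.2).2 _ (hself n x))
      (fun x y hxy => hdisj x.2 y.2 (fun h => hxy (Subtype.ext h)))

end IsDilationChart

/-! ### Finite modulus above the dimension -/

namespace HeintzeData

variable {E : Type*} [NormedAddCommGroup E] [NormedSpace ℝ E] [FiniteDimensional ℝ E]
  {N : Type*} [TopologicalSpace N] [ChartedSpace E N] [Group N] [LieGroup 𝓘(ℝ, E) ∞ N]
  (S : HeintzeData E N)

/-- The balls of nonnegative level, in terms of the iterates of the contraction `e^{-α}`. -/
theorem generated_real_natCast {B : Set N} (hB : B.Nonempty) (x : N) (n : ℕ) :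
    (S.generated B hB).real (x, (n : ℤ)) = (fun y => x * (S.dilation (-1) ^ n) y) '' B := by
  rw [← S.dilation_neg_natCast]
  rfl

theorem continuous_dilation (t : ℝ) : Continuous (S.dilation t) :=
  (S.contMDiff_dilation t).continuous

theorem isOpenMap_dilation (t : ℝ) : IsOpenMap (S.dilation t) := by
  have h : ∀ s : ℝ, S.dilation (-s) * S.dilation s = 1 := by
    intro s
    simp only [dilation]
    rw [← map_mul, ← ofAdd_add]
    simp
  refine IsOpenMap.of_inverse (S.continuous_dilation (-t)) (fun x => ?_) (fun x => ?_)
  · have := h (-t)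
    rw [neg_neg] at this
    exact congrArg (fun f : MulAut N => f x) this
  · exact congrArg (fun f : MulAut N => f x) (h t)

variable {S} [IsTopologicalGroup N] [ConnectedSpace N] {ι : Type*} [Fintype ι] {μ : ι → ℝ}
  {ψ : OpenPartialHomeomorph N (ι → ℝ)} {u : ℝ → ℝ} {B Ω : Set N}

omit [IsTopologicalGroup N] [ConnectedSpace N] in
/-- The oscillations of left translates of a bump function decay exponentially on the balls. -/
theorem oscillation_le_of_bump (hB : B.Nonempty) {f : N → ℝ} {C θ : ℝ}
    (hf : ∀ n : ℕ, ∀ x, ∀ w ∈ B, |f (x * (S.dilation (-1) ^ n) w) - f x| ≤ C * Real.exp (-(θ * n)))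
    (b : ((S.generated B hB).restrict Ω).Ball)
    (hb : 0 ≤ ((S.generated B hB).restrict Ω).level b) {a : Set Ω}
    (ha : a ⊆ ((S.generated B hB).restrict Ω).real b) :
    BallStructure.oscillation (fun (x : N) (z : Ω) => f (x * z)) a ≤
      ENNReal.ofReal (2 * C * Real.exp
        (-(θ * (((S.generated B hB).restrict Ω).level b : ℤ)))) := by
  obtain ⟨⟨x, j⟩, hbΩ⟩ := b
  obtain ⟨n, rfl⟩ : ∃ n : ℕ, j = n := Int.eq_ofNat_of_zero_le hb
  have hreal : ∀ z ∈ a, ∃ w ∈ B, (z : N) = x * (S.dilation (-1) ^ n) w := by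
    intro z hz
    have h1 : (z : N) ∈ (S.generated B hB).real (x, (n : ℤ)) := ha hz
    rw [generated_real_natCast] at h1
    obtain ⟨w, hw, h2⟩ := h1
    exact ⟨w, hw, h2.symm⟩
  refine iSup_le fun y => Metric.ediam_le ?_
  rintro _ ⟨z, hz, rfl⟩ _ ⟨z', hz', rfl⟩
  obtain ⟨w, hw, hzw⟩ := hreal z hz
  obtain ⟨w', hw', hzw'⟩ := hreal z' hz'
  rw [edist_dist, Real.dist_eq]
  refine ENNReal.ofReal_le_ofReal ?_
  have h1 := hf n (y * x) w hw
  have h2 := hf n (y * x) w' hw'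
  simp only [hzw, hzw', ← mul_assoc]
  have h3 := abs_sub_le (f (y * x * (S.dilation (-1) ^ n) w)) (f (y * x))
    (f (y * x * (S.dilation (-1) ^ n) w'))
  rw [abs_sub_comm (f (y * x))] at h3
  have e : ((((S.generated B hB).restrict Ω).level ⟨(x, (n : ℤ)), hbΩ⟩ : ℤ) : ℝ) = n := by
    change (((n : ℕ) : ℤ) : ℝ) = n
    simp
  rw [e]
  linarith

omit [IsTopologicalGroup N] [ConnectedSpace N] in
/-- The same decay holds for the sets contained in the dilates `m.b`, at the price of replacing the
exponent `θ` by `θ ^ 2`, because `m` is sublinear. -/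
theorem exists_oscillation_dilate_le (hu : IsAdmissible u) (hB : B.Nonempty) {f : N → ℝ} {C θ : ℝ}
    (hC : 0 ≤ C) (hθ0 : 0 < θ) (hθ1 : θ < 1)
    (hf : ∀ n : ℕ, ∀ x, ∀ w ∈ B, |f (x * (S.dilation (-1) ^ n) w) - f x| ≤ C * Real.exp (-(θ * n)))
    (m : OPlus u) :
    ∃ n₀ : ℤ, 0 ≤ n₀ ∧ ∀ n ≥ n₀, ∀ b, n ≤ ((S.generated B hB).restrict Ω).level b → ∀ a,
      a ⊆ ((S.generated B hB).restrict Ω).real (((S.generated B hB).restrict Ω).dilate m b) →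
      BallStructure.oscillation (fun (x : N) (z : Ω) => f (x * z)) a ≤
        ENNReal.ofReal (2 * C * Real.exp (-(θ ^ 2 * n))) := by
  obtain ⟨n₀, hn₀, h⟩ := m.exists_forall_le_sub hu (ε := 1 - θ) (by linarith)
  refine ⟨n₀, hn₀, fun n hn b hb a ha => ?_⟩
  have h1 := h _ (hn.trans hb)
  have hlev : ((S.generated B hB).restrict Ω).level
      (((S.generated B hB).restrict Ω).dilate m b) =
      ((S.generated B hB).restrict Ω).level b -
        m.toFun (((S.generated B hB).restrict Ω).level b) :=
    ((S.generated B hB).restrict Ω).level_shift _ _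
  set L := ((S.generated B hB).restrict Ω).level b with hL
  have hn' : (n : ℝ) ≤ (L : ℝ) := by exact_mod_cast hb
  have hn0' : (0 : ℝ) ≤ n := by exact_mod_cast hn₀.trans hn
  have h2 : θ * n ≤ ((L - m.toFun L : ℤ) : ℝ) := by
    refine le_trans ?_ h1
    rw [sub_sub_cancel]
    gcongr
  have h3 : (0 : ℝ) ≤ ((L - m.toFun L : ℤ) : ℝ) := le_trans (by positivity) h2
  refine (oscillation_le_of_bump hB hf _ (by rw [hlev]; exact_mod_cast h3) ha).trans ?_
  rw [hlev]
  have h4 : θ ^ 2 * n ≤ θ * ((L - m.toFun L : ℤ) : ℝ) := by nlinarith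
  gcongr

variable [T2Space N] [SecondCountableTopology N]

/-- For `p` larger than `∑ i, μ i`, the modulus with `k = 0` of the nonconstant curves is finite:
a suitable power of the oscillation of a bump function is an admissible gauge whose
`p`-dimensional Carathéodory measure is finite. -/
theorem modulus_zero_ne_top (hψ : IsDilationChart (S.dilation (-1)) μ ψ) (hμ : ∀ i, 1 ≤ μ i)
    (hu : IsAdmissible u) (hBcompact : IsCompact B) (hBconn : IsConnected B)
    (hB1 : B ∈ nhds (1 : N))
    (hβ : (S.generated B hBconn.nonempty).IsQuasisymmetric (fun _ => 1)) (hΩ : IsOpen Ω) {p : ℝ}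
    (hp : ∑ i, μ i < p) (ℓ m : OPlus u) :
    ((S.generated B hBconn.nonempty).restrict Ω).modulus p (OPlus.zero u) ℓ m
      (nonconstantCurves Ω) ≠ ⊤ := by
  set β := (S.generated B hBconn.nonempty).restrict Ω with hβdef
  have hp0 : 0 < p := lt_of_le_of_lt (Finset.sum_nonneg fun i _ => zero_le_one.trans (hμ i)) hp
  have hD := S.continuous_dilation (-1)
  have hDo := S.isOpenMap_dilation (-1)
  -- the power `θ ^ 3` accounts for the exponent of the gauge, the Hölder exponent of the bump
  -- function and the sublinear loss in the levels
  obtain ⟨θ, hθp, hθ0, hθ1⟩ : ∃ θ : ℝ, ∑ i, μ i < θ ^ 3 * p ∧ 0 < θ ∧ θ < 1 := by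
    have h1 : Tendsto (fun θ : ℝ => θ ^ 3 * p) (nhdsWithin 1 (Set.Iio 1)) (nhds p) := by
      have : Continuous (fun θ : ℝ => θ ^ 3 * p) := by fun_prop
      simpa using (this.tendsto 1).mono_left nhdsWithin_le_nhds
    have h2 : ∀ᶠ θ : ℝ in nhdsWithin 1 (Set.Iio 1), θ ∈ Set.Ioo (0 : ℝ) 1 :=
      Ioo_mem_nhdsLT one_pos
    obtain ⟨θ, h3, h4⟩ := ((h1.eventually (lt_mem_nhds hp)).and h2).exists
    exact ⟨θ, h3, h4.1, h4.2⟩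
  obtain ⟨f, hfc, hf1, ⟨R, hR⟩, hfK⟩ := hψ.exists_bump hD hμ hθ1 hθ0.le
  obtain ⟨C, hC, hfC⟩ := hfK B hBcompact
  let F : N → Ω → ℝ := fun x z => f (x * z)
  have hosctop : ∀ a, BallStructure.oscillation F a ≠ ⊤ := by
    intro a
    refine ne_top_of_le_ne_top (ENNReal.ofReal_ne_top (r := R))
      (iSup_le fun y => Metric.ediam_le ?_)
    rintro _ ⟨z, hz, rfl⟩ _ ⟨z', hz', rfl⟩
    rw [edist_dist, Real.dist_eq]
    exact ENNReal.ofReal_le_ofReal (hR _ _)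
  let φ : Set Ω → ℝ≥0 := fun a => (BallStructure.oscillation F a ^ θ).toNNReal
  have hφ : (fun a => (φ a : ℝ≥0∞)) = fun a => BallStructure.oscillation F a ^ θ := by
    funext a
    exact ENNReal.coe_toNNReal (ENNReal.rpow_ne_top_of_nonneg hθ0.le (hosctop a))
  have hadm : β.AdmissibleGauge m (nonconstantCurves Ω) φ := by
    intro γ hγ
    rw [hφ]
    refine β.one_le_caratheodory_oscillation F (fun x => by fun_prop) ?_ m ?_ hθ0 hθ1 hγ
    · intro y z hyz
      refine ⟨(y : N)⁻¹, fun h => ?_⟩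
      simp only [F, inv_mul_cancel] at h
      refine hf1 ((y : N)⁻¹ * z) (fun h1 => hyz ?_) h.symm
      exact Subtype.ext (inv_mul_eq_one.1 h1)
    · intro δ hδ
      obtain ⟨n₀, hn₀, h⟩ := exists_oscillation_dilate_le (S := S) (Ω := Ω) hu hBconn.nonempty
        hC.le hθ0 hθ1 hfC m
      have hlim : Tendsto (fun n : ℤ => ENNReal.ofReal (2 * C * Real.exp (-(θ ^ 2 * n)))) atTop
          (nhds 0) := by
        have h3 : Tendsto (fun n : ℤ => Real.exp (-(θ ^ 2 * n))) atTop (nhds 0) :=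
          Real.tendsto_exp_neg_atTop_nhds_zero.comp
            (tendsto_intCast_atTop_atTop.const_mul_atTop (by positivity))
        simpa using ENNReal.tendsto_ofReal (h3.const_mul (2 * C))
      obtain ⟨n, hn1, hn2⟩ := ((hlim.eventually (ge_mem_nhds hδ)).and
        (eventually_ge_atTop n₀)).exists
      refine ⟨n, fun a ⟨b, hb, _, _, hab⟩ => ?_⟩
      exact (h n hn2 b hb a hab).trans hn1
  have hmod : β.caratheodory (β.shiftedGauge ℓ (fun a => (φ a : ℝ≥0∞))) p (OPlus.zero u)
      Set.univ ≤ 1 := by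
    -- the pieces of `Ω` are covered by balls of level `n`, whose number is controlled
    set ε := (θ ^ 3 * p - ∑ i, μ i) / 2 with hε
    have hεpos : 0 < ε := by rw [hε]; linarith
    choose W hW M hM n₀ hcov using fun z : Ω =>
      hψ.exists_cover hD hDo hμ hεpos hBcompact hB1 hΩ z.2
    obtain ⟨s, hs, hsU⟩ := TopologicalSpace.countable_cover_nhds
      (f := fun z : Ω => (Subtype.val ⁻¹' W z : Set Ω))
      (fun z => continuous_subtype_val.continuousAt.preimage_mem_nhds (hW z))
    refine β.caratheodory_univ_le_one (T := (fun z : Ω => (Subtype.val ⁻¹' W z : Set Ω)) '' s)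
      (hs.image _) (by rw [Set.sUnion_image]; exact hsU) ?_
    rintro _ ⟨z, -, rfl⟩ j η hη
    obtain ⟨n₁, hn₁, hosc⟩ := exists_oscillation_dilate_le (S := S) (Ω := Ω) hu hBconn.nonempty
        hC.le hθ0 hθ1 hfC ℓ
    have hlim : Tendsto (fun n : ℕ => ENNReal.ofReal ((2 * C) ^ (θ * p) * Real.exp (-(ε * n))) *
        M z) atTop (nhds 0) := by
      have h3 : Tendsto (fun n : ℕ => Real.exp (-(ε * n))) atTop (nhds 0) :=
        Real.tendsto_exp_neg_atTop_nhds_zero.comp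
          (tendsto_natCast_atTop_atTop.const_mul_atTop hεpos)
      have h4 := ENNReal.tendsto_ofReal (h3.const_mul ((2 * C) ^ (θ * p)))
      simpa using ENNReal.Tendsto.mul_const h4 (Or.inr (hM z))
    obtain ⟨n, hn, hn0, hnj, hn1⟩ := ((hlim.eventually (ge_mem_nhds hη)).and
      ((eventually_ge_atTop (n₀ z)).and ((eventually_ge_atTop j.toNat).and
        (eventually_ge_atTop n₁.toNat)))).exists
    replace hnj : j ≤ n := Int.toNat_le.1 hnj
    replace hn1 : n₁ ≤ n := Int.toNat_le.1 hn1
    obtain ⟨T, hTc, hTΩ, hTsub, hTcov, hTsum⟩ := hcov z n hn0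
    let A : N → Set Ω := fun x =>
      {y | (y : N) ∈ (S.generated B hBconn.nonempty).real (x, (n : ℤ))}
    have hself : ∀ (x : N) (j : ℤ), x ∈ (S.generated B hBconn.nonempty).real (x, j) :=
      fun x j => ⟨1, mem_of_mem_nhds hB1, by simp⟩
    have hgauge : ∀ x ∈ T, β.shiftedGauge ℓ (fun a => (φ a : ℝ≥0∞)) (A x) ≤
        ENNReal.ofReal (2 * C * Real.exp (-(θ ^ 2 * n))) ^ θ := by
      intro x hx
      refine iSup₂_le fun a' ⟨b, hbs, hbA, hAa', ha'b⟩ => ?_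
      -- the small ball `b` is connected and its trace on `Ω` lies in a compact subset of `Ω`,
      -- so that it is contained in `Ω`
      set P := (S.generated B hBconn.nonempty).real b.1 with hP
      set Q := (S.generated B hBconn.nonempty).real (x, (n : ℤ)) with hQ
      have hPcont : ∀ b : N × ℤ, Continuous fun y : N => b.1 * S.dilation (-(b.2 : ℝ)) y :=
        fun b => continuous_const.mul (S.continuous_dilation _)
      have hPconn : IsPreconnected P :=
        hBconn.isPreconnected.image _ (hPcont b.1).continuousOn
      have hQclosed : IsClosed Q := (hBcompact.image (hPcont (x, (n : ℤ)))).isClosed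
      have hQΩ : Q ⊆ Ω := by
        rw [hQ, generated_real_natCast]
        exact hTsub x hx
      have hPQ : ∀ y ∈ P, y ∈ Ω → y ∈ Q := fun y hy hyΩ =>
        hbA (show (⟨y, hyΩ⟩ : Ω) ∈ β.real b from hy)
      have hPsub : P ⊆ Q := by
        rcases isPreconnected_iff_subset_of_disjoint.1 hPconn Ω Qᶜ hΩ hQclosed.isOpen_compl
          (fun y _ => by
            by_cases hy : y ∈ Ω
            · exact Or.inl hy
            · exact Or.inr fun h => hy (hQΩ h))
          (by
            ext y
            simp only [Set.mem_inter_iff, Set.mem_compl_iff, Set.mem_empty_iff_false, iff_false]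
            exact fun h => h.2.2 (hPQ y h.1 h.2.1)) with h | h
        · exact fun y hy => hPQ y hy (h hy)
        · obtain ⟨y, hy⟩ := β.real_nonempty b
          exact absurd (hbA hy) (h (show (y : N) ∈ P from hy))
      have hlev : (n : ℤ) ≤ β.level b := by
        by_contra! hlt
        exact hβ.not_subset b.1 (x, (n : ℤ)) hlt hPsub
      have h1 := hosc n hn1 b hlev a' ha'b
      have h2 : (φ a' : ℝ≥0∞) = BallStructure.oscillation F a' ^ θ := congrFun hφ a'
      refine h2.le.trans ?_
      gcongr
      simpa using h1
    refine ⟨A '' T, hTc.image _, ?_, ?_, ?_⟩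
    · rintro _ ⟨x, hx, rfl⟩
      refine ⟨⟨(x, (n : ℤ)), fun k => ⟨x, hself x _, hTΩ hx⟩⟩, hnj, ?_, subset_rfl, ?_⟩
      · exact Int.natCast_nonneg n
      · exact fun y hy => (congrArg β.real (β.shift_zero _)).ge hy
    · intro y hy
      obtain ⟨x, hx, hyx⟩ := Set.mem_iUnion₂.1 (hTcov hy)
      refine ⟨A x, ⟨x, hx, rfl⟩, ?_⟩
      change (y : N) ∈ (S.generated B hBconn.nonempty).real (x, (n : ℤ))
      rwa [generated_real_natCast]
    · refine (ENNReal.tsum_image_le A T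
        (fun a => β.shiftedGauge ℓ (fun a => (φ a : ℝ≥0∞)) a ^ p)).trans ?_
      have hcost : (ENNReal.ofReal (2 * C * Real.exp (-(θ ^ 2 * n))) ^ θ) ^ p =
          ENNReal.ofReal ((2 * C) ^ (θ * p) * Real.exp (-(ε * n))) *
            ENNReal.ofReal (Real.exp (-((∑ i, μ i + ε) * n))) := by
        rw [← ENNReal.rpow_mul, ENNReal.ofReal_rpow_of_nonneg (by positivity) (by positivity),
          Real.mul_rpow (by positivity) (Real.exp_pos _).le,
          ← ENNReal.ofReal_mul (by positivity), mul_assoc, ← Real.exp_add, ← Real.exp_mul]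
        congr 3
        rw [hε]
        ring
      calc _ ≤ ∑' _x : T, ENNReal.ofReal ((2 * C) ^ (θ * p) * Real.exp (-(ε * n))) *
            ENNReal.ofReal (Real.exp (-((∑ i, μ i + ε) * n))) := by
            refine ENNReal.tsum_le_tsum fun x => ?_
            rw [← hcost]
            gcongr
            exact hgauge x x.2
        _ ≤ ENNReal.ofReal ((2 * C) ^ (θ * p) * Real.exp (-(ε * n))) * M z := by
            rw [ENNReal.tsum_mul_left]
            gcongr
        _ ≤ η := hn
  exact ne_top_of_le_ne_top ENNReal.one_ne_top (iInf₂_le_of_le φ hadm hmod)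

end HeintzeData

/-! ### Curves in open subsets -/

/-- A nonconstant curve of `X` contained in `Ω` is a curve of the subspace `Ω`. -/
theorem preimage_val_mem_nonconstantCurves {X : Type*} [TopologicalSpace X] {Ω : Set X} {J : Set ℝ}
    (hJ : J.OrdConnected) {c : ℝ → X} (hc : ContinuousOn c J) (hcΩ : c '' J ⊆ Ω)
    (hnt : (c '' J).Nontrivial) :
    (Subtype.val ⁻¹' (c '' J) : Set Ω) ∈ nonconstantCurves Ω := by
  classical
  obtain ⟨y, hy, z, hz, hyz⟩ := hnt
  let c' : ℝ → Ω := fun t => if h : c t ∈ Ω then ⟨c t, h⟩ else ⟨y, hcΩ hy⟩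
  have hval : ∀ t ∈ J, (c' t : X) = c t := by
    intro t ht
    have : c t ∈ Ω := hcΩ ⟨t, ht, rfl⟩
    simp [c', this]
  refine ⟨⟨⟨y, hcΩ hy⟩, hy, ⟨z, hcΩ hz⟩, hz, fun h => hyz (congrArg Subtype.val h)⟩, J, c',
    hJ, ?_, ?_⟩
  · exact Topology.IsInducing.subtypeVal.continuousOn_iff.2 (hc.congr hval)
  · ext w
    constructor
    · rintro ⟨t, ht, h⟩
      exact ⟨t, ht, Subtype.ext ((hval t ht).trans h)⟩
    · rintro ⟨t, ht, rfl⟩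
      exact ⟨t, ht, (hval t ht).symm⟩

/-! ### Self-similar arcs -/

/-- An arc `g`, parametrized by `[0, τ]`, such that increments over intervals of length
`τ exp (-n)` belong to the image of the arc by `D ^ n`. -/
structure IsDilationArc {N : Type*} [TopologicalSpace N] [Group N] (D : MulAut N) (τ : ℝ)
    (g : ℝ → N) : Prop where
  pos : 0 < τ
  continuousOn : ContinuousOn g (Set.Icc 0 τ)
  nonconstant : ∃ t ∈ Set.Icc 0 τ, g t ≠ g 0
  increment : ∀ n : ℕ, ∀ t₀ t, 0 ≤ t₀ → t₀ ≤ t → t ≤ τ → t - t₀ ≤ τ * Real.exp (-n) →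
    ∃ s ∈ Set.Icc 0 τ, (g t₀)⁻¹ * g t = (D ^ n) (g s)

namespace IsDilationArc

open MeasureTheory
open scoped Pointwise

variable {N : Type*} [TopologicalSpace N] [Group N] [IsTopologicalGroup N] {D : MulAut N}
  {ι : Type*} [Fintype ι] {μ : ι → ℝ} {ψ : OpenPartialHomeomorph N (ι → ℝ)} {τ : ℝ} {g : ℝ → N}

omit [IsTopologicalGroup N] in
theorem pow_apply (hg : IsDilationArc D τ g) (hD : Continuous D) (m : ℕ) :
    IsDilationArc D τ (fun t => (D ^ m) (g t)) where
  pos := hg.pos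
  continuousOn := by
    exact (MulAut.continuous_pow hD m).comp_continuousOn hg.continuousOn
  nonconstant := by
    obtain ⟨t, ht, h⟩ := hg.nonconstant
    exact ⟨t, ht, fun h' => h ((D ^ m : MulAut N).injective h')⟩
  increment n t₀ t h₀ h h₁ hn := by
    obtain ⟨s, hs, e⟩ := hg.increment n t₀ t h₀ h h₁ hn
    refine ⟨s, hs, ?_⟩
    rw [← map_inv, ← map_mul, e, ← MulAut.mul_apply, ← MulAut.mul_apply, ← pow_add, ← pow_add,
      add_comm]

/-- Volume of tubes: in dimension `∑ i, μ i`, the translates of the arc meeting `x (D ^ n B)` start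
in a set of volume at most of order `exp (-(∑ i, μ i - 1) n)`, since the arc is covered by `exp n`
translates of sets of size `exp (-n)`. -/
theorem exists_volume_tube_le [ConnectedSpace N] (hψ : IsDilationChart D μ ψ) (hD : Continuous D)
    (hμ : ∀ i, 1 ≤ μ i) {ε : ℝ} (hε : 0 < ε) {B : Set N} (hB : IsCompact B) :
    ∃ r > 0, ∀ τ g, IsDilationArc D τ g → (∀ t ∈ Set.Icc 0 τ, (g t)⁻¹ ∈ chartBall ψ r) →
      ∃ C > 0, ∃ n₀ : ℕ, ∀ n ≥ n₀, ∀ x ∈ chartBall ψ r,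
        volume (ψ '' {y | ∃ t ∈ Set.Icc 0 τ, y * g t ∈ (fun w => x * (D ^ n) w) '' B}) ≤
          ENNReal.ofReal (C * Real.exp (-((∑ i, μ i - 1 - ε) * n))) := by
  obtain ⟨r, hr, hvol⟩ := hψ.exists_volume_le hD hμ hε
  refine ⟨r, hr, fun τ g hg hgr => ?_⟩
  have hτ := hg.pos
  obtain ⟨C, hC, n₀, h⟩ := hvol (B * (g '' Set.Icc 0 τ)⁻¹)
    (hB.mul (isCompact_Icc.image_of_continuousOn hg.continuousOn).inv)
  refine ⟨2 * C, by positivity, n₀, fun n hn x hx => ?_⟩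
  have hen : 0 < τ * Real.exp (-n) := by positivity
  let J := ⌊Real.exp n⌋₊
  let s : ℕ → ℝ := fun j => j * (τ * Real.exp (-n))
  have hs : ∀ j ∈ Finset.range (J + 1), s j ∈ Set.Icc 0 τ := by
    intro j hj
    refine ⟨by positivity, ?_⟩
    have h1 : (j : ℝ) ≤ Real.exp n := (Nat.cast_le.2 (Nat.lt_succ_iff.1
      (Finset.mem_range.1 hj))).trans (Nat.floor_le (Real.exp_pos _).le)
    calc (j : ℝ) * (τ * Real.exp (-n)) ≤ Real.exp n * (τ * Real.exp (-n)) := by gcongr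
      _ = τ := by rw [mul_left_comm, ← Real.exp_add]; simp
  have hcov : {y | ∃ t ∈ Set.Icc 0 τ, y * g t ∈ (fun w => x * (D ^ n) w) '' B} ⊆
      ⋃ j ∈ Finset.range (J + 1),
        (fun k => x * (D ^ n) k * (g (s j))⁻¹) '' (B * (g '' Set.Icc 0 τ)⁻¹) := by
    rintro y ⟨t, ht, w, hw, hwy⟩
    have hwy : x * (D ^ n) w = y * g t := hwy
    set j := ⌊t / (τ * Real.exp (-n))⌋₊ with hj
    have hjt : s j ≤ t := by
      have := Nat.floor_le (a := t / (τ * Real.exp (-n))) (div_nonneg ht.1 hen.le)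
      rwa [le_div_iff₀ hen] at this
    have htj : t - s j ≤ τ * Real.exp (-n) := by
      have := Nat.lt_floor_add_one (t / (τ * Real.exp (-n)))
      rw [div_lt_iff₀ hen, add_mul, one_mul] at this
      exact (sub_lt_iff_lt_add'.2 this).le
    have hjJ : j ≤ J := by
      refine Nat.floor_le_floor ?_
      rw [div_le_iff₀ hen, mul_left_comm, ← Real.exp_add]
      simpa using ht.2
    have hjm : j ∈ Finset.range (J + 1) := Finset.mem_range.2 (Nat.lt_succ_of_le hjJ)
    obtain ⟨v, hv, hgv⟩ := hg.increment n (s j) t (hs j hjm).1 hjt ht.2 htj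
    refine Set.mem_iUnion₂.2 ⟨j, hjm, w * (g v)⁻¹,
      Set.mul_mem_mul hw (Set.inv_mem_inv.2 ⟨v, hv, rfl⟩), ?_⟩
    have h2 : y = x * (D ^ n) w * (g t)⁻¹ := by rw [hwy, mul_inv_cancel_right]
    simp only [map_mul, map_inv]
    rw [h2, ← hgv]
    group
  refine (measure_mono (Set.image_mono hcov)).trans ?_
  rw [Set.image_iUnion₂]
  refine (measure_biUnion_finset_le _ _).trans ?_
  calc _ ≤ ∑ _j ∈ Finset.range (J + 1),
        ENNReal.ofReal (C * Real.exp (-((∑ i, μ i - ε) * n))) :=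
        Finset.sum_le_sum fun j hj => h n hn x hx _ (hgr _ (hs j hj))
    _ = ENNReal.ofReal ((J + 1 : ℕ) * (C * Real.exp (-((∑ i, μ i - ε) * n)))) := by
        rw [Finset.sum_const, Finset.card_range, nsmul_eq_mul,
          ENNReal.ofReal_mul (Nat.cast_nonneg _),
          ENNReal.ofReal_natCast]
    _ ≤ _ := by
        refine ENNReal.ofReal_le_ofReal ?_
        have h1 : ((J + 1 : ℕ) : ℝ) ≤ 2 * Real.exp n := by
          have h2 : (J : ℝ) ≤ Real.exp n := Nat.floor_le (Real.exp_pos _).le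
          have h3 : 1 ≤ Real.exp (n : ℝ) := Real.one_le_exp (Nat.cast_nonneg n)
          push_cast
          linarith
        calc _ ≤ 2 * Real.exp n * (C * Real.exp (-((∑ i, μ i - ε) * n))) := by gcongr
          _ = 2 * C * (Real.exp n * Real.exp (-((∑ i, μ i - ε) * n))) := by ring
          _ = _ := by rw [← Real.exp_add]; ring_nf

end IsDilationArc

/-! ### The case of exponent one -/

namespace HeintzeData

variable {E : Type*} [NormedAddCommGroup E] [NormedSpace ℝ E] [FiniteDimensional ℝ E]
  {N : Type*} [TopologicalSpace N] [ChartedSpace E N] [Group N] [LieGroup 𝓘(ℝ, E) ∞ N]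
  {S : HeintzeData E N} [IsTopologicalGroup N] [ConnectedSpace N] {ι : Type*} [Fintype ι]
  {μ : ι → ℝ} {ψ : OpenPartialHomeomorph N (ι → ℝ)} {u : ℝ → ℝ} {B Ω : Set N}

/-- An admissible gauge has infinite total length, because there are arbitrarily many disjoint
compact curves. -/
theorem caratheodory_one_univ_eq_top [Nonempty ι] (hψ : IsDilationChart (S.dilation (-1)) μ ψ)
    (hμ : ∀ i, 1 ≤ μ i) (hu : IsAdmissible u) (hBcompact : IsCompact B) (hB : B.Nonempty)
    (hΩ : IsOpen Ω) (hΩne : Ω.Nonempty) (k : OPlus u) {φ : Set Ω → ℝ≥0}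
    (hφ : ((S.generated B hB).restrict Ω).AdmissibleGauge k (nonconstantCurves Ω) φ) :
    ((S.generated B hB).restrict Ω).caratheodory (fun a => (φ a : ℝ≥0∞)) 1 k Set.univ = ⊤ := by
  set β := (S.generated B hB).restrict Ω with hβdef
  refine β.caratheodory_univ_eq_top_of_separated fun M => ?_
  obtain ⟨o, ho⟩ := hΩne
  have hD := S.continuous_dilation (-1)
  obtain ⟨r, hr, hrt, hmul⟩ := hψ.exists_mul_approx one_pos
  have hW : chartBall ψ r ∩ (fun z => o * z) ⁻¹' Ω ∈ nhds (1 : N) := by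
    refine inter_mem (hψ.chartBall_mem_nhds hr)
      ((continuous_const_mul o).continuousAt.preimage_mem_nhds ?_)
    rw [mul_one]
    exact hΩ.mem_nhds ho
  obtain ⟨ρ, hρ, hρt, hρW⟩ := hψ.exists_ball_subset_preimage hW
  -- a coordinate segment, and equally spaced disjoint subsegments
  let c : ℝ → N := fun t => o * ψ.symm (fun _ => t)
  have hball : ∀ t ∈ Set.Icc 0 ρ, (fun _ : ι => t) ∈ Metric.closedBall (0 : ι → ℝ) ρ := by
    intro t ht
    rw [mem_closedBall_zero_iff, pi_norm_const, Real.norm_of_nonneg ht.1]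
    exact ht.2
  have hcc : ContinuousOn c (Set.Icc 0 ρ) := by
    refine continuousOn_const.mul (ψ.continuousOn_symm.comp
      (continuous_pi fun _ => continuous_id).continuousOn fun t ht => hρt (hball t ht))
  set δ := ρ / (2 * (M + 1)) with hδ
  have hδ0 : 0 < δ := by positivity
  have hδρ : 2 * (M + 1) * δ = ρ := by rw [hδ]; field_simp
  let J : Fin M → Set ℝ := fun j => Set.Icc (2 * (j : ℕ) * δ) (2 * (j : ℕ) * δ + δ)
  have hJρ : ∀ j, J j ⊆ Set.Icc 0 ρ := by
    intro j t ht
    have h1 : ((j : ℕ) : ℝ) + 1 ≤ M := by exact_mod_cast j.2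
    have h2 : (0 : ℝ) ≤ (j : ℕ) := Nat.cast_nonneg _
    refine ⟨le_trans (by positivity) ht.1, ht.2.trans ?_⟩
    nlinarith
  have hψc : ∀ t ∈ Set.Icc 0 ρ, ψ (ψ.symm (fun _ : ι => t)) = fun _ => t := fun t ht =>
    ψ.right_inv (hρt (hball t ht))
  obtain ⟨n₁, hn₁, hk⟩ := k.exists_forall_le_sub hu (ε := 1 / 2) (by norm_num)
  obtain ⟨n₂, hn₂⟩ := hψ.exists_forall_pow_mem hD hμ (hBcompact.inv.mul hBcompact)
    (r := min r (δ / 4)) (lt_min hr (by positivity))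
  refine ⟨fun j => Subtype.val ⁻¹' (c '' J j), fun j => hφ _ ?_, max n₁ (2 * n₂), ?_⟩
  · refine preimage_val_mem_nonconstantCurves Set.ordConnected_Icc (hcc.mono (hJρ j)) ?_ ?_
    · rintro _ ⟨t, ht, rfl⟩
      exact (hρW _ (hball t (hJρ j ht))).2
    · have h1 : 2 * (j : ℕ) * δ ∈ J j := ⟨le_rfl, by linarith⟩
      have h2 : 2 * (j : ℕ) * δ + δ ∈ J j := ⟨by linarith, le_rfl⟩
      refine ⟨_, ⟨_, h1, rfl⟩, _, ⟨_, h2, rfl⟩, fun h => ?_⟩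
      have h3 := congrArg ψ (mul_left_cancel h)
      rw [hψc _ (hJρ j h1), hψc _ (hJρ j h2)] at h3
      have h4 := congrFun h3 (Classical.arbitrary ι)
      linarith
  · rintro a ⟨⟨⟨x, l⟩, hbΩ⟩, hb1, -, -, hab⟩ i j ⟨y, hya, t, ht, hty⟩ ⟨y', hya', t', ht', hty'⟩
    have hl : max n₁ (2 * n₂) ≤ l := hb1
    -- the two points lie in a common small ball, hence have nearby coordinates
    have hm : (n₂ : ℝ) ≤ ((l - k.toFun l : ℤ) : ℝ) := by
      have h1 := hk l (le_of_max_le_left hl)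
      have h2 : (2 * n₂ : ℝ) ≤ l := by exact_mod_cast le_of_max_le_right hl
      linarith
    obtain ⟨m, hm'⟩ : ∃ m : ℕ, l - k.toFun l = m := Int.eq_ofNat_of_zero_le (by
      have : (n₂ : ℤ) ≤ l - k.toFun l := by exact_mod_cast hm
      omega)
    have hmn : n₂ ≤ m := by
      rw [hm'] at hm
      exact_mod_cast hm
    have hreal : ∀ y : Ω, y ∈ a → (y : N) ∈ (fun w => x * (S.dilation (-1) ^ m) w) '' B := by
      intro y hy
      rw [← generated_real_natCast S hB, ← hm']
      exact hab hy
    obtain ⟨v, hv, hvy⟩ := hreal y hya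
    obtain ⟨v', hv', hvy'⟩ := hreal y' hya'
    have hw := hn₂ m hmn (v⁻¹ * v') (Set.mul_mem_mul (Set.inv_mem_inv.2 hv) hv')
    set w := (S.dilation (-1) ^ m) (v⁻¹ * v') with hwdef
    have hyw : c t' = c t * w := by
      rw [hty, hty', ← hvy, ← hvy', hwdef]
      simp [mul_assoc]
    have hyw' : ψ.symm (fun _ : ι => t') = ψ.symm (fun _ => t) * w := by
      have : o * ψ.symm (fun _ : ι => t') = o * (ψ.symm (fun _ => t) * w) := by
        rw [← mul_assoc]; exact hyw
      exact mul_left_cancel this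
    have h1 := (hmul _ (hρW _ (hball t (hJρ i ht))).1 1 (hψ.one_mem_chartBall hr)).2 w
      (chartBall_mono ψ (min_le_left _ _) hw) 1 (hψ.one_mem_chartBall hr)
    simp only [mul_one, ← hyw', hψc t' (hJρ j ht'), hψc t (hJρ i ht), hψ.map_one, sub_zero,
      one_mul] at h1
    have h2 : |t' - t| ≤ 2 * ‖ψ w‖ := by
      have h3 : ‖(fun _ : ι => t') - (fun _ : ι => t)‖ = |t' - t| := by
        rw [← Real.norm_eq_abs, ← pi_norm_const (ι := ι) (t' - t)]
        rfl
      have h4 := norm_sub_norm_le ((fun _ : ι => t') - (fun _ : ι => t)) (ψ w)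
      linarith
    have h3 : ‖ψ w‖ < δ / 4 := (norm_lt_of_mem_chartBall hw).trans_le (min_le_right _ _)
    have h4 := abs_lt.1 (show |t' - t| < δ by linarith)
    have h5 : ∀ p q : ℕ, ∀ s s' : ℝ, 2 * p * δ ≤ s → s' ≤ 2 * q * δ + δ → s - s' < δ → p ≤ q := by
      intro p q s s' hs hs' hss
      by_contra! hpq
      have : (q : ℝ) + 1 ≤ p := by exact_mod_cast hpq
      nlinarith
    refine Fin.ext (le_antisymm ?_ ?_)
    · exact h5 _ _ t t' ht.1 ht'.2 (by linarith)
    · exact h5 _ _ t' t ht'.1 ht.2 (by linarith)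

end HeintzeData

/-! ### Disjoint subfamilies of balls -/

namespace BallStructure

/-- The basic covering lemma in a quasisymmetric structure: from a family of balls one can extract
disjoint balls whose enlargements by a constant shift contain all the balls of the family. -/
theorem IsQuasisymmetric.exists_disjoint_subfamily {Z : Type*} {β : BallStructure Z}
    (hβ : β.IsQuasisymmetric (fun _ => 1)) :
    ∃ (Q : ℕ) (n₀ : ℤ), ∀ {A : Type*} (s : Set A) (b : A → β.Ball),
      (∀ a ∈ s, n₀ ≤ β.level (b a)) → ∃ I ⊆ s, I.PairwiseDisjoint (fun a => β.real (b a)) ∧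
        ∀ a ∈ s, ∃ c ∈ I, β.real (b a) ⊆ β.real (β.shift Q (b c)) := by
  obtain ⟨q, hq0, hq⟩ := hβ.engulf
  obtain ⟨Q, n₁, hQ⟩ := OPlus.exists_bound_of_one q
  refine ⟨Q, max n₁ q.start, fun s b hb => ?_⟩
  obtain ⟨I, hI, hdisj, hcov⟩ := Vitali.exists_disjoint_subfamily_covering_enlargement
    (fun a => β.real (b a)) s (fun a => Real.exp (-(β.level (b a)))) 2 one_lt_two
    (fun a _ => (Real.exp_pos _).le) 1
    (fun a ha => Real.exp_le_one_iff.2 (neg_nonpos.2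
      (Int.cast_nonneg (hq0.trans ((le_max_right _ _).trans (hb a ha))))))
    (fun a _ => β.real_nonempty _)
  refine ⟨I, hI, hdisj, fun a ha => ?_⟩
  obtain ⟨c, hc, hne, hle⟩ := hcov a ha
  have hlevel : β.level (b c) ≤ β.level (b a) := by
    -- the levels are integers, and the factor `2` is less than `exp 1`
    have h1 : Real.exp (-(β.level (b a) : ℝ)) < Real.exp (1 - β.level (b c)) := by
      refine hle.trans_lt ?_
      rw [sub_eq_add_neg, Real.exp_add]
      have := Real.exp_one_gt_two
      gcongr
    have h2 := Real.exp_lt_exp.1 h1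
    have h3 : (β.level (b c) : ℝ) < β.level (b a) + 1 := by linarith
    exact Int.lt_add_one_iff.1 (by exact_mod_cast h3)
  have hbc := hb c (hI hc)
  refine ⟨c, hc, (hq (b c) (b a) (le_of_max_le_right hbc) hlevel
    (by rwa [Set.inter_comm])).trans ?_⟩
  have h4 := hβ.subset_shift (Q - q.toFun (β.level (b c)))
    (β.shift (q.toFun (β.level (b c))) (b c))
  rwa [β.shift_shift, Nat.sub_add_cancel (hQ _ (le_of_max_le_left hbc))] at h4

end BallStructure

/-! ### Infinite modulus below the dimension -/

namespace HeintzeData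

open MeasureTheory

variable {E : Type*} [NormedAddCommGroup E] [NormedSpace ℝ E] [FiniteDimensional ℝ E]
  {N : Type*} [TopologicalSpace N] [ChartedSpace E N] [Group N] [LieGroup 𝓘(ℝ, E) ∞ N]
  {S : HeintzeData E N} [IsTopologicalGroup N] [ConnectedSpace N] {ι : Type*} [Fintype ι]
  {μ : ι → ℝ} {ψ : OpenPartialHomeomorph N (ι → ℝ)} {u : ℝ → ℝ} {B Ω : Set N}

/-- For `p = 1`, the modulus of the nonconstant curves is infinite: if `ℓ = k`, then `(a, a)` is an
`ℓ`-ring for every `k`-round set `a`, so that the shifted gauge is at least the gauge itself. -/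
theorem modulus_one_eq_top [Nonempty ι] (hψ : IsDilationChart (S.dilation (-1)) μ ψ)
    (hμ : ∀ i, 1 ≤ μ i) (hu : IsAdmissible u) (hBcompact : IsCompact B) (hB : B.Nonempty)
    (hΩ : IsOpen Ω) (hΩne : Ω.Nonempty) (k : OPlus u) :
    ((S.generated B hB).restrict Ω).modulus 1 k k k (nonconstantCurves Ω) = ⊤ := by
  refine iInf₂_eq_top.2 fun φ hφ => ?_
  have h := caratheodory_one_univ_eq_top hψ hμ hu hBcompact hB hΩ hΩne k hφ
  rw [eq_top_iff, ← h]
  refine iSup_mono fun n => BallStructure.le_preCaratheodory fun F hF hround hcov => ?_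
  refine (BallStructure.preCaratheodory_le hF hround hcov).trans
    (ENNReal.tsum_le_tsum fun a => ?_)
  obtain ⟨b, -, hb, hba, hab⟩ := hround a a.2
  gcongr
  exact BallStructure.le_shiftedGauge _ _ ⟨b, hb, hba, subset_rfl, hab⟩

/-- For `1 < p < ∑ i, μ i`, the modulus of the nonconstant curves is infinite for gauges of
asphericity differing by a large constant. The curves tested are the left translates of a small
self-similar arc. -/
theorem exists_modulus_addConst_eq_top (hψ : IsDilationChart (S.dilation (-1)) μ ψ)
    (hμ : ∀ i, 1 ≤ μ i) (hu : IsAdmissible u) (hBcompact : IsCompact B) (hB : B.Nonempty)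
    (hB1 : B ∈ nhds (1 : N)) (hβ : (S.generated B hB).IsQuasisymmetric (fun _ => 1))
    (hΩ : IsOpen Ω) (hΩne : Ω.Nonempty) {τ : ℝ} {g : ℝ → N}
    (hg : IsDilationArc (S.dilation (-1)) τ g) {p : ℝ} (hp1 : 1 < p) (hp : p < ∑ i, μ i) :
    ∃ Q : ℕ, ∀ k : OPlus u, ((S.generated B hB).restrict Ω).modulus p k (k.addConst hu Q)
      (k.addConst hu Q) (nonconstantCurves Ω) = ⊤ := by
  classical
  set G := S.generated B hB with hG
  set β := G.restrict Ω with hβdef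
  set h := ∑ i, μ i with hh
  have hD := S.continuous_dilation (-1)
  have hDo := S.isOpenMap_dilation (-1)
  obtain ⟨o, ho⟩ := hΩne
  obtain ⟨Q, n₁, hcovering⟩ := hβ.exists_disjoint_subfamily
  refine ⟨Q, fun k => iInf₂_eq_top.2 fun φ hφ => ?_⟩
  set ℓ := k.addConst hu Q with hℓ
  -- `σ` lies strictly between `1` and `(h - 1) / (p - 1)`; then `ε` is small
  set σ : ℝ := (1 + (h - 1) / (p - 1)) / 2 with hσ
  have hp10 : 0 < p - 1 := by linarith
  have hdiv : 1 < (h - 1) / (p - 1) := by rw [one_lt_div hp10]; linarith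
  have hσ1 : 1 < σ := by rw [hσ]; linarith
  have hσp : σ * (p - 1) < h - 1 := by
    rw [← lt_div_iff₀ hp10, hσ]; linarith
  obtain ⟨ε, hε1, hε2, hε3, hε⟩ : ∃ ε : ℝ, σ * (p - 1) < (h - 1 - ε) * (1 - ε) ∧
      h + ε < (h - 1 - ε) * (1 - ε) + σ ∧ ε < min (h - 1) 1 ∧ 0 < ε := by
    have hc1 : Tendsto (fun ε : ℝ => (h - 1 - ε) * (1 - ε)) (nhdsWithin 0 (Set.Ioi 0))
        (nhds (h - 1)) := by
      have : Continuous (fun ε : ℝ => (h - 1 - ε) * (1 - ε)) := by fun_prop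
      simpa using (this.tendsto 0).mono_left nhdsWithin_le_nhds
    have hc2 : Tendsto (fun ε : ℝ => (h - 1 - ε) * (1 - ε) + σ - (h + ε))
        (nhdsWithin 0 (Set.Ioi 0)) (nhds (h - 1 + σ - h)) := by
      have : Continuous (fun ε : ℝ => (h - 1 - ε) * (1 - ε) + σ - (h + ε)) := by fun_prop
      simpa using (this.tendsto 0).mono_left nhdsWithin_le_nhds
    have hc3 : ∀ᶠ ε : ℝ in nhdsWithin 0 (Set.Ioi 0), ε ∈ Set.Ioo 0 (min (h - 1) 1) :=
      Ioo_mem_nhdsGT (lt_min (by linarith) one_pos)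
    obtain ⟨ε, h1, h2, h3⟩ := ((hc1.eventually (lt_mem_nhds hσp)).and
      ((hc2.eventually (lt_mem_nhds (show 0 < h - 1 + σ - h by linarith))).and hc3)).exists
    exact ⟨ε, h1, by linarith, h3.2, h3.1⟩
  have hεh := hε3.trans_le (min_le_left _ _)
  have hε1' := hε3.trans_le (min_le_right _ _)
  obtain ⟨rp, hrp, U, -, hU1, hUB, M, hM, hpack⟩ :=
    hψ.exists_tsum_le_of_disjoint hD hDo hμ hε hB1
  obtain ⟨rv, hrv, htube⟩ := IsDilationArc.exists_volume_tube_le hψ hD hμ hε hBcompact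
  obtain ⟨r', hr', n₂, hsub⟩ := hψ.exists_forall_subset hD hμ hBcompact hΩ ho (lt_min hrp hrv)
  have hW : (fun z => o * z) ⁻¹' Ω ∩ chartBall ψ r' ∈ nhds (1 : N) := by
    refine inter_mem ((continuous_const_mul o).continuousAt.preimage_mem_nhds ?_)
      (hψ.chartBall_mem_nhds hr')
    rw [mul_one]
    exact hΩ.mem_nhds ho
  obtain ⟨r₁, hr₁, hmul⟩ := hψ.exists_chartBall_mul_subset hW
  obtain ⟨ρ, hρ, hρt, hρr₁⟩ := hψ.exists_ball_subset_preimage (hψ.chartBall_mem_nhds hr₁)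
  -- the arc is contracted until its translates stay close to `o`
  have hgK := isCompact_Icc.image_of_continuousOn hg.continuousOn
  obtain ⟨m, hm⟩ := hψ.exists_forall_pow_mem hD hμ (hgK.union hgK.inv) (lt_min hr₁ hrv)
  obtain ⟨f, hf, hf1, hf2⟩ : ∃ f, IsDilationArc (S.dilation (-1)) τ f ∧
      (∀ t ∈ Set.Icc 0 τ, f t ∈ chartBall ψ r₁) ∧
      (∀ t ∈ Set.Icc 0 τ, (f t)⁻¹ ∈ chartBall ψ rv) := by
    refine ⟨_, hg.pow_apply hD m, fun t ht => ?_, fun t ht => ?_⟩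
    · exact chartBall_mono ψ (min_le_left _ _) (hm m le_rfl _ (Or.inl ⟨t, ht, rfl⟩))
    · rw [← map_inv]
      exact chartBall_mono ψ (min_le_right _ _)
        (hm m le_rfl _ (Or.inr (Set.inv_mem_inv.2 ⟨t, ht, rfl⟩)))
  obtain ⟨C, hC, n₃, hvol⟩ := htube τ f hf hf2
  have hγW : ∀ z ∈ Metric.ball (0 : ι → ℝ) ρ, ∀ t ∈ Set.Icc 0 τ,
      o * ψ.symm z * f t ∈ Ω ∧ ψ.symm z * f t ∈ chartBall ψ r' := by
    intro z hz t ht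
    have := (hmul _ (hρr₁ z (Metric.ball_subset_closedBall hz)) _ (hf1 t ht)).1
    rw [mul_assoc]
    exact this
  obtain ⟨n₄, hn₄, hkε⟩ := ℓ.exists_forall_le_sub hu hε
  obtain ⟨n₅, hn₅⟩ := exists_nat_gt
    ((max (max (n₁ : ℝ) n₂) (max n₃ n₄)) / (1 - ε))
  have hεpos : 0 < 1 - ε := by linarith
  rw [div_lt_iff₀ hεpos] at hn₅
  refine β.caratheodory_univ_eq_top_of_selection (k := k) (ℓ := ℓ) (φ := φ) (p := p) (σ := σ)
    (κ := (h - 1 - ε) * (1 - ε)) (q := h + ε) hp1.le hε1 hε2 volume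
    (G := Metric.ball (0 : ι → ℝ) ρ) (Metric.measure_ball_pos _ _ hρ)
    (fun z => Subtype.val ⁻¹' ((fun t => o * ψ.symm z * f t) '' Set.Icc 0 τ))
    (fun z hz => hφ _ (preimage_val_mem_nonconstantCurves Set.ordConnected_Icc
      (continuousOn_const.mul hf.continuousOn) ?_ ?_)) hM (ENNReal.ofReal_ne_top (r := C))
    ⟨max n₄ n₅, fun n hn F hF hround hcov => ?_⟩
  · rintro _ ⟨t, ht, rfl⟩
    exact (hγW z hz t ht).1
  · obtain ⟨t, ht, htne⟩ := hf.nonconstant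
    exact ⟨_, ⟨t, ht, rfl⟩, _, ⟨0, ⟨le_rfl, hf.pos.le⟩, rfl⟩,
      fun e => htne (mul_left_cancel e)⟩
  have hcenter : ∀ (x : N) (j : ℤ), x ∈ G.real (x, j) :=
    fun x j => ⟨1, mem_of_mem_nhds hB1, by simp⟩
  -- for sets outside of `F` the ball is a dummy, needed to have a function defined everywhere
  have hround' : ∀ a : Set Ω, ∃ b : β.Ball, a ∈ F → n ≤ β.level b ∧ k.start ≤ β.level b ∧
      β.real b ⊆ a ∧ a ⊆ β.real (β.dilate k b) := by
    intro a
    by_cases ha : a ∈ F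
    · obtain ⟨b, hb⟩ := hround a ha
      exact ⟨b, fun _ => hb⟩
    · exact ⟨⟨(o, 0), fun j => ⟨o, hcenter o _, ho⟩⟩, fun h => absurd h ha⟩
  choose b hb using hround'
  -- levels are large, even after dilation
  have hlev : ∀ a ∈ F, n ≤ (b a).1.2 := fun a ha => (hb a ha).1
  have hlarge : ∀ a ∈ F, (1 - ε) * ((b a).1.2 : ℝ) ≤ ((b a).1.2 - ℓ.toFun (b a).1.2 : ℤ) ∧
      max (max (n₁ : ℝ) n₂) (max n₃ n₄) ≤ ((b a).1.2 - ℓ.toFun (b a).1.2 : ℤ) := by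
    intro a ha
    have h1 := hkε (b a).1.2 ((le_of_max_le_left hn).trans (hlev a ha))
    refine ⟨h1, hn₅.le.trans (le_trans ?_ h1)⟩
    rw [mul_comm]
    have h2 : ((n₅ : ℤ) : ℝ) ≤ ((b a).1.2 : ℝ) :=
      Int.cast_le.2 ((le_of_max_le_right hn).trans (hlev a ha))
    rw [Int.cast_natCast] at h2
    gcongr
  have hkℓ : ∀ j : ℤ, j - ℓ.toFun j ≤ j - k.toFun j := by
    intro j
    have : ℓ.toFun j = k.toFun j + Q := rfl
    rw [this]
    push_cast
    linarith
  let P : Set Ω → N × ℤ := fun a => ((b a).1.1, (b a).1.2 - k.toFun (b a).1.2)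
  have haP : ∀ a ∈ F, ∀ y ∈ a, (y : N) ∈ G.real (P a) := fun a ha y hy => (hb a ha).2.2.2 hy
  have hreal : ∀ (x : N) (j : ℤ), 0 ≤ j → G.real (x, j) =
      (fun y => x * (S.dilation (-1) ^ j.toNat) y) '' B := by
    intro x j hj
    obtain ⟨i, rfl⟩ := Int.eq_ofNat_of_zero_le hj
    exact generated_real_natCast S hB x i
  -- only the round sets coming close to `o` can meet the curves; a disjoint family of
  -- enlarged balls is extracted from those
  let I₀ : Set (Set Ω) := {a ∈ F | ∃ y ∈ a, o⁻¹ * (y : N) ∈ chartBall ψ r'}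
  obtain ⟨I, hI, hdisj, hengulf⟩ := hcovering I₀ P (fun a ha => by
    have h1 : (n₁ : ℝ) ≤ ((b a).1.2 - ℓ.toFun (b a).1.2 : ℤ) :=
      ((le_max_left _ _).trans (le_max_left _ _)).trans (hlarge a ha.1).2
    exact (Int.cast_le.1 h1).trans (hkℓ _))
  have hIF : I ⊆ F := fun a ha => (hI ha).1
  have hdil : ∀ a (y : Ω), y ∈ β.real (β.dilate ℓ (b a)) ↔
      (y : N) ∈ G.real ((b a).1.1, (b a).1.2 - ℓ.toFun (b a).1.2) := fun _ _ => Iff.rfl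
  have hshift : ∀ a, G.shift Q (P a) = ((b a).1.1, (b a).1.2 - ℓ.toFun (b a).1.2) := by
    intro a
    refine Prod.ext rfl ?_
    change (b a).1.2 - (k.toFun (b a).1.2 : ℤ) - Q = (b a).1.2 - ((k.toFun (b a).1.2 + Q : ℕ) : ℤ)
    push_cast
    ring
  have haℓ : ∀ a ∈ F, a ⊆ β.real (β.dilate ℓ (b a)) := by
    intro a ha y hy
    rw [hdil, ← hshift]
    exact hβ.subset_shift Q _ (haP a ha y hy)
  -- the centers of the selected balls are close to `o`
  have hxr : ∀ a ∈ I, o⁻¹ * (b a).1.1 ∈ chartBall ψ (min rp rv) := by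
    intro a ha
    obtain ⟨haF, y, hy, hyr⟩ := hI ha
    have h0 : (n₂ : ℝ) ≤ ((b a).1.2 - ℓ.toFun (b a).1.2 : ℤ) :=
      ((le_max_right _ _).trans (le_max_left _ _)).trans (hlarge a haF).2
    have h1 : (n₂ : ℤ) ≤ (b a).1.2 - k.toFun (b a).1.2 :=
      le_trans (by exact_mod_cast h0) (hkℓ _)
    have h2 : G.real (P a) = _ := hreal (b a).1.1 ((b a).1.2 - k.toFun (b a).1.2) (by omega)
    refine (hsub _ (by omega) (b a).1.1 y (h2 ▸ haP a haF y hy) hyr).2 _ ?_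
    rw [← h2]
    exact hcenter _ _
  refine ⟨I, hIF, fun a => β.real (β.dilate ℓ (b a)), fun a => (b a).1.2, ?_, ?_, ?_, ?_, ?_, ?_⟩
  · intro a ha
    obtain ⟨h1, h2, h3, -⟩ := hb a (hIF ha)
    exact ⟨b a, h1, h2, h3.trans (haℓ a (hIF ha)), subset_rfl⟩
  · intro a ha
    obtain ⟨h1, h2, h3, -⟩ := hb a (hIF ha)
    exact β.le_shiftedGauge (fun a => (φ a : ℝ≥0∞)) ⟨b a, h2, h3, haℓ a (hIF ha), subset_rfl⟩
  · rintro z hz y ⟨t, ht, hty⟩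
    have hty : o * ψ.symm z * f t = y := hty
    obtain ⟨a, ha, hya⟩ := hcov (Set.mem_univ y)
    have ha0 : a ∈ I₀ := by
      refine ⟨ha, y, hya, ?_⟩
      rw [← hty, mul_assoc, inv_mul_cancel_left]
      exact (hγW z hz t ht).2
    obtain ⟨c, hc, hac⟩ := hengulf a ha0
    refine Set.mem_iUnion₂.2 ⟨c, hc, (hdil c y).2 ?_⟩
    rw [← hshift]
    exact hac (haP a ha y hya)
  · intro a ha
    exact Int.cast_le.2 (hlev a (hIF ha))
  · intro a ha
    set L := (b a).1.2 with hL
    obtain ⟨h1, h2⟩ := hlarge a (hIF ha)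
    rw [← hL] at h1 h2
    have h3 : (n₃ : ℝ) ≤ (L - ℓ.toFun L : ℤ) :=
      ((le_max_left _ _).trans (le_max_right _ _)).trans h2
    have h4 : (n₃ : ℤ) ≤ L - ℓ.toFun L := by exact_mod_cast h3
    have h5 := hvol (L - ℓ.toFun L).toNat (by omega) _
      (chartBall_mono ψ (min_le_right _ _) (hxr a ha))
    -- the curves meeting the enlarged ball start in the tube estimated by `hvol`
    refine (measure_mono ?_).trans (h5.trans ?_)
    · rintro z ⟨hz, y, ⟨t, ht, hty⟩, hy⟩
      have hty : o * ψ.symm z * f t = y := hty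
      refine ⟨ψ.symm z, ⟨t, ht, ?_⟩, ψ.right_inv (hρt (Metric.ball_subset_closedBall hz))⟩
      replace hy := (hdil a y).1 hy
      rw [← hL, hreal _ _ (by omega)] at hy
      obtain ⟨w, hw, hwy⟩ := hy
      refine ⟨w, hw, ?_⟩
      have hwy : (b a).1.1 * (S.dilation (-1) ^ (L - ℓ.toFun L).toNat) w = y := hwy
      have : ψ.symm z * f t = o⁻¹ * y := by rw [← hty, mul_assoc, inv_mul_cancel_left]
      rw [this, ← hwy]
      exact mul_assoc _ _ _
    · rw [← ENNReal.ofReal_mul hC.le]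
      refine ENNReal.ofReal_le_ofReal ?_
      have h6 : (((L - ℓ.toFun L).toNat : ℕ) : ℝ) = (L - ℓ.toFun L : ℤ) := by
        have : (((L - ℓ.toFun L).toNat : ℕ) : ℤ) = L - ℓ.toFun L := Int.toNat_of_nonneg (by omega)
        exact_mod_cast congrArg (fun j : ℤ => (j : ℝ)) this
      rw [h6, mul_assoc (h - 1 - ε)]
      have h7 : 0 ≤ h - 1 - ε := by linarith
      gcongr
  · have : Countable I := hF.mono hIF
    have hL0 : ∀ a ∈ F, 0 ≤ (b a).1.2 := fun a ha =>
      hn₄.trans ((le_of_max_le_left hn).trans (hlev a ha))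
    have h1 := hpack I o (fun a => (b a).1.1) (fun a => (b a).1.2.toNat)
      (fun a => chartBall_mono ψ (min_le_left _ _) (hxr a a.2)) (by
        intro a c hac
        have hUP : ∀ a ∈ F, (fun y => (b a).1.1 * (S.dilation (-1) ^ (b a).1.2.toNat) y) '' U ⊆
            G.real (P a) := by
          intro a ha
          refine Set.Subset.trans ?_ (hβ.subset_shift (k.toFun (b a).1.2) (b a).1)
          rw [show (b a).1 = ((b a).1.1, (b a).1.2) from rfl, hreal _ _ (hL0 a ha)]
          refine Set.image_mono fun y hy => ?_
          simpa using hUB y hy 1 hU1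
        exact (hdisj a.2 c.2 fun e => hac (Subtype.ext e)).mono (hUP a (hIF a.2))
          (hUP c (hIF c.2)))
    refine le_trans (le_of_eq (tsum_congr fun a => ?_)) h1
    have h2 : (((b a).1.2.toNat : ℕ) : ℝ) = ((b a).1.2 : ℝ) := by
      have := Int.toNat_of_nonneg (hL0 a (hIF a.2))
      exact_mod_cast congrArg (fun j : ℤ => (j : ℝ)) this
    rw [h2]

end HeintzeData

end

theorem mainTheorem4 {E : Type*} [NormedAddCommGroup E] [NormedSpace ℝ E] [FiniteDimensional ℝ E]
    {N : Type*} [TopologicalSpace N] [T2Space N] [SecondCountableTopology N] [ChartedSpace E N]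
    [Group N] [LieGroup 𝓘(ℝ, E) ∞ N]
    (S : HeintzeData E N) (hS : S.IsNormalizedDiagonalizable)
    (u : ℝ → ℝ) (hu : IsAdmissible u)
    (B : Set N) (hBcompact : IsCompact B) (hBconn : IsConnected B) (hB1 : (1 : N) ∈ interior B)
    (hβ : (S.generated B hBconn.nonempty).IsQuasisymmetric (fun _ => 1))
    (Ω : Set N) (hΩ : IsOpen Ω) (hΩne : Ω.Nonempty) :
    ((S.generated B hBconn.nonempty).restrict Ω).conformalDimension u (nonconstantCurves Ω) =
      ENNReal.ofReal (LinearMap.trace ℝ (GroupLieAlgebra 𝓘(ℝ, E) N) S.endα) := by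
  have : IsTopologicalGroup N := topologicalGroup_of_lieGroup 𝓘(ℝ, E) ∞
  have : SimplyConnectedSpace N := hS.simplyConnected
  have hB : B ∈ nhds (1 : N) := mem_interior_iff_mem_nhds.1 hB1
  obtain ⟨ι, hι, μ, b, hb⟩ := exists_eigenbasis (E := E) S.endα hS.diagonalizable
  have htrace : LinearMap.trace ℝ (GroupLieAlgebra 𝓘(ℝ, E) N) S.endα = ∑ i, μ i :=
    trace_eq_sum_of_eigenbasis (E := E) S.endα b hb
  have hμ : ∀ i, 1 ≤ μ i := fun i => hS.lowest.2
    (Module.End.hasEigenvalue_of_hasEigenvector (f := S.endα) (x := b i)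
      ⟨Module.End.mem_eigenspace_iff.2 (hb i), b.ne_zero i⟩)
  obtain ⟨v, hv⟩ := hS.lowest.1.exists_hasEigenvector
  have hv1 : S.endα v = v := by
    have := hv.apply_eq_smul
    rwa [one_smul] at this
  have hι' : Nonempty ι := by
    by_contra h
    rw [not_nonempty_iff] at h
    exact hv.2 (b.ext_elem (fun i => isEmptyElim i) : (v : E) = 0)
  have hψ : IsDilationChart (S.dilation (-1)) μ (coordChart N b) := by
    refine isDilationChart_coordChart b _ (S.contMDiff_dilation (-1)) fun i => ?_
    have := S.mfderiv_dilation_eigenvector (-1) (μ i) (v := b i) (hb i)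
    rwa [neg_one_mul] at this
  obtain ⟨τ, hτ, g, hgc, hgne, hginc⟩ := S.exists_arc hv1 hv.2
  have hg : IsDilationArc (S.dilation (-1)) τ g := ⟨hτ, hgc, hgne, hginc⟩
  rw [htrace]
  refine le_antisymm (iSup₂_le fun p hp => ENNReal.ofReal_le_ofReal ?_) ?_
  · by_contra! hlt
    obtain ⟨ℓ, m, h⟩ := hp.2 (OPlus.zero u)
    exact HeintzeData.modulus_zero_ne_top hψ hμ hu hBcompact hBconn hB hβ hΩ hlt ℓ m h
  · have hle : ∀ p : ℝ, 1 ≤ p → p < ∑ i, μ i ∨ p = 1 → ENNReal.ofReal p ≤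
        ((S.generated B hBconn.nonempty).restrict Ω).conformalDimension u
          (nonconstantCurves Ω) := by
      intro p hp1 hp
      refine le_iSup₂_of_le p ⟨by linarith, fun k => ?_⟩ le_rfl
      rcases hp1.eq_or_lt with rfl | hp1
      · exact ⟨k, k, HeintzeData.modulus_one_eq_top hψ hμ hu hBcompact hBconn.nonempty hΩ hΩne k⟩
      · obtain ⟨Q, hQ⟩ := HeintzeData.exists_modulus_addConst_eq_top hψ hμ hu hBcompact
          hBconn.nonempty hB hβ hΩ hΩne hg hp1 (hp.resolve_right hp1.ne')
        exact ⟨_, _, hQ k⟩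
    have hsum : 1 ≤ ∑ i, μ i :=
      (hμ (Classical.arbitrary ι)).trans (Finset.single_le_sum (f := μ)
        (fun i _ => zero_le_one.trans (hμ i)) (Finset.mem_univ _))
    -- if the trace is `1`, it is attained by `p = 1`; otherwise it is the limit of smaller `p > 1`
    rcases hsum.eq_or_lt with h1 | h1
    · rw [← h1]
      exact hle 1 le_rfl (Or.inr rfl)
    · have hlim : Tendsto ENNReal.ofReal (nhdsWithin (∑ i, μ i) (Set.Iio (∑ i, μ i)))
          (nhds (ENNReal.ofReal (∑ i, μ i))) :=
        (ENNReal.continuous_ofReal.tendsto _).mono_left nhdsWithin_le_nhds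
      refine le_of_tendsto hlim ?_
      filter_upwards [Ioo_mem_nhdsLT h1] with p hp
      exact hle p hp.1.le (Or.inl hp.2)
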